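/- Let $\mu$ be a finite positive Borel measure on $\mathbb C$ whose support is compact and infinite, and let $E=\sigma_{\rm ess}(\mu)$ be the (compact) set of nonisolated points of $\operatorname{supp}\mu$. Let $X_n$ and $x_n=X_n/\|X_n\|_{L^2(\mu)}$ be the monic orthogonal and the orthonormal polynomials of $\mu$. For a probability measure $\rho$ of compact support let $\Phi_\rho(z)=\int\log|z-w|^{-1}\,d\rho(w)$ and $\mathcal E(\rho)=\int\Phi_\rho\,d\rho$. The capacity of a Borel set $X$ is $C(X)=\exp(-\inf\mathcal E(\rho))$, the infimum being over the probability measures $\rho$ whose support is a compact subset of $X$ (so $C(X)=0$ if all these energies are $+\infty$). "q.e." means: outside a Borel set of capacity zero. If $C(E)>0$, let $\rho_E$ be the equilibrium measure (the unique probability measure on $E$ with $\mathcal E(\rho_E)=\log(C(E)^{-1})$) and $G_E(z)=\log(C(E)^{-1})-\Phi_{\rho_E}(z)$ the Green's function of $E$; if $C(E)=0$, put $G_E\equiv+\infty$ and $e^{+\infty}=+\infty$. Let $\Omega$ be the unbounded connected component of $\mathbb C\setminus E$. Then the following are equivalent: (i) $\mu$ is regular, that is, $\lim_{n\to\infty}\|X_n\|_{L^2(\mu)}^{1/n}=C(E)$.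 (ii) For all $z\in\mathbb C$, $\limsup_{n\to\infty}|x_n(z)|^{1/n}\le e^{G_E(z)}$, and this holds uniformly on compacts in the following sense: for every compact $K\subset\mathbb C$ and every continuous $g:K\to\mathbb R$ with $g>G_E$ on $K$ there is an $N$ such that $|x_n(z)|^{1/n}\le e^{g(z)}$ for all $n\ge N$ and all $z\in K$. (iii) For q.e. $z\in\partial\Omega$, $\limsup_{n\to\infty}|x_n(z)|^{1/n}\le 1$. Moreover, if (i)–(iii) hold, then: (iv) For every $z\in\mathbb C$ outside the closed convex hull of $\operatorname{supp}\mu$, $\lim_{n\to\infty}|x_n(z)|^{1/n}=e^{G_E(z)}$. (v) For q.e. $z\in\partial\Omega$, $\limsup_{n\to\infty}|x_n(z)|^{1/n}=1$. (vi) For any sequence of polynomials $Q_n\neq 0$ of degree at most $n$ and all $z\in\mathbb C$, $\limsup_{n\to\infty}\bigl|Q_n(z)/\|Q_n\|_{L^2(\mu)}\bigr|^{1/n}\le e^{G_E(z)}$. -/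

import Mathlib

open MeasureTheory Filter Topology
open scoped ENNReal

namespace OPRegular

noncomputable section

/-! ### Potential theory in the plane -/

/-- The kernel `log |x - y|⁻¹`, with value `+∞` on the diagonal. -/
def logKernel (x y : ℂ) : EReal := ENNReal.log (‖x - y‖ₑ)⁻¹

/-- The potential `Φ_ν(x) = ∫ log |x - y|⁻¹ dν(y) ∈ (-∞, +∞]` of a finite measure of compact support,
as the integral of the positive part minus the integral of the negative part
(the latter is finite for such a measure). -/
def potential (ν : Measure ℂ) (x : ℂ) : EReal :=
  ((∫⁻ y, (logKernel x y).toENNReal ∂ν : ℝ≥0∞) : EReal) -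
    ((∫⁻ y, (-logKernel x y).toENNReal ∂ν : ℝ≥0∞) : EReal)

/-- The Coulomb energy `∫∫ log |x - y|⁻¹ dν(y) dν(x) ∈ (-∞, +∞]` of a finite measure of compact
support. -/
def energy (ν : Measure ℂ) : EReal :=
  ((∫⁻ x, ∫⁻ y, (logKernel x y).toENNReal ∂ν ∂ν : ℝ≥0∞) : EReal) -
    ((∫⁻ x, ∫⁻ y, (-logKernel x y).toENNReal ∂ν ∂ν : ℝ≥0∞) : EReal)

/-- The logarithmic capacity `C(X) = exp (- inf E(ρ))`, the infimum over the probability measures `ρ`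
whose support is a compact subset of `X`; it is `0` if all of these have infinite energy (or if there
are none). For a Borel set `X` this is the supremum of `C(K)` over the compact subsets `K` of `X`. -/
def capacity (X : Set ℂ) : ℝ≥0∞ :=
  EReal.exp (-(⨅ (ρ : Measure ℂ) (_ : IsProbabilityMeasure ρ)
    (_ : IsCompact ρ.support) (_ : ρ.support ⊆ X), energy ρ))

/-- `p` holds quasi-everywhere on `S`: it holds at all points of `S` outside some Borel set of
capacity zero. -/
def QuasiEverywhereOn (S : Set ℂ) (p : ℂ → Prop) : Prop :=
  ∃ N : Set ℂ, MeasurableSet N ∧ capacity N = 0 ∧ ∀ z ∈ S \ N, p z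

/-- `ρ` is an equilibrium measure of the compact set `E`: a probability measure on `E` of energy
`log (C(E)⁻¹)`. If `C(E) > 0` there is exactly one. -/
def IsEquilibriumMeasure (E : Set ℂ) (ρ : Measure ℂ) : Prop :=
  IsProbabilityMeasure ρ ∧ ρ.support ⊆ E ∧ energy ρ = ENNReal.log (capacity E)⁻¹

open Classical in
/-- The equilibrium measure `ρ_E` of a compact set `E` with `C(E) > 0`. -/
def equilibriumMeasure (E : Set ℂ) : Measure ℂ :=
  if h : ∃ ρ, IsEquilibriumMeasure E ρ then h.choose else 0

open Classical in
/-- The Green's function `G_E(z) = log (C(E)⁻¹) - Φ_{ρ_E}(z)` of a compact set `E`, with the usual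
convention `G_E = +∞` if `C(E) = 0` (when there is no equilibrium measure of finite energy). -/
def greenFunction (E : Set ℂ) (z : ℂ) : EReal :=
  if capacity E = 0 then ⊤
  else ENNReal.log (capacity E)⁻¹ - potential (equilibriumMeasure E) z

/-- The unbounded connected component of the complement of a compact set `E`. -/
def unboundedComponent (E : Set ℂ) : Set ℂ :=
  {z | z ∈ Eᶜ ∧ ¬ Bornology.IsBounded (connectedComponentIn Eᶜ z)}

/-! ### Orthogonal polynomials -/

/-- The essential spectrum `σ_ess(μ)`: the nonisolated points of the support of `μ`. -/
def essSpectrum (μ : Measure ℂ) : Set ℂ :=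
  {z | z ∈ μ.support ∧ AccPt z (𝓟 μ.support)}

/-- The monic orthogonal polynomials `X_n` of a measure `μ`, by the Gram-Schmidt process applied to
`1, z, z², …` in `L²(μ)`. -/
def monicOP (μ : Measure ℂ) : ℕ → Polynomial ℂ
  | n => Polynomial.X ^ n - ∑ k : Fin n,
      Polynomial.C ((∫ z, (starRingEnd ℂ) ((monicOP μ k).eval z) * z ^ n ∂μ) /
        (∫ z, (starRingEnd ℂ) ((monicOP μ k).eval z) * (monicOP μ k).eval z ∂μ)) * monicOP μ k
  termination_by n => n
  decreasing_by all_goals exact k.2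

/-- The norm `‖P‖_{L²(μ)}` of a polynomial. -/
def L2norm (μ : Measure ℂ) (P : Polynomial ℂ) : ℝ≥0∞ := eLpNorm (fun z => P.eval z) 2 μ

/-- The orthonormal polynomials `x_n = X_n / ‖X_n‖_{L²(μ)}`. -/
def orthonormalOP (μ : Measure ℂ) (n : ℕ) : Polynomial ℂ :=
  Polynomial.C (((L2norm μ (monicOP μ n)).toReal : ℂ)⁻¹) * monicOP μ n

/-- The `n`-th root `|x_n(z)|^{1/n}`. -/
def rootOP (μ : Measure ℂ) (n : ℕ) (z : ℂ) : ℝ≥0∞ :=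
  ‖(orthonormalOP μ n).eval z‖ₑ ^ ((1 : ℝ) / n)

/-- `limsup f_n ≤ e^G` uniformly on compacts, for a function `G` that is only upper semicontinuous:
for every compact `K` and every continuous `g` on `K` with `g > G` on `K`, one has `f_n ≤ e^g` on all
of `K` as soon as `n` is large. (Where `G` is finite and continuous this is the usual notion.) -/
def LimsupLEUniformlyOnCompacts (f : ℕ → ℂ → ℝ≥0∞) (G : ℂ → EReal) : Prop :=
  ∀ K : Set ℂ, IsCompact K → ∀ g : ℂ → ℝ, ContinuousOn g K → (∀ z ∈ K, G z < (g z : EReal)) →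
    ∀ᶠ n in atTop, ∀ z ∈ K, f n z ≤ EReal.exp (g z : EReal)

/-- `μ` is regular relative to `E`: `lim ‖X_n‖^{1/n} = C(E)`. -/
def IsRegularMeasure (μ : Measure ℂ) (E : Set ℂ) : Prop :=
  Tendsto (fun n : ℕ => L2norm μ (monicOP μ n) ^ ((1 : ℝ) / n)) atTop (𝓝 (capacity E))

/-- `limsup |x_n(z)|^{1/n} ≤ e^{G_E(z)}` for all `z`, uniformly on compacts. -/
def GreenUpperBound (μ : Measure ℂ) (E : Set ℂ) : Prop :=
  (∀ z : ℂ, limsup (fun n => rootOP μ n z) atTop ≤ EReal.exp (greenFunction E z)) ∧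
    LimsupLEUniformlyOnCompacts (rootOP μ) (greenFunction E)

/-- `limsup |x_n(z)|^{1/n} ≤ 1` for quasi-every `z ∈ ∂Ω`. -/
def BoundaryUpperBound (μ : Measure ℂ) (E : Set ℂ) : Prop :=
  QuasiEverywhereOn (frontier (unboundedComponent E))
    (fun z => limsup (fun n => rootOP μ n z) atTop ≤ 1)

end

end OPRegular

open OPRegular

/-! Let `ν_n` be the normalized zero counting measure of `X_n`, let `r_n = -(1/n) log ‖X_n‖`, and
let `I = log (C(E)⁻¹)`. Since `log |x_n|^{1/n} = r_n - Φ_{ν_n}` (`log_rootOP`), everything reduces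
to the numbers `r_n` and the weak limits `ν` of the `ν_n`.

Three facts hold without regularity. First, `liminf r_n ≥ I` (`eventually_le_rate`): `E` carries
monic polynomials of size about `e^{-In}` (or arbitrarily small exponential size if `I = +∞`), and
away from `E` the support is finite, so a fixed factor takes care of it. Second, no `ν` charges `Ω`
(`IsZeroLimit.measure_unboundedComponent`). Third, if `r_n → a` along the subsequence, then `Φ_ν ≤
a` on the closure of `Ω` (`IsZeroLimit.potential_le_of_tendsto_rate`). The last two come from the
minimality of `‖X_n‖` and a Runge-type comparison polynomial (`exists_monic_half`): trading zeros
near a point of `Ω` for the zeros of that polynomial would lower the norm.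

(i) ⇒ (ii), when `C(E) > 0`: here `Φ_ν ≤ I` on the closure of `Ω`, while `Φ_{ρ_E} = I` holds
`ν`-a.e. By symmetry of the mutual energy `∫ Φ_ν dρ_E = I`, so `Φ_ν = I` holds `ρ_E`-a.e., and the
principle of domination gives `Φ_{ρ_E} ≤ Φ_ν` everywhere
(`IsEquilibriumMeasure.potential_le_potential`). The principle of descent then excludes a violation
of the uniform bound. (ii) ⇒ (iii): by Frostman's theorem `G_E = 0` q.e. on `∂Ω`. (iii) ⇒ (i): if
`r_n ≥ v > I` infinitely often, the lower envelope theorem (`ae_le_potential_of_tendsto`) gives `Φ_ν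
≥ v - η` for `ρ_E`-a.e. point, whereas `∫ Φ_ν dρ_E = ∫ Φ_{ρ_E} dν ≤ I`.

For (iv), two potentials of probability measures on the convex hull, one dominating the other, agree
outside it because they have equal means over large circles. For (v), the lower envelope theorem
contradicts `Φ_ν ≤ I` wherever the limsup is below `1` on a set charged by a measure of finite
energy. For (vi), `Q_n` is expanded in the orthonormal polynomials.

The potential theory is built on the continuous kernels `ker n`, which increase to the logarithmic
kernel: weak limits, symmetry and superharmonicity are immediate for them, and potentials and
energies are suprema. By Egorov's theorem a potential that is a.e. finite becomes continuous after
removing little mass, which reduces domination to a minimum principle (`le_iSup_of_superharmonic`).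
-/

namespace OPRegular

noncomputable section

/-! ### The truncated logarithmic kernel -/

/-- The truncation `min n (log |x - y|⁻¹)` of the logarithmic kernel. -/
def ker (n : ℕ) (x y : ℂ) : ℝ := -Real.log (max ‖x - y‖ (Real.exp (-n)))

lemma ker_comm (n : ℕ) (x y : ℂ) : ker n x y = ker n y x := by
  simp only [ker, norm_sub_rev]

lemma ker_arg_pos (n : ℕ) (x y : ℂ) : 0 < max ‖x - y‖ (Real.exp (-n)) :=
  lt_max_of_lt_right (Real.exp_pos _)

lemma ker_le (n : ℕ) (x y : ℂ) : ker n x y ≤ n := by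
  have h := Real.log_le_log (Real.exp_pos _) (le_max_right ‖x - y‖ (Real.exp (-n)))
  rw [Real.log_exp] at h
  simp only [ker]; linarith

lemma ker_mono {m n : ℕ} (h : m ≤ n) (x y : ℂ) : ker m x y ≤ ker n x y := by
  have h' : (m : ℝ) ≤ n := by exact_mod_cast h
  exact neg_le_neg (Real.log_le_log (ker_arg_pos n x y)
    (max_le_max le_rfl (Real.exp_le_exp.2 (by linarith))))

lemma ker_of_le {n : ℕ} {x y : ℂ} (h : Real.exp (-n) ≤ ‖x - y‖) :
    ker n x y = -Real.log ‖x - y‖ := by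
  simp only [ker, max_eq_left h]

lemma ker_self (n : ℕ) (x : ℂ) : ker n x x = n := by
  simp [ker, max_eq_right (Real.exp_pos _).le]

lemma ker_le_neg_log {x y : ℂ} (n : ℕ) (h : x ≠ y) : ker n x y ≤ -Real.log ‖x - y‖ :=
  neg_le_neg (Real.log_le_log (norm_pos_iff.2 (sub_ne_zero.2 h)) (le_max_left _ _))

lemma neg_log_le_ker {n : ℕ} {x y : ℂ} {D : ℝ} (hD : 1 ≤ D) (h : ‖x - y‖ ≤ D) :
    -Real.log D ≤ ker n x y :=
  neg_le_neg (Real.log_le_log (ker_arg_pos n x y)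
    (max_le h ((Real.exp_le_one_iff.2 (by simp)).trans hD)))

lemma ker_abs_le (n : ℕ) (x y : ℂ) : |ker n x y| ≤ n + ‖x - y‖ := by
  rw [abs_le]
  refine ⟨?_, (ker_le n x y).trans (by linarith [norm_nonneg (x - y)])⟩
  have h := neg_log_le_ker (n := n) (x := x) (y := y) (D := 1 + ‖x - y‖)
    (by linarith [norm_nonneg (x - y)]) (by linarith)
  have h2 := Real.log_le_sub_one_of_pos (x := 1 + ‖x - y‖) (by positivity)
  have h3 : (0 : ℝ) ≤ n := by positivity
  linarith

lemma continuous_ker (n : ℕ) : Continuous fun p : ℂ × ℂ => ker n p.1 p.2 := by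
  unfold ker
  refine Continuous.neg (Continuous.log ?_ fun p => (ker_arg_pos n p.1 p.2).ne')
  fun_prop

lemma continuous_ker_right (n : ℕ) (x : ℂ) : Continuous fun y => ker n x y :=
  (continuous_ker n).comp (by fun_prop : Continuous fun y : ℂ => (x, y))

lemma log_sub_log_le {a s t : ℝ} (ha : 0 < a) (hs : a ≤ s) (ht : a ≤ t) :
    Real.log s - Real.log t ≤ a⁻¹ * |s - t| := by
  have ht0 := ha.trans_le ht
  have hs0 := ha.trans_le hs
  rw [← Real.log_div hs0.ne' ht0.ne']
  refine (Real.log_le_sub_one_of_pos (by positivity)).trans ?_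
  have h1 : s / t - 1 = t⁻¹ * (s - t) := by field_simp
  rw [h1]
  exact (mul_le_mul_of_nonneg_left (le_abs_self _) (by positivity)).trans
    (mul_le_mul_of_nonneg_right (inv_anti₀ ha ht) (abs_nonneg _))

/-- The truncation keeps the argument of the logarithm above `e^{-n}`, where the logarithm has
Lipschitz constant `e^n`. The bound is uniform in `y`, hence passes to potentials. -/
lemma ker_lipschitz (n : ℕ) (x x' y : ℂ) :
    |ker n x y - ker n x' y| ≤ Real.exp n * ‖x - x'‖ := by
  have key : ∀ u v : ℂ, ker n u y - ker n v y ≤ Real.exp n * ‖u - v‖ := by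
    intro u v
    have h := log_sub_log_le (Real.exp_pos (-n)) (le_max_right ‖v - y‖ (Real.exp (-n)))
      (le_max_right ‖u - y‖ (Real.exp (-n)))
    rw [Real.exp_neg, inv_inv] at h
    have h2 := abs_max_sub_max_le_abs ‖v - y‖ ‖u - y‖ (Real.exp n)⁻¹
    have h3 : |‖v - y‖ - ‖u - y‖| ≤ ‖u - v‖ := by
      refine (abs_norm_sub_norm_le _ _).trans ?_
      rw [norm_sub_rev u v]; simp
    simp only [ker, Real.exp_neg]
    have h4 := mul_le_mul_of_nonneg_left (h2.trans h3) (Real.exp_pos (n : ℝ)).le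
    linarith
  rw [abs_le]
  constructor
  · have := key x' x
    rw [norm_sub_rev] at this; linarith
  · exact key _ _

/-! ### Truncated potentials -/

/-- The measure `ν` is carried by the disc of radius `R` about the origin. -/
def BddBy (R : ℝ) (ν : Measure ℂ) : Prop := ∀ᵐ y ∂ν, ‖y‖ ≤ R

/-- The potential of `ν` with respect to the truncated kernel. -/
def tpot (n : ℕ) (ν : Measure ℂ) (x : ℂ) : ℝ := ∫ y, ker n x y ∂ν

lemma BddBy.mono {R R' : ℝ} {ν : Measure ℂ} (h : BddBy R ν) (hR : R ≤ R') : BddBy R' ν :=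
  Eventually.mono h fun _ hy => hy.trans hR

lemma BddBy.restrict {R : ℝ} {ν : Measure ℂ} (h : BddBy R ν) (A : Set ℂ) :
    BddBy R (ν.restrict A) :=
  ae_restrict_of_ae h

lemma BddBy.smul {R : ℝ} {ν : Measure ℂ} (h : BddBy R ν) (c : ℝ≥0∞) : BddBy R (c • ν) :=
  Measure.ae_smul_measure h c

lemma tpot_smul (ν : Measure ℂ) (c : ℝ≥0∞) (n : ℕ) (x : ℂ) :
    tpot n (c • ν) x = c.toReal * tpot n ν x := by
  simp [tpot, integral_smul_measure]

section
variable {R : ℝ} {ν σ : Measure ℂ} [IsFiniteMeasure ν] [IsFiniteMeasure σ]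

lemma integrable_ker (h : BddBy R ν) (n : ℕ) (x : ℂ) : Integrable (fun y => ker n x y) ν := by
  refine Integrable.of_bound (continuous_ker_right n x).aestronglyMeasurable (n + (‖x‖ + R)) ?_
  filter_upwards [h] with y hy
  have := ker_abs_le n x y
  have h2 := norm_sub_le x y
  rw [Real.norm_eq_abs]; linarith

lemma tpot_mono (h : BddBy R ν) {m n : ℕ} (hmn : m ≤ n) (x : ℂ) : tpot m ν x ≤ tpot n ν x :=
  integral_mono (integrable_ker h m x) (integrable_ker h n x) fun y => ker_mono hmn x y

lemma tpot_lipschitz (h : BddBy R ν) (n : ℕ) (x x' : ℂ) :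
    |tpot n ν x - tpot n ν x'| ≤ Real.exp n * ν.real Set.univ * ‖x - x'‖ := by
  unfold tpot
  rw [← integral_sub (integrable_ker h n x) (integrable_ker h n x'), ← Real.norm_eq_abs]
  refine (norm_integral_le_of_norm_le_const (C := Real.exp n * ‖x - x'‖)
    (ae_of_all _ fun y => ker_lipschitz n x x' y)).trans (le_of_eq (by ring))

lemma continuous_tpot (h : BddBy R ν) (n : ℕ) : Continuous (tpot n ν) := by
  have : LipschitzWith (Real.toNNReal (Real.exp n * ν.real Set.univ)) (tpot n ν) := by
    refine LipschitzWith.of_dist_le_mul fun x y => ?_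
    rw [Real.coe_toNNReal _ (by positivity), Real.dist_eq, dist_eq_norm]
    exact tpot_lipschitz h n x y
  exact this.continuous

lemma le_tpot (h : BddBy R ν) {n : ℕ} {x : ℂ} {D : ℝ} (hD : 1 ≤ D) (hx : ‖x‖ + R ≤ D) :
    -(Real.log D * ν.real Set.univ) ≤ tpot n ν x := by
  have : ∫ _, -Real.log D ∂ν ≤ tpot n ν x := by
    refine integral_mono_ae (integrable_const _) (integrable_ker h n x) ?_
    filter_upwards [h] with y hy
    exact neg_log_le_ker hD ((norm_sub_le x y).trans (by linarith))
  simpa [mul_comm] using this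

lemma tpot_le (h : BddBy R ν) (n : ℕ) (x : ℂ) : tpot n ν x ≤ n * ν.real Set.univ := by
  have : tpot n ν x ≤ ∫ _, (n : ℝ) ∂ν :=
    integral_mono (integrable_ker h n x) (integrable_const _) fun y => ker_le n x y
  simpa [mul_comm] using this

lemma integrable_tpot (h : BddBy R ν) (hσ : BddBy R σ) (n : ℕ) : Integrable (tpot n ν) σ := by
  obtain ⟨C, hC⟩ := (isCompact_closedBall (0 : ℂ) R).exists_bound_of_continuousOn
    (continuous_tpot h n).continuousOn
  refine Integrable.of_bound (continuous_tpot h n).aestronglyMeasurable C ?_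
  filter_upwards [hσ] with y hy
  exact hC y (by simpa using hy)

lemma integrable_ker_prod (h : BddBy R ν) (hσ : BddBy R σ) (n : ℕ) :
    Integrable (fun p : ℂ × ℂ => ker n p.1 p.2) (σ.prod ν) := by
  refine Integrable.of_bound (continuous_ker n).aestronglyMeasurable (n + (R + R)) ?_
  have h1 : ∀ᵐ p ∂(σ.prod ν), ‖p.1‖ ≤ R :=
    Measure.quasiMeasurePreserving_fst.ae hσ
  have h2 : ∀ᵐ p ∂(σ.prod ν), ‖p.2‖ ≤ R :=
    Measure.quasiMeasurePreserving_snd.ae h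
  filter_upwards [h1, h2] with p hp1 hp2
  have := ker_abs_le n p.1 p.2
  have h2 := norm_sub_le p.1 p.2
  rw [Real.norm_eq_abs]; linarith

lemma integral_tpot_comm (h : BddBy R ν) (hσ : BddBy R σ) (n : ℕ) :
    ∫ x, tpot n ν x ∂σ = ∫ x, tpot n σ x ∂ν := by
  unfold tpot
  rw [integral_integral_swap (integrable_ker_prod h hσ n)]
  simp_rw [ker_comm n]

lemma tpot_add (h : BddBy R ν) (hσ : BddBy R σ) (n : ℕ) (x : ℂ) :
    tpot n (ν + σ) x = tpot n ν x + tpot n σ x :=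
  integral_add_measure (integrable_ker h n x) (integrable_ker hσ n x)

end

/-! ### Potentials and energies as suprema of truncations -/

/-- All truncations have the same negative part as `f`, and its integral is finite; the positive
parts increase, so monotone convergence applies to them alone. -/
lemma lintegral_pos_sub_neg_eq_iSup {α : Type*} [MeasurableSpace α] (m : Measure α)
    (f : α → EReal) (g : ℕ → α → ℝ) (hg : ∀ n, Integrable (g n) m) (hm : ∀ n, Measurable (g n))
    (hmono : ∀ a, Monotone fun n => g n a)
    (hpos : ∀ a, (f a).toENNReal = ⨆ n, ENNReal.ofReal (g n a))
    (hneg : ∀ n a, (-f a).toENNReal = ENNReal.ofReal (-g n a)) :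
    ((∫⁻ a, (f a).toENNReal ∂m : ℝ≥0∞) : EReal) - ((∫⁻ a, (-f a).toENNReal ∂m : ℝ≥0∞) : EReal) =
      ⨆ n, ((∫ a, g n a ∂m : ℝ) : EReal) := by
  have hB : ∫⁻ a, (-f a).toENNReal ∂m ≠ ⊤ := by
    simp_rw [hneg 0]
    exact ((hg 0).neg.lintegral_lt_top).ne
  set B := ∫⁻ a, (-f a).toENNReal ∂m with hBdef
  have hA : ∫⁻ a, (f a).toENNReal ∂m = ⨆ n, ∫⁻ a, ENNReal.ofReal (g n a) ∂m := by
    simp_rw [hpos]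
    exact lintegral_iSup (fun n => (hm n).ennreal_ofReal) fun i j hij a =>
      ENNReal.ofReal_le_ofReal (hmono a hij)
  have hint : ∀ n, ((∫ a, g n a ∂m : ℝ) : EReal) =
      ((∫⁻ a, ENNReal.ofReal (g n a) ∂m : ℝ≥0∞) : EReal) - (B : EReal) := by
    intro n
    rw [integral_eq_lintegral_pos_part_sub_lintegral_neg_part (hg n), EReal.coe_sub,
      ← EReal.coe_ennreal_toReal hB, hBdef, ← EReal.coe_ennreal_toReal (hg n).lintegral_lt_top.ne]
    simp_rw [hneg n]
  have hmonoA : Monotone fun n => ∫⁻ a, ENNReal.ofReal (g n a) ∂m := fun i j hij =>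
    lintegral_mono fun a => ENNReal.ofReal_le_ofReal (hmono a hij)
  have h1 : Tendsto (fun n => ((∫⁻ a, ENNReal.ofReal (g n a) ∂m : ℝ≥0∞) : EReal) - (B : EReal)) atTop
      (𝓝 (((∫⁻ a, (f a).toENNReal ∂m : ℝ≥0∞) : EReal) - (B : EReal))) := by
    rw [hA]
    have hlim := EReal.tendsto_coe_ennreal.2 (tendsto_atTop_iSup hmonoA)
    rw [← EReal.coe_ennreal_toReal hB]
    simp_rw [sub_eq_add_neg]
    -- Addition on `EReal` is continuous away from `⊤ + ⊥`, which is excluded because the negative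
    -- part is finite.
    refine (EReal.continuousAt_add (Or.inr ?_) (Or.inl ?_)).tendsto.comp
      (hlim.prodMk_nhds tendsto_const_nhds)
    · rw [← EReal.coe_neg]; exact EReal.coe_ne_bot _
    · exact EReal.coe_ennreal_ne_bot _
  have h2 : Tendsto (fun n => ((∫ a, g n a ∂m : ℝ) : EReal)) atTop
      (𝓝 (⨆ n, ((∫ a, g n a ∂m : ℝ) : EReal))) :=
    tendsto_atTop_iSup fun i j hij => EReal.coe_le_coe_iff.2
      (integral_mono (hg i) (hg j) fun a => hmono a hij)
  simp_rw [hint] at h2 ⊢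
  exact tendsto_nhds_unique h1 h2

lemma logKernel_self (x : ℂ) : logKernel x x = ⊤ := by
  simp [logKernel]

lemma logKernel_of_ne {x y : ℂ} (h : x ≠ y) : logKernel x y = ((-Real.log ‖x - y‖ : ℝ) : EReal) := by
  have h0 : 0 < ‖x - y‖ := norm_pos_iff.2 (sub_ne_zero.2 h)
  rw [logKernel, ENNReal.log_inv, ← ofReal_norm, ENNReal.log_ofReal_of_pos h0, EReal.coe_neg]

lemma logKernel_pos_eq_iSup (x y : ℂ) :
    (logKernel x y).toENNReal = ⨆ n, ENNReal.ofReal (ker n x y) := by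
  by_cases h : x = y
  · subst h
    rw [logKernel_self]
    simp only [ker_self, ENNReal.ofReal_natCast, EReal.toENNReal_top]
    exact ENNReal.iSup_natCast.symm
  · rw [logKernel_of_ne h, EReal.real_coe_toENNReal]
    refine le_antisymm ?_ (iSup_le fun n => ENNReal.ofReal_le_ofReal (ker_le_neg_log n h))
    have h0 : 0 < ‖x - y‖ := norm_pos_iff.2 (sub_ne_zero.2 h)
    obtain ⟨n, hn⟩ := exists_nat_ge (-Real.log ‖x - y‖)
    refine le_iSup_of_le n (le_of_eq ?_)
    rw [ker_of_le]
    rw [← Real.le_log_iff_exp_le h0]; linarith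

/-- Truncating at a level `n ≥ 0` alters the kernel only where it is positive. -/
lemma logKernel_neg (n : ℕ) (x y : ℂ) :
    (-logKernel x y).toENNReal = ENNReal.ofReal (-ker n x y) := by
  by_cases h : x = y
  · subst h
    rw [logKernel_self, ker_self]
    simp
  · rw [logKernel_of_ne h, ← EReal.coe_neg, EReal.real_coe_toENNReal]
    have h0 : 0 < ‖x - y‖ := norm_pos_iff.2 (sub_ne_zero.2 h)
    rcases le_total (Real.exp (-n)) ‖x - y‖ with h1 | h1
    · rw [ker_of_le h1]
    · have h2 := (Real.log_le_log h0 h1).trans_eq (Real.log_exp _)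
      have h3 : (0 : ℝ) ≤ n := by positivity
      rw [ENNReal.ofReal_of_nonpos (by linarith), ker, max_eq_right h1, Real.log_exp,
        ENNReal.ofReal_of_nonpos (by linarith)]

lemma measurable_logKernel : Measurable fun p : ℂ × ℂ => logKernel p.1 p.2 := by
  unfold logKernel
  have : Measurable fun p : ℂ × ℂ => (‖p.1 - p.2‖ₑ)⁻¹ := by fun_prop
  exact ENNReal.measurable_log.comp this

section
variable {R : ℝ} {ν : Measure ℂ} [IsFiniteMeasure ν]

lemma potential_eq_iSup (h : BddBy R ν) (x : ℂ) :
    potential ν x = ⨆ n, ((tpot n ν x : ℝ) : EReal) :=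
  lintegral_pos_sub_neg_eq_iSup ν (logKernel x) (fun n => ker n x) (fun n => integrable_ker h n x)
    (fun n => (continuous_ker_right n x).measurable) (fun y _ _ hmn => ker_mono hmn x y)
    (logKernel_pos_eq_iSup x) fun n => logKernel_neg n x

lemma energy_eq_iSup (h : BddBy R ν) :
    energy ν = ⨆ n, ((∫ x, tpot n ν x ∂ν : ℝ) : EReal) := by
  have hk := measurable_logKernel
  have key := lintegral_pos_sub_neg_eq_iSup (ν.prod ν) (fun p => logKernel p.1 p.2)
    (fun n p => ker n p.1 p.2) (fun n => integrable_ker_prod h h n)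
    (fun n => (continuous_ker n).measurable) (fun p _ _ hmn => ker_mono hmn p.1 p.2)
    (fun p => logKernel_pos_eq_iSup p.1 p.2) fun n p => logKernel_neg n p.1 p.2
  rw [lintegral_prod _ (by fun_prop), lintegral_prod _ (by fun_prop)] at key
  rw [energy, key]
  congr 1 with n
  rw [integral_prod _ (integrable_ker_prod h h n)]
  rfl

lemma tpot_le_potential (h : BddBy R ν) (n : ℕ) (x : ℂ) : (tpot n ν x : EReal) ≤ potential ν x := by
  rw [potential_eq_iSup h]; exact le_iSup (fun n => ((tpot n ν x : ℝ) : EReal)) n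

lemma potential_le_iff (h : BddBy R ν) {x : ℂ} {c : EReal} :
    potential ν x ≤ c ↔ ∀ n, (tpot n ν x : EReal) ≤ c := by
  rw [potential_eq_iSup h, iSup_le_iff]

lemma lt_potential_iff (h : BddBy R ν) {x : ℂ} {c : EReal} :
    c < potential ν x ↔ ∃ n, c < (tpot n ν x : EReal) := by
  rw [potential_eq_iSup h, lt_iSup_iff]

lemma energy_le_iff (h : BddBy R ν) {c : EReal} :
    energy ν ≤ c ↔ ∀ n, ((∫ x, tpot n ν x ∂ν : ℝ) : EReal) ≤ c := by
  rw [energy_eq_iSup h, iSup_le_iff]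

lemma potential_ne_bot (h : BddBy R ν) (x : ℂ) : potential ν x ≠ ⊥ :=
  (lt_of_lt_of_le (EReal.bot_lt_coe _) (tpot_le_potential h 0 x)).ne'

lemma lowerSemicontinuous_potential (h : BddBy R ν) : LowerSemicontinuous (potential ν) := by
  have : potential ν = fun x => ⨆ n, ((tpot n ν x : ℝ) : EReal) := funext (potential_eq_iSup h)
  rw [this]
  exact lowerSemicontinuous_iSup fun n =>
    (continuous_coe_real_ereal.comp (continuous_tpot h n)).lowerSemicontinuous

lemma measurable_potential (h : BddBy R ν) : Measurable (potential ν) :=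
  (lowerSemicontinuous_potential h).measurable

end

/-! ### Uniform measures on circles -/

/-- The uniform probability measure on the circle of centre `c` and radius `r`. -/
def circ (c : ℂ) (r : ℝ) : Measure ℂ :=
  (ENNReal.ofReal (2 * Real.pi))⁻¹ •
    (volume.restrict (Set.Ioc 0 (2 * Real.pi))).map (circleMap c r)

lemma measurable_circleMap (c : ℂ) (r : ℝ) : Measurable (circleMap c r) :=
  (continuous_circleMap c r).measurable

instance (c : ℂ) (r : ℝ) : IsProbabilityMeasure (circ c r) := by
  constructor
  have h : (0 : ℝ) < 2 * Real.pi := by positivity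
  rw [circ, Measure.smul_apply, Measure.map_apply (measurable_circleMap c r) MeasurableSet.univ]
  simp only [Set.preimage_univ, Measure.restrict_apply_univ, Real.volume_Ioc, sub_zero, smul_eq_mul]
  exact ENNReal.inv_mul_cancel (by simpa using h) ENNReal.ofReal_ne_top

lemma integral_circ {f : ℂ → ℝ} (hf : Measurable f) (c : ℂ) (r : ℝ) :
    ∫ x, f x ∂(circ c r) = Real.circleAverage f c r := by
  have h : (0 : ℝ) ≤ 2 * Real.pi := by positivity
  rw [circ, integral_smul_measure, integral_map (measurable_circleMap c r).aemeasurable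
    hf.aestronglyMeasurable, Real.circleAverage, intervalIntegral.integral_of_le h,
    ENNReal.toReal_inv, ENNReal.toReal_ofReal h]

lemma ae_circ (c : ℂ) {r : ℝ} (hr : 0 ≤ r) : ∀ᵐ x ∂(circ c r), ‖x - c‖ = r := by
  refine Measure.ae_smul_measure ?_ _
  rw [ae_map_iff (measurable_circleMap c r).aemeasurable
    (measurableSet_eq_fun (by fun_prop) (by fun_prop))]
  refine ae_of_all _ fun θ => ?_
  simp [circleMap, abs_of_nonneg hr]

lemma bddBy_circ (c : ℂ) {r : ℝ} (hr : 0 ≤ r) : BddBy (‖c‖ + r) (circ c r) := by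
  filter_upwards [ae_circ c hr] with x hx
  have := norm_add_le c (x - c)
  rw [add_sub_cancel] at this
  linarith

lemma circ_pos_of_isOpen {c : ℂ} {r : ℝ} {θ : ℝ} {U : Set ℂ} (hU : IsOpen U)
    (h : circleMap c r θ ∈ U) (hθ : θ ∈ Set.Ioo 0 (2 * Real.pi)) : 0 < circ c r U := by
  rw [circ, Measure.smul_apply, Measure.map_apply (measurable_circleMap c r) hU.measurableSet,
    smul_eq_mul]
  refine ENNReal.mul_pos (ENNReal.inv_ne_zero.2 ENNReal.ofReal_ne_top) ?_
  rw [Measure.restrict_apply ((measurable_circleMap c r) hU.measurableSet)]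
  have hO : IsOpen (circleMap c r ⁻¹' U ∩ Set.Ioo 0 (2 * Real.pi)) :=
    (hU.preimage (continuous_circleMap c r)).inter isOpen_Ioo
  exact ((hO.measure_pos volume ⟨θ, h, hθ⟩).trans_le
    (measure_mono (Set.inter_subset_inter_right _ Set.Ioo_subset_Ioc_self))).ne'

/-- Jensen's formula for one linear factor, written without a case distinction. -/
lemma circleAverage_log_eq {c y : ℂ} {r : ℝ} (hr : 0 < r) :
    Real.circleAverage (fun x => Real.log ‖x - y‖) c r = Real.log (max r ‖c - y‖) := by
  rw [circleAverage_log_norm_sub_const_eq_log_radius_add_posLog hr.ne']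
  rcases le_total ‖c - y‖ r with h | h
  · rw [max_eq_left h, add_eq_left, Real.posLog_eq_zero_iff, abs_mul, abs_inv, abs_of_pos hr,
      abs_of_nonneg (norm_nonneg _)]
    exact inv_mul_le_one_of_le₀ h hr.le
  · have h0 : 0 < ‖c - y‖ := hr.trans_le h
    rw [max_eq_right h, Real.posLog_eq_log, Real.log_mul (by positivity) h0.ne', Real.log_inv]
    · ring
    · rw [abs_of_nonneg (by positivity)]
      rwa [← div_eq_inv_mul, one_le_div hr]

/-- At distance at least `e^{-n}` from the circle the truncation is inactive, so this is the exact
circle average of the logarithm. -/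
lemma tpot_circ_eq {c y : ℂ} {r : ℝ} (hr : 0 < r) {n : ℕ}
    (hn : Real.exp (-n) ≤ |‖c - y‖ - r|) :
    tpot n (circ c r) y = -Real.log (max r ‖c - y‖) := by
  have hm : Measurable fun x : ℂ => Real.log ‖x - y‖ := by fun_prop
  rw [← circleAverage_log_eq hr, ← integral_circ hm, ← integral_neg, tpot]
  refine integral_congr_ae ?_
  filter_upwards [ae_circ c hr.le] with x hx
  rw [ker_comm, ker_of_le]
  refine hn.trans ?_
  rw [← hx, norm_sub_rev x c]
  refine (abs_norm_sub_norm_le (c - y) (c - x)).trans_eq ?_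
  congr 1; ring

/-- Off the circle, raising the truncation level until it is inactive only increases the left side.
Points of the circle are limits of points outside it. -/
lemma tpot_circ_le_log {c y : ℂ} {r : ℝ} (hr : 0 < r) (n : ℕ) :
    tpot n (circ c r) y ≤ -Real.log (max r ‖c - y‖) := by
  have hm : ∀ y : ℂ, Measurable fun x : ℂ => Real.log ‖x - y‖ := fun y => by fun_prop
  have key : ∀ y : ℂ, ‖c - y‖ ≠ r → tpot n (circ c r) y ≤ -Real.log (max r ‖c - y‖) := by
    intro y hy
    obtain ⟨m, hm⟩ := exists_nat_ge (-Real.log |‖c - y‖ - r|)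
    have h0 : 0 < |‖c - y‖ - r| := abs_pos.2 (sub_ne_zero.2 hy)
    rw [← tpot_circ_eq hr (n := max n m)]
    · exact tpot_mono (bddBy_circ c hr.le) (le_max_left _ _) y
    · rw [← Real.le_log_iff_exp_le h0]
      have : (m : ℝ) ≤ (max n m : ℕ) := by exact_mod_cast le_max_right n m
      linarith
  by_cases hy : ‖c - y‖ = r
  -- The point `y` of the circle is approached radially from outside.
  · have hcont : Continuous fun t : ℝ => c + (1 + t) * (y - c) := by fun_prop
    have h1 : Tendsto (fun t : ℝ => tpot n (circ c r) (c + (1 + t) * (y - c))) (𝓝[>] 0)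
        (𝓝 (tpot n (circ c r) y)) := by
      have := ((continuous_tpot (bddBy_circ c hr.le) n).comp hcont).tendsto 0
      simp only [Function.comp_def, Complex.ofReal_zero, add_zero, one_mul, add_sub_cancel] at this
      exact this.mono_left nhdsWithin_le_nhds
    refine le_of_tendsto h1 ?_
    filter_upwards [self_mem_nhdsWithin] with t ht
    have ht : (0 : ℝ) < t := ht
    have h2 : ‖c - (c + (1 + t) * (y - c))‖ = (1 + t) * r := by
      rw [sub_add_cancel_left, norm_neg, norm_mul, norm_sub_rev y c, hy]
      congr 1
      rw [← Complex.ofReal_one, ← Complex.ofReal_add, Complex.norm_real, Real.norm_eq_abs,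
        abs_of_pos (by linarith)]
    refine (key _ ?_).trans ?_
    · rw [h2]; nlinarith
    · rw [h2, hy, max_self]
      exact neg_le_neg (Real.log_le_log hr (le_max_left _ _))
  · exact key y hy

lemma tpot_circ_le_ker {c y : ℂ} {r : ℝ} (hr : 0 < r) (n : ℕ) :
    tpot n (circ c r) y ≤ ker n c y := by
  rcases le_total (Real.exp (-n)) ‖c - y‖ with h | h
  · rw [ker_of_le h]
    refine (tpot_circ_le_log hr n).trans (neg_le_neg (Real.log_le_log ?_ (le_max_right _ _)))
    exact (Real.exp_pos _).trans_le h
  · have := tpot_le (bddBy_circ c hr.le) n y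
    rw [ker, max_eq_right h, Real.log_exp]
    simpa using this

section
variable {R : ℝ} {ν : Measure ℂ} [IsFiniteMeasure ν]

lemma integral_tpot_circ (h : BddBy R ν) (c : ℂ) {r : ℝ} (hr : 0 ≤ r) (n : ℕ) :
    ∫ x, tpot n ν x ∂(circ c r) = ∫ y, tpot n (circ c r) y ∂ν :=
  integral_tpot_comm (h.mono (le_max_left R (‖c‖ + r)))
    ((bddBy_circ c hr).mono (le_max_right R (‖c‖ + r))) n

/-- The truncated potentials are superharmonic. -/
lemma integral_tpot_circ_le (h : BddBy R ν) (c : ℂ) {r : ℝ} (hr : 0 < r) (n : ℕ) :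
    ∫ x, tpot n ν x ∂(circ c r) ≤ tpot n ν c := by
  rw [integral_tpot_circ h c hr.le]
  exact integral_mono (integrable_tpot ((bddBy_circ c hr.le).mono (le_max_right R (‖c‖ + r)))
    (h.mono (le_max_left R (‖c‖ + r))) n) (integrable_ker h n c) fun y => tpot_circ_le_ker hr n

/-- A potential has the mean value property on discs not charged by the measure. -/
lemma integral_tpot_circ_eq {c : ℂ} {r : ℝ} (hr : 0 < r) {n : ℕ}
    (hR : BddBy R ν) (h : ∀ᵐ y ∂ν, r + Real.exp (-n) ≤ ‖c - y‖) :
    ∫ x, tpot n ν x ∂(circ c r) = tpot n ν c := by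
  rw [integral_tpot_circ hR c hr.le]
  refine integral_congr_ae ?_
  filter_upwards [h] with y hy
  have h0 := Real.exp_pos (-n)
  rw [tpot_circ_eq hr (by rw [abs_of_nonneg] <;> linarith), max_eq_right (by linarith),
    ker_of_le (by linarith)]

/-- Two measures of equal mass carried by a disc have equal potentials, in the mean, on larger
concentric circles. -/
lemma integral_tpot_circ_of_inside {c : ℂ} {r : ℝ} (hr : 0 < r) {n : ℕ}
    (hR : BddBy R ν) (h : ∀ᵐ y ∂ν, ‖c - y‖ ≤ r - Real.exp (-n)) :
    ∫ x, tpot n ν x ∂(circ c r) = -(Real.log r * ν.real Set.univ) := by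
  rw [integral_tpot_circ hR c hr.le]
  have : ∫ y, tpot n (circ c r) y ∂ν = ∫ _, -Real.log r ∂ν := by
    refine integral_congr_ae ?_
    filter_upwards [h] with y hy
    have h0 := Real.exp_pos (-n)
    rw [tpot_circ_eq hr (by rw [abs_of_nonpos] <;> linarith), max_eq_left (by linarith)]
  rw [this]
  simp [mul_comm]

end

/-! ### Weak limits of measures on a compact set -/

/-- Prokhorov's theorem, with the tightness condition at tolerance zero so that the limit is carried
by the same compact set. -/
lemma exists_subseq_tendsto (ν : ℕ → ProbabilityMeasure ℂ) {K : Set ℂ} (hK : IsCompact K)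
    (h : ∀ n, (ν n : Measure ℂ) Kᶜ = 0) :
    ∃ ν' : ProbabilityMeasure ℂ, (ν' : Measure ℂ) Kᶜ = 0 ∧
      ∃ φ : ℕ → ℕ, StrictMono φ ∧ Tendsto (fun k => ν (φ k)) atTop (𝓝 ν') := by
  have hc := isCompact_setOfPred_probabilityMeasure_mass_eq_compl_isCompact_le (E := ℂ)
    (u := fun _ => 0) (K := fun _ => K) tendsto_const_nhds (fun _ => hK) (Or.inl inferInstance)
  obtain ⟨ν', h1, φ, hφ, h2⟩ := hc.tendsto_subseq (x := ν) fun n _ => by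
    simp [ProbabilityMeasure.coeFn_def, h n]
  refine ⟨ν', ?_, φ, hφ, h2⟩
  have := h1 0
  rw [nonpos_iff_eq_zero] at this
  exact (ProbabilityMeasure.null_iff_toMeasure_null ν' Kᶜ).1 this

lemma tendsto_integral_of_ae_mem_isCompact {X ι : Type*} [TopologicalSpace X] [MeasurableSpace X]
    [OpensMeasurableSpace X] {L : Filter ι} {ν : ι → ProbabilityMeasure X}
    {ν' : ProbabilityMeasure X} (hν : Tendsto ν L (𝓝 ν')) {K : Set X} (hK : IsCompact K)
    (h : ∀ i, ∀ᵐ x ∂(ν i : Measure X), x ∈ K) (h' : ∀ᵐ x ∂(ν' : Measure X), x ∈ K) {f : X → ℝ}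
    (hf : Continuous f) :
    Tendsto (fun i => ∫ x, f x ∂(ν i : Measure X)) L (𝓝 (∫ x, f x ∂(ν' : Measure X))) := by
  obtain ⟨M, hM⟩ := hK.exists_bound_of_continuousOn hf.continuousOn
  -- Clipping `f` at its bound on `K` gives a legitimate test function without changing any of the
  -- integrals.
  let g : BoundedContinuousFunction X ℝ := BoundedContinuousFunction.ofNormedAddCommGroup
    (fun x => max (-|M|) (min |M| (f x))) (by fun_prop) |M| (fun x => by
      rw [Real.norm_eq_abs, abs_le]
      exact ⟨le_max_left _ _, max_le (neg_le_self (abs_nonneg M)) (min_le_left _ _)⟩)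
  have hg : ∀ m : Measure X, (∀ᵐ x ∂m, x ∈ K) → ∫ x, f x ∂m = ∫ x, g x ∂m := by
    intro m hm
    refine integral_congr_ae ?_
    filter_upwards [hm] with x hx
    have := abs_le.1 ((hM x hx).trans (le_abs_self M))
    simp [g, min_eq_right this.2, max_eq_right this.1]
  rw [hg _ h']
  simp_rw [fun i => hg _ (h i)]
  exact ProbabilityMeasure.tendsto_iff_forall_integral_tendsto.1 hν g

section
variable {ι : Type*} {L : Filter ι} {ν : ι → ProbabilityMeasure ℂ} {ν' : ProbabilityMeasure ℂ}
  {R : ℝ}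

lemma BddBy.ae_mem {ν : Measure ℂ} (h : BddBy R ν) : ∀ᵐ x ∂ν, x ∈ Metric.closedBall (0 : ℂ) R := by
  filter_upwards [h] with x hx
  simpa using hx

lemma tendsto_integral_of_bddBy (hν : Tendsto ν L (𝓝 ν')) (h : ∀ i, BddBy R (ν i))
    (h' : BddBy R ν') {f : ℂ → ℝ} (hf : Continuous f) :
    Tendsto (fun i => ∫ x, f x ∂(ν i : Measure ℂ)) L (𝓝 (∫ x, f x ∂(ν' : Measure ℂ))) :=
  tendsto_integral_of_ae_mem_isCompact hν (isCompact_closedBall 0 R) (fun i => (h i).ae_mem)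
    h'.ae_mem hf

/-- The evaluation point may move because the Lipschitz constant does not depend on the measure.
This is what makes the principle of descent usable uniformly on compacts. -/
lemma tendsto_tpot (hν : Tendsto ν L (𝓝 ν')) (h : ∀ i, BddBy R (ν i)) (h' : BddBy R ν')
    (n : ℕ) {x : ι → ℂ} {x' : ℂ} (hx : Tendsto x L (𝓝 x')) :
    Tendsto (fun i => tpot n (ν i) (x i)) L (𝓝 (tpot n ν' x')) := by
  have h1 : Tendsto (fun i => tpot n (ν i) x') L (𝓝 (tpot n ν' x')) :=
    tendsto_integral_of_bddBy hν h h' (continuous_ker_right n x')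
  have h2 : Tendsto (fun i => tpot n (ν i) (x i) - tpot n (ν i) x') L (𝓝 0) := by
    refine squeeze_zero_norm (a := fun i => Real.exp n * ‖x i - x'‖) (fun i => ?_) ?_
    · have := tpot_lipschitz (h i) n (x i) x'
      simpa using this
    · have := (hx.sub_const x').norm.const_mul (Real.exp n)
      simpa using this
  simpa using h2.add h1

/-- Products of weakly convergent measures converge weakly, and the truncated kernel is continuous
on the product. -/
lemma tendsto_integral_tpot (hν : Tendsto ν L (𝓝 ν')) (h : ∀ i, BddBy R (ν i))
    (h' : BddBy R ν') (n : ℕ) :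
    Tendsto (fun i => ∫ x, tpot n (ν i) x ∂(ν i : Measure ℂ)) L
      (𝓝 (∫ x, tpot n ν' x ∂(ν' : Measure ℂ))) := by
  have hprod : Tendsto (fun i => (ν i).prod (ν i)) L (𝓝 (ν'.prod ν')) :=
    (ProbabilityMeasure.continuous_prod.tendsto (ν', ν')).comp (hν.prodMk_nhds hν)
  have hmem : ∀ m : ProbabilityMeasure ℂ, BddBy R m → ∀ᵐ p ∂((m.prod m : ProbabilityMeasure _) :
      Measure (ℂ × ℂ)), p ∈ Metric.closedBall (0 : ℂ) R ×ˢ Metric.closedBall (0 : ℂ) R := by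
    intro m hm
    filter_upwards [Measure.quasiMeasurePreserving_fst.ae hm.ae_mem,
      Measure.quasiMeasurePreserving_snd.ae hm.ae_mem] with p h1 h2 using ⟨h1, h2⟩
  have := tendsto_integral_of_ae_mem_isCompact hprod
    ((isCompact_closedBall (0 : ℂ) R).prod (isCompact_closedBall (0 : ℂ) R))
    (fun i => hmem _ (h i)) (hmem _ h') (continuous_ker n)
  simp only [ProbabilityMeasure.toMeasure_prod] at this
  rw [integral_prod _ (integrable_ker_prod h' h' n)] at this
  simp_rw [fun i => integral_prod _ (integrable_ker_prod (h i) (h i) n)] at this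
  exact this

end

/-! ### Measures of finite energy and sets of capacity zero -/

/-- The truncated energies of `σ` are bounded. -/
def FiniteEnergy (σ : Measure ℂ) : Prop := ∃ M : ℝ, ∀ n, ∫ x, tpot n σ x ∂σ ≤ M

section
variable {R : ℝ} {ν σ : Measure ℂ} [IsFiniteMeasure ν] [IsFiniteMeasure σ]

lemma finiteEnergy_iff (h : BddBy R σ) : FiniteEnergy σ ↔ energy σ ≠ ⊤ := by
  constructor
  · rintro ⟨M, hM⟩ htop
    have : energy σ ≤ (M : EReal) := (energy_le_iff h).2 fun n => EReal.coe_le_coe_iff.2 (hM n)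
    rw [htop] at this
    exact absurd this (not_le.2 (EReal.coe_lt_top M))
  · intro htop
    have hb : energy σ ≠ ⊥ := by
      have := (energy_le_iff h).1 le_rfl 0
      exact (lt_of_lt_of_le (EReal.bot_lt_coe _) this).ne'
    refine ⟨(energy σ).toReal, fun n => ?_⟩
    rw [← EReal.coe_le_coe_iff, EReal.coe_toReal htop hb]
    exact (energy_le_iff h).1 le_rfl n

lemma FiniteEnergy.restrict (h : BddBy R σ) (hσ : FiniteEnergy σ) (A : Set ℂ) :
    FiniteEnergy (σ.restrict A) := by
  obtain ⟨M, hM⟩ := hσ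
  set D := max 1 (R + R) with hD
  have hD0 : 0 ≤ Real.log D := Real.log_nonneg (le_max_left _ _)
  have hi := fun n => integrable_ker_prod h h n
  refine ⟨M + Real.log D * (σ.prod σ).real Set.univ, fun n => ?_⟩
  have h1 : ∫ x, tpot n (σ.restrict A) x ∂(σ.restrict A) =
      ∫ p in A ×ˢ A, ker n p.1 p.2 ∂(σ.prod σ) := by
    rw [← Measure.prod_restrict, integral_prod _
      (integrable_ker_prod (h.restrict A) (h.restrict A) n)]
    rfl
  have h2 : ∫ x, tpot n σ x ∂σ = ∫ p, ker n p.1 p.2 ∂(σ.prod σ) := by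
    rw [integral_prod _ (hi n)]; rfl
  -- Once `log D` is added the kernel is nonnegative on the disc, so that shrinking the domain
  -- lowers the integral.
  have h3 : ∫ p in A ×ˢ A, (ker n p.1 p.2 + Real.log D) ∂(σ.prod σ) ≤
      ∫ p, (ker n p.1 p.2 + Real.log D) ∂(σ.prod σ) := by
    refine setIntegral_le_integral ((hi n).add (integrable_const _)) ?_
    filter_upwards [Measure.quasiMeasurePreserving_fst.ae h,
      Measure.quasiMeasurePreserving_snd.ae h] with p hp1 hp2
    have := neg_log_le_ker (n := n) (x := p.1) (y := p.2) (le_max_left 1 (R + R))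
      ((norm_sub_le _ _).trans ((add_le_add hp1 hp2).trans (le_max_right _ _)))
    simp only [Pi.zero_apply]; linarith
  rw [integral_add (hi n).integrableOn (integrable_const _), integral_add (hi n) (integrable_const _),
    ← h1, ← h2] at h3
  simp only [integral_const, smul_eq_mul, MeasureTheory.measureReal_restrict_apply_univ] at h3
  have h4 : 0 ≤ (σ.prod σ).real (A ×ˢ A) * Real.log D := by positivity
  linarith [hM n]

end

lemma FiniteEnergy.smul {σ : Measure ℂ} (hσ : FiniteEnergy σ) (c : ℝ≥0∞) : FiniteEnergy (c • σ) := by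
  obtain ⟨M, hM⟩ := hσ
  refine ⟨c.toReal * c.toReal * M, fun n => ?_⟩
  simp only [tpot_smul, integral_smul_measure, integral_const_mul, smul_eq_mul, ← mul_assoc]
  exact mul_le_mul_of_nonneg_left (hM n) (by positivity)

lemma measure_compl_eq_zero_of_support_subset {ρ : Measure ℂ} {X : Set ℂ} (h : ρ.support ⊆ X) :
    ρ Xᶜ = 0 :=
  measure_mono_null (Set.compl_subset_compl.2 h) Measure.measure_compl_support

lemma support_subset_of_measure_compl {ρ : Measure ℂ} {K : Set ℂ} (hK : IsClosed K)
    (h : ρ Kᶜ = 0) : ρ.support ⊆ K :=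
  Measure.support_subset_of_isClosed hK (mem_ae_iff.2 h)

lemma isCompact_support_of_measure_compl {ρ : Measure ℂ} {K : Set ℂ} (hK : IsCompact K)
    (h : ρ Kᶜ = 0) : IsCompact ρ.support :=
  hK.of_isClosed_subset Measure.isClosed_support
    (support_subset_of_measure_compl hK.isClosed h)

lemma bddBy_of_measure_compl {ρ : Measure ℂ} {K : Set ℂ} {R : ℝ} (hK : ∀ x ∈ K, ‖x‖ ≤ R)
    (h : ρ Kᶜ = 0) : BddBy R ρ := by
  refine Eventually.mono (mem_ae_iff.2 h : ∀ᵐ x ∂ρ, x ∈ K) hK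

lemma exists_norm_le_of_isCompact {K : Set ℂ} (hK : IsCompact K) :
    ∃ R : ℝ, 1 ≤ R ∧ ∀ x ∈ K, ‖x‖ ≤ R := by
  obtain ⟨R, hR⟩ := hK.isBounded.exists_norm_le
  exact ⟨max 1 R, le_max_left _ _, fun x hx => (hR x hx).trans (le_max_right _ _)⟩

lemma exists_bddBy {ρ : Measure ℂ} (h : IsCompact ρ.support) : ∃ R : ℝ, 1 ≤ R ∧ BddBy R ρ := by
  obtain ⟨R, h1, hR⟩ := exists_norm_le_of_isCompact h
  exact ⟨R, h1, bddBy_of_measure_compl hR Measure.measure_compl_support⟩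

/-- The infimum of the energies of the probability measures on compact subsets of `X`. -/
def minEnergy (X : Set ℂ) : EReal :=
  ⨅ (ρ : Measure ℂ) (_ : IsProbabilityMeasure ρ)
    (_ : IsCompact ρ.support) (_ : ρ.support ⊆ X), energy ρ

lemma capacity_eq (X : Set ℂ) : capacity X = EReal.exp (-minEnergy X) := rfl

lemma log_capacity_inv (X : Set ℂ) : ENNReal.log (capacity X)⁻¹ = minEnergy X := by
  rw [capacity_eq, ENNReal.log_inv, EReal.log_exp, neg_neg]

lemma capacity_eq_zero_iff (X : Set ℂ) : capacity X = 0 ↔ minEnergy X = ⊤ := by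
  rw [capacity_eq, EReal.exp_eq_zero_iff, EReal.neg_eq_bot_iff]

lemma minEnergy_le {X : Set ℂ} {ρ : Measure ℂ} [IsProbabilityMeasure ρ] (h : IsCompact ρ.support)
    (hX : ρ.support ⊆ X) : minEnergy X ≤ energy ρ :=
  iInf_le_of_le ρ (iInf_le_of_le inferInstance (iInf_le_of_le h (iInf_le _ hX)))

lemma minEnergy_anti {X Y : Set ℂ} (h : X ⊆ Y) : minEnergy Y ≤ minEnergy X :=
  le_iInf fun _ => le_iInf fun _ => le_iInf fun hc => le_iInf fun hX => minEnergy_le hc (hX.trans h)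

lemma minEnergy_le_of_measure_compl {K : Set ℂ} (hK : IsCompact K) {ρ : Measure ℂ}
    [IsProbabilityMeasure ρ] (h : ρ Kᶜ = 0) : minEnergy K ≤ energy ρ :=
  minEnergy_le (isCompact_support_of_measure_compl hK h)
    (support_subset_of_measure_compl hK.isClosed h)

lemma capacity_eq_zero_of_forall {X : Set ℂ}
    (h : ∀ (ρ : Measure ℂ) (R : ℝ), IsProbabilityMeasure ρ → BddBy R ρ → FiniteEnergy ρ →
      IsCompact ρ.support → ρ.support ⊆ X → False) : capacity X = 0 := by
  rw [capacity_eq_zero_iff, minEnergy]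
  simp only [iInf_eq_top]
  intro ρ hρ hc hX
  obtain ⟨R, _, hR⟩ := exists_bddBy hc
  by_contra hne
  exact h ρ R hρ hR ((finiteEnergy_iff hR).2 hne) hc hX

/-- Sets of capacity zero are not charged by measures of finite energy. -/
lemma measure_eq_zero_of_capacity_eq_zero {R : ℝ} {σ : Measure ℂ} [IsFiniteMeasure σ]
    (h : BddBy R σ) (hσ : FiniteEnergy σ) {N : Set ℂ} (hN : MeasurableSet N)
    (hcap : capacity N = 0) : σ N = 0 := by
  by_contra hne
  -- By inner regularity a charged set contains a charged compact set; the normalized restriction of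
  -- `σ` to it is a competitor of finite energy.
  obtain ⟨K, hKN, hK, hpos⟩ := hN.exists_lt_isCompact (μ := σ) (pos_iff_ne_zero.2 hne)
  have hprob : IsProbabilityMeasure (ProbabilityTheory.cond σ K) :=
    ProbabilityTheory.cond_isProbabilityMeasure hpos.ne'
  have hE : FiniteEnergy (ProbabilityTheory.cond σ K) :=
    (hσ.restrict h K).smul _
  have hB : BddBy R (ProbabilityTheory.cond σ K) := (h.restrict K).smul _
  have hz : ProbabilityTheory.cond σ K Kᶜ = 0 := by
    simp [ProbabilityTheory.cond, Measure.restrict_apply hK.measurableSet.compl]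
  rw [capacity_eq_zero_iff] at hcap
  have := (minEnergy_anti hKN).trans (minEnergy_le_of_measure_compl hK hz)
  rw [hcap, top_le_iff] at this
  exact (finiteEnergy_iff hB).1 hE this

/-! ### Existence of equilibrium measures -/

lemma neg_log_le_energy {R : ℝ} {ρ : Measure ℂ} [IsProbabilityMeasure ρ] (h : BddBy R ρ) {D : ℝ}
    (hD : 1 ≤ D) (hR : R + R ≤ D) : ((-Real.log D : ℝ) : EReal) ≤ energy ρ := by
  refine le_trans ?_ ((energy_le_iff h).1 le_rfl 0)
  rw [EReal.coe_le_coe_iff]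
  have : ∫ _, -Real.log D ∂ρ ≤ ∫ x, tpot 0 ρ x ∂ρ := by
    refine integral_mono_ae (integrable_const _) (integrable_tpot h h 0) ?_
    filter_upwards [h] with x hx
    simpa using le_tpot h (n := 0) (x := x) hD (by linarith)
  simpa using this

lemma minEnergy_ne_bot {K : Set ℂ} (hK : IsCompact K) : minEnergy K ≠ ⊥ := by
  obtain ⟨R, _, hR⟩ := exists_norm_le_of_isCompact hK
  have : ((-Real.log (R + R) : ℝ) : EReal) ≤ minEnergy K := by
    refine le_iInf fun ρ => le_iInf fun hρ => le_iInf fun _ => le_iInf fun hs => ?_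
    exact neg_log_le_energy (bddBy_of_measure_compl hR (measure_compl_eq_zero_of_support_subset hs))
      (by linarith) le_rfl
  exact (lt_of_lt_of_le (EReal.bot_lt_coe _) this).ne'

/-- Any weak limit of probability measures on `K` whose energies tend to `I` has energy at most
`I`. -/
lemma energy_le_of_tendsto {R : ℝ} {ν : ℕ → ProbabilityMeasure ℂ} {ν' : ProbabilityMeasure ℂ}
    (hν : Tendsto ν atTop (𝓝 ν')) (h : ∀ i, BddBy R (ν i)) (h' : BddBy R ν') {I : EReal}
    (hI : Tendsto (fun k => energy (ν k)) atTop (𝓝 I)) : energy (ν' : Measure ℂ) ≤ I := by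
  rw [energy_le_iff h']
  intro n
  have h1 := (continuous_coe_real_ereal.tendsto _).comp (tendsto_integral_tpot hν h h' n)
  exact le_of_tendsto_of_tendsto' h1 hI fun k => (energy_le_iff (h k)).1 le_rfl n

/-- The direct method: a minimizing sequence has a weak limit on `K`, and the energy is lower
semicontinuous as a supremum of weakly continuous truncations. -/
lemma exists_isEquilibriumMeasure {K : Set ℂ} (hK : IsCompact K) (hcap : capacity K ≠ 0) :
    ∃ ρ, IsEquilibriumMeasure K ρ := by
  rw [Ne, capacity_eq_zero_iff] at hcap
  obtain ⟨R, _, hR⟩ := exists_norm_le_of_isCompact hK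
  set S : Set EReal := {e | ∃ ρ : Measure ℂ, IsProbabilityMeasure ρ ∧ ρ Kᶜ = 0 ∧ energy ρ = e}
  have hS : sInf S = minEnergy K := by
    refine le_antisymm (le_iInf fun ρ => le_iInf fun hρ => le_iInf fun _ => le_iInf fun hs =>
      sInf_le ⟨ρ, hρ, measure_compl_eq_zero_of_support_subset hs, rfl⟩) (le_sInf ?_)
    rintro _ ⟨ρ, hρ, hs, rfl⟩
    exact minEnergy_le_of_measure_compl hK hs
  have hne : S.Nonempty := by
    rw [Set.nonempty_iff_ne_empty]
    intro h0
    rw [h0, sInf_empty] at hS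
    exact hcap hS.symm
  obtain ⟨u, _, hu, hmem⟩ := exists_seq_tendsto_sInf hne (OrderBot.bddBelow S)
  rw [hS] at hu
  choose ρ hprob hz he using hmem
  let ν : ℕ → ProbabilityMeasure ℂ := fun n => ⟨ρ n, hprob n⟩
  obtain ⟨ν', hν', φ, hφ, hlim⟩ := exists_subseq_tendsto ν hK hz
  refine ⟨ν', inferInstance, support_subset_of_measure_compl hK.isClosed hν', ?_⟩
  rw [log_capacity_inv]
  refine le_antisymm ?_ (minEnergy_le_of_measure_compl hK hν')
  refine energy_le_of_tendsto hlim (fun k => bddBy_of_measure_compl hR (hz (φ k)))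
    (bddBy_of_measure_compl hR hν') ?_
  have : (fun k => energy (ν (φ k) : Measure ℂ)) = u ∘ φ := funext fun k => he (φ k)
  rw [this]
  exact hu.comp hφ.tendsto_atTop

lemma isEquilibriumMeasure_equilibriumMeasure {K : Set ℂ} (hK : IsCompact K)
    (hcap : capacity K ≠ 0) : IsEquilibriumMeasure K (equilibriumMeasure K) := by
  have h := exists_isEquilibriumMeasure hK hcap
  rw [equilibriumMeasure, dif_pos h]
  exact h.choose_spec

/-- The Robin constant `log (C(K)⁻¹)`. -/
def robin (K : Set ℂ) : ℝ := (minEnergy K).toReal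

lemma coe_robin {K : Set ℂ} (hK : IsCompact K) (hcap : capacity K ≠ 0) :
    (robin K : EReal) = minEnergy K :=
  EReal.coe_toReal (fun h => hcap ((capacity_eq_zero_iff K).2 h)) (minEnergy_ne_bot hK)

/-! ### Restrictions with continuous potential -/

/-- The tail of the kernel between two levels decreases with the distance, and a factor `2` in the
distance costs at most one level because `2 ≤ e`. With `w` a nearest point of `K` to `z`, the tail
at `z` is controlled by the tail on `K`: this drives the continuity principle. -/
lemma ker_sub_ker_le {n m : ℕ} (hnm : n + 1 ≤ m) {w z y : ℂ} (h : ‖w - y‖ ≤ 2 * ‖z - y‖) :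
    ker m z y - ker (n + 1) z y ≤ ker m w y - ker n w y := by
  have hn : (n : ℝ) + 1 ≤ m := by exact_mod_cast hnm
  have hea : 2 * Real.exp (-((n + 1 : ℕ) : ℝ)) ≤ Real.exp (-n) := by
    have h1 : Real.exp (-(n : ℝ)) = Real.exp 1 * Real.exp (-((n + 1 : ℕ) : ℝ)) := by
      rw [← Real.exp_add]; congr 1; push_cast; ring
    rw [h1]
    exact mul_le_mul_of_nonneg_right (by linarith [Real.add_one_le_exp 1]) (Real.exp_pos _).le
  have hb : Real.exp (-(m : ℝ)) ≤ Real.exp (-((n + 1 : ℕ) : ℝ)) :=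
    Real.exp_le_exp.2 (by push_cast; linarith)
  have p1 := ker_arg_pos m z y
  have p2 := ker_arg_pos (n + 1) z y
  have p3 := ker_arg_pos m w y
  have p4 := ker_arg_pos n w y
  have key : max ‖z - y‖ (Real.exp (-((n + 1 : ℕ) : ℝ))) * max ‖w - y‖ (Real.exp (-(m : ℝ))) ≤
      max ‖z - y‖ (Real.exp (-(m : ℝ))) * max ‖w - y‖ (Real.exp (-(n : ℝ))) := by
    have ha := Real.exp_pos (-((n + 1 : ℕ) : ℝ))
    rcases le_total (Real.exp (-((n + 1 : ℕ) : ℝ))) ‖z - y‖ with h1 | h1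
    · rw [max_eq_left h1, max_eq_left (hb.trans h1)]
      exact mul_le_mul_of_nonneg_left (max_le_max le_rfl (by linarith)) (norm_nonneg _)
    · rw [max_eq_right h1]
      calc _ ≤ Real.exp (-((n + 1 : ℕ) : ℝ)) * (2 * max ‖z - y‖ (Real.exp (-(m : ℝ)))) := by
            refine mul_le_mul_of_nonneg_left (max_le ?_ ?_) ha.le
            · linarith [le_max_left ‖z - y‖ (Real.exp (-(m : ℝ)))]
            · linarith [le_max_right ‖z - y‖ (Real.exp (-(m : ℝ)))]
        _ = (2 * Real.exp (-((n + 1 : ℕ) : ℝ))) * max ‖z - y‖ (Real.exp (-(m : ℝ))) := by ring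
        _ ≤ max ‖w - y‖ (Real.exp (-(n : ℝ))) * max ‖z - y‖ (Real.exp (-(m : ℝ))) :=
            mul_le_mul_of_nonneg_right (hea.trans (le_max_right _ _)) p1.le
        _ = _ := by ring
  have := Real.log_le_log (mul_pos p2 p3) key
  rw [Real.log_mul p2.ne' p3.ne', Real.log_mul p1.ne' p4.ne'] at this
  simp only [ker]
  linarith

section
variable {R : ℝ} {σ : Measure ℂ} [IsFiniteMeasure σ]

lemma tendsto_tpot_toReal (h : BddBy R σ) {x : ℂ} (hx : potential σ x ≠ ⊤) :
    Tendsto (fun n => tpot n σ x) atTop (𝓝 (potential σ x).toReal) := by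
  rw [← EReal.tendsto_coe, EReal.coe_toReal hx (potential_ne_bot h x), potential_eq_iSup h]
  exact tendsto_atTop_iSup fun i j hij => EReal.coe_le_coe_iff.2 (tpot_mono h hij x)

lemma tpot_restrict_add_compl (h : BddBy R σ) {A : Set ℂ} (hA : MeasurableSet A) (n : ℕ) (x : ℂ) :
    tpot n (σ.restrict A) x + tpot n (σ.restrict Aᶜ) x = tpot n σ x := by
  rw [← tpot_add (h.restrict A) (h.restrict Aᶜ), Measure.restrict_add_restrict_compl hA]

/-- Increments in the truncation level are nonnegative, hence monotone in the measure; uniform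
convergence is therefore inherited by restrictions. -/
lemma tpot_restrict_sub_le (h : BddBy R σ) {A : Set ℂ} (hA : MeasurableSet A) {n m : ℕ}
    (hnm : n ≤ m) (x : ℂ) :
    tpot m (σ.restrict A) x - tpot n (σ.restrict A) x ≤ tpot m σ x - tpot n σ x := by
  have h1 := tpot_restrict_add_compl h hA n x
  have h2 := tpot_restrict_add_compl h hA m x
  have h3 := tpot_mono (h.restrict Aᶜ) hnm x
  linarith

/-- If the truncated potentials of `σ` converge uniformly on a compact set `K`, those of the
restriction of `σ` to `K` converge uniformly on the plane. -/
lemma exists_tendstoUniformly_restrict (h : BddBy R σ) {K : Set ℂ} (hK : IsCompact K) {g : ℂ → ℝ}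
    (hg : TendstoUniformlyOn (fun n => tpot n σ) g atTop K) :
    ∃ φ : ℂ → ℝ, TendstoUniformly (fun n => tpot n (σ.restrict K)) φ atTop := by
  rcases K.eq_empty_or_nonempty with rfl | hne
  · refine ⟨fun _ => 0, ?_⟩
    rw [Metric.tendstoUniformly_iff]
    intro ε hε
    refine Eventually.of_forall fun n x => ?_
    simpa [tpot] using hε
  have hκ := h.restrict K
  have hcauchy : UniformCauchySeqOn (fun n => tpot n (σ.restrict K)) atTop Set.univ := by
    rw [Metric.uniformCauchySeqOn_iff]
    intro ε hε
    obtain ⟨N, hN⟩ := (Metric.uniformCauchySeqOn_iff.1 hg.uniformCauchySeqOn) (ε / 2) (by linarith)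
    have key : ∀ m n, N + 1 ≤ n → n ≤ m → ∀ z,
        tpot m (σ.restrict K) z - tpot n (σ.restrict K) z < ε := by
      intro m n hn hnm z
      obtain ⟨k, rfl⟩ : ∃ k, n = k + 1 := ⟨n - 1, by omega⟩
      -- For `y ∈ K` the nearest point satisfies `‖w - y‖ ≤ ‖w - z‖ + ‖z - y‖ ≤ 2 ‖z - y‖`.
      obtain ⟨w, hw, hmin⟩ := hK.exists_infDist_eq_dist hne z
      have h1 : tpot m (σ.restrict K) z - tpot (k + 1) (σ.restrict K) z ≤
          tpot m (σ.restrict K) w - tpot k (σ.restrict K) w := by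
        unfold tpot
        rw [← integral_sub (integrable_ker hκ _ _) (integrable_ker hκ _ _),
          ← integral_sub (integrable_ker hκ _ _) (integrable_ker hκ _ _)]
        refine integral_mono_ae ((integrable_ker hκ _ _).sub (integrable_ker hκ _ _))
          ((integrable_ker hκ _ _).sub (integrable_ker hκ _ _)) ?_
        filter_upwards [ae_restrict_mem hK.measurableSet] with y hy
        refine ker_sub_ker_le hnm ?_
        have h2 : dist z w ≤ dist z y := hmin ▸ Metric.infDist_le_dist_of_mem hy
        have h3 := dist_triangle w z y
        rw [dist_comm w z] at h3
        simp only [dist_eq_norm] at h2 h3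
        linarith
      have h2 := tpot_restrict_sub_le h hK.measurableSet (show k ≤ m by omega) w
      have h3 := hN m (by omega) k (by omega) w hw
      rw [Real.dist_eq] at h3
      linarith [le_abs_self (tpot m σ w - tpot k σ w)]
    refine ⟨N + 1, fun m hm n hn z _ => ?_⟩
    rw [Real.dist_eq]
    rcases le_total n m with h1 | h1
    · rw [abs_of_nonneg (sub_nonneg.2 (tpot_mono hκ h1 z))]
      exact key m n hn h1 z
    · rw [abs_sub_comm, abs_of_nonneg (sub_nonneg.2 (tpot_mono hκ h1 z))]
      exact key n m hm h1 z
  have hlim : ∀ z, ∃ l, Tendsto (fun n => tpot n (σ.restrict K) z) atTop (𝓝 l) := fun z =>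
    cauchySeq_tendsto_of_complete (hcauchy.cauchySeq (Set.mem_univ z))
  choose φ hφ using hlim
  exact ⟨φ, tendstoUniformlyOn_univ.1
    (hcauchy.tendstoUniformlyOn_of_tendsto fun z _ => hφ z)⟩

/-- Off a set of small measure, a measure whose potential is finite almost everywhere has
continuous potential. -/
lemma exists_isCompact_tendstoUniformly (h : BddBy R σ) (hfin : ∀ᵐ x ∂σ, potential σ x ≠ ⊤)
    {A : Set ℂ} (hA : MeasurableSet A) {ε : ℝ} (hε : 0 < ε) :
    ∃ K ⊆ A, IsCompact K ∧ σ (A \ K) ≤ ENNReal.ofReal ε ∧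
      ∃ φ : ℂ → ℝ, TendstoUniformly (fun n => tpot n (σ.restrict K)) φ atTop := by
  -- Egorov's theorem gives uniform convergence off a set of mass at most `ε / 2`; inner regularity
  -- then costs another `ε / 2`.
  obtain ⟨t, ht, hts, hu⟩ := tendstoUniformlyOn_of_ae_tendsto' (μ := σ)
    (fun n => (continuous_tpot h n).stronglyMeasurable)
    (g := fun x => (potential σ x).toReal) (measurable_potential h).ereal_toReal.stronglyMeasurable
    (by filter_upwards [hfin] with x hx using tendsto_tpot_toReal h hx) (half_pos hε)
  obtain ⟨K, hKA, hK, hKs⟩ := (hA.diff ht).exists_isCompact_sdiff_lt (μ := σ)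
    (measure_ne_top σ _) (ENNReal.ofReal_pos.2 (half_pos hε)).ne'
  refine ⟨K, hKA.trans Set.sdiff_subset, hK, ?_,
    exists_tendstoUniformly_restrict h hK (hu.mono fun x hx => (hKA hx).2)⟩
  calc σ (A \ K) ≤ σ (((A \ t) \ K) ∪ t) := measure_mono fun x hx => by
        by_cases hxt : x ∈ t
        · exact Or.inr hxt
        · exact Or.inl ⟨⟨hx.1, hxt⟩, hx.2⟩
    _ ≤ σ ((A \ t) \ K) + σ t := measure_union_le _ _
    _ ≤ ENNReal.ofReal (ε / 2) + ENNReal.ofReal (ε / 2) := add_le_add hKs.le hts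
    _ = ENNReal.ofReal ε := by
        rw [← ENNReal.ofReal_add (by linarith) (by linarith), add_halves]

end

lemma coe_le_iSup_coe_iff {g : ℕ → ℝ} {c : ℝ} :
    (c : EReal) ≤ ⨆ n, (g n : EReal) ↔ ∀ ε > 0, ∃ n, c - ε < g n := by
  constructor
  · intro h ε hε
    have : ((c - ε : ℝ) : EReal) < ⨆ n, (g n : EReal) :=
      (EReal.coe_lt_coe_iff.2 (by linarith)).trans_le h
    obtain ⟨n, hn⟩ := lt_iSup_iff.1 this
    exact ⟨n, EReal.coe_lt_coe_iff.1 hn⟩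
  · intro h
    by_contra! hcon
    obtain ⟨d, hd1, hd2⟩ := EReal.lt_iff_exists_real_btwn.1 hcon
    rw [EReal.coe_lt_coe_iff] at hd2
    obtain ⟨n, hn⟩ := h (c - d) (by linarith)
    have := (le_iSup (fun n => ((g n : ℝ) : EReal)) n).trans hd1.le
    rw [EReal.coe_le_coe_iff] at this
    linarith

/-! ### The maximum principle and the principle of domination -/

section
variable {R : ℝ} {κ : Measure ℂ} [IsFiniteMeasure κ]

lemma continuous_of_tendstoUniformly_tpot (h : BddBy R κ) {φ : ℂ → ℝ}
    (hφ : TendstoUniformly (fun n => tpot n κ) φ atTop) : Continuous φ :=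
  hφ.continuous (Frequently.of_forall fun n => continuous_tpot h n)

lemma integral_tendsto_of_tendstoUniformly (h : BddBy R κ) {φ : ℂ → ℝ}
    (hφ : TendstoUniformly (fun n => tpot n κ) φ atTop) {m : Measure ℂ} [IsProbabilityMeasure m]
    {R' : ℝ} (hm : BddBy R' m) :
    Integrable φ m ∧ Tendsto (fun n => ∫ x, tpot n κ x ∂m) atTop (𝓝 (∫ x, φ x ∂m)) := by
  have hc := continuous_of_tendstoUniformly_tpot h hφ
  have hi : Integrable φ m := by
    obtain ⟨C, hC⟩ := (isCompact_closedBall (0 : ℂ) R').exists_bound_of_continuousOn hc.continuousOn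
    refine Integrable.of_bound hc.aestronglyMeasurable C ?_
    filter_upwards [hm] with y hy
    exact hC y (by simpa using hy)
  refine ⟨hi, ?_⟩
  rw [Metric.tendsto_atTop]
  intro ε hε
  obtain ⟨N, hN⟩ := eventually_atTop.1 (Metric.tendstoUniformly_iff.1 hφ (ε / 2) (by linarith))
  refine ⟨N, fun n hn => ?_⟩
  have hi' : Integrable (tpot n κ) m :=
    integrable_tpot (h.mono (le_max_left R R')) (hm.mono (le_max_right R R')) n
  rw [Real.dist_eq, ← integral_sub hi' hi, ← Real.norm_eq_abs]
  refine (norm_integral_le_of_norm_le_const (C := ε / 2) (ae_of_all _ fun x => ?_)).trans_lt ?_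
  · have := hN n hn x
    rw [dist_comm, dist_eq_norm] at this
    exact this.le
  · simp; linarith

/-- A continuous potential has the mean value property off the support of the measure. -/
lemma integral_circ_of_tendstoUniformly (h : BddBy R κ) {K : Set ℂ} (hK : κ Kᶜ = 0) {φ : ℂ → ℝ}
    (hφ : TendstoUniformly (fun n => tpot n κ) φ atTop) {c : ℂ} {r : ℝ} (hr : 0 < r)
    (hd : ∀ y ∈ K, 2 * r ≤ ‖c - y‖) : ∫ x, φ x ∂(circ c r) = φ c := by
  refine tendsto_nhds_unique
    (integral_tendsto_of_tendstoUniformly h hφ (bddBy_circ c hr.le)).2 ?_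
  obtain ⟨N, hN⟩ := exists_nat_ge (-Real.log r)
  refine Tendsto.congr' ?_ (hφ.tendsto_at c)
  filter_upwards [eventually_ge_atTop N] with n hn
  refine (integral_tpot_circ_eq hr h ?_).symm
  filter_upwards [(mem_ae_iff.2 hK : ∀ᵐ y ∂κ, y ∈ K)] with y hy
  have h1 : Real.exp (-n) ≤ r := by
    rw [← Real.le_log_iff_exp_le hr]
    have : (N : ℝ) ≤ n := by exact_mod_cast hn
    linarith
  linarith [hd y hy]

/-- A function that is superharmonic in the plane and dominates a continuous potential on the
support of its measure and at infinity dominates it everywhere. -/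
lemma le_iSup_of_superharmonic (h : BddBy R κ) {K : Set ℂ} (hKc : IsCompact K) (hK : κ Kᶜ = 0)
    {φ : ℂ → ℝ} (hφ : TendstoUniformly (fun n => tpot n κ) φ atTop) {g : ℕ → ℂ → ℝ}
    (hgc : ∀ n, Continuous (g n)) (hgm : ∀ z, Monotone fun n => g n z)
    (hgs : ∀ n c r, 0 < r → ∫ x, g n x ∂(circ c r) ≤ g n c)
    (hgK : ∀ z ∈ K, (φ z : EReal) ≤ ⨆ n, (g n z : EReal))
    (hginf : ∀ η > 0, ∃ R', ∀ z : ℂ, R' ≤ ‖z‖ → ((φ z - η : ℝ) : EReal) ≤ ⨆ n, (g n z : EReal))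
    (z : ℂ) : (φ z : EReal) ≤ ⨆ n, (g n z : EReal) := by
  have hφc := continuous_of_tendstoUniformly_tpot h hφ
  by_contra! hz
  obtain ⟨b, hb1, hb2⟩ := EReal.lt_iff_exists_real_btwn.1 hz
  rw [EReal.coe_lt_coe_iff] at hb2
  set η := φ z - b with hη
  have hη0 : 0 < η := by linarith
  obtain ⟨R', hR'⟩ := hginf η hη0
  -- `G` is lower semicontinuous, nonnegative on `K` and at least `-η` far out, and off `K` its
  -- truncations inherit the super-mean-value inequality. A value below `-η` would force a minimum
  -- off `K`.
  set G : ℂ → EReal := fun w => ⨆ n, ((g n w - φ w : ℝ) : EReal) with hG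
  have hlt : ∀ w (c : ℝ), (c : EReal) < G w ↔ ∃ n, c < g n w - φ w := by
    intro w c; simp only [hG, lt_iSup_iff, EReal.coe_lt_coe_iff]
  have hle : ∀ w (c : ℝ), G w ≤ c ↔ ∀ n, g n w - φ w ≤ c := by
    intro w c; simp only [hG, iSup_le_iff, EReal.coe_le_coe_iff]
  have hfrom : ∀ w (c : ℝ), ((φ w + c : ℝ) : EReal) ≤ ⨆ n, (g n w : EReal) →
      (c : EReal) ≤ G w := by
    intro w c hw
    by_contra! hcon
    obtain ⟨d, hd1, hd2⟩ := EReal.lt_iff_exists_real_btwn.1 hcon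
    rw [EReal.coe_lt_coe_iff] at hd2
    have := hw.trans (iSup_le fun n => EReal.coe_le_coe_iff.2
      (show g n w ≤ φ w + d by linarith [(hle w d).1 hd1.le n]))
    rw [EReal.coe_le_coe_iff] at this
    linarith
  have hGK : ∀ w ∈ K, (0 : EReal) ≤ G w := fun w hw => by
    simpa using hfrom w 0 (by simpa using hgK w hw)
  have hGinf : ∀ w : ℂ, R' ≤ ‖w‖ → ((-η : ℝ) : EReal) ≤ G w := fun w hw =>
    hfrom w (-η) (by simpa [sub_eq_add_neg] using hR' w hw)
  have hGz : G z < ((-η : ℝ) : EReal) := by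
    obtain ⟨b', hb'1, hb'2⟩ := EReal.lt_iff_exists_real_btwn.1 hb1
    rw [EReal.coe_lt_coe_iff] at hb'2
    refine lt_of_le_of_lt ((hle z (b' - φ z)).2 fun n => ?_)
      (EReal.coe_lt_coe_iff.2 (show b' - φ z < -η by linarith))
    have := (le_iSup (fun n => ((g n z : ℝ) : EReal)) n).trans hb'1.le
    rw [EReal.coe_le_coe_iff] at this
    linarith
  have hlsc : LowerSemicontinuous G := lowerSemicontinuous_iSup fun n =>
    (continuous_coe_real_ereal.comp ((hgc n).sub hφc)).lowerSemicontinuous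
  have hzR : ‖z‖ < R' := by
    by_contra! hcon
    exact absurd (hGinf z hcon) (not_le.2 hGz)
  obtain ⟨z₀, hz₀, hmin⟩ := LowerSemicontinuousOn.exists_isMinOn
    ⟨z, (mem_closedBall_zero_iff.2 hzR.le : z ∈ Metric.closedBall (0 : ℂ) R')⟩
    (isCompact_closedBall _ _) (hlsc.lowerSemicontinuousOn _)
  have hz₀lt : G z₀ < ((-η : ℝ) : EReal) :=
    (hmin (mem_closedBall_zero_iff.2 hzR.le)).trans_lt hGz
  have hz₀bot : G z₀ ≠ ⊥ :=
    (lt_of_lt_of_le (EReal.bot_lt_coe _) (le_iSup (fun n => ((g n z₀ - φ z₀ : ℝ) : EReal)) 0)).ne'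
  obtain ⟨m, hm⟩ : ∃ m : ℝ, (m : EReal) = G z₀ :=
    ⟨(G z₀).toReal, EReal.coe_toReal (hz₀lt.trans (EReal.coe_lt_top _)).ne hz₀bot⟩
  have hmη : m < -η := by rwa [← hm, EReal.coe_lt_coe_iff] at hz₀lt
  have hmG : ∀ w, (m : EReal) ≤ G w := by
    intro w
    rcases le_or_gt R' ‖w‖ with hw | hw
    · exact (EReal.coe_le_coe_iff.2 hmη.le).trans (hGinf w hw)
    · rw [hm]; exact hmin (mem_closedBall_zero_iff.2 hw.le)
  have hZ : IsCompact (Metric.closedBall (0 : ℂ) R' ∩ G ⁻¹' Set.Iic (m : EReal)) :=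
    (isCompact_closedBall _ _).inter_right (hlsc.isClosed_preimage _)
  -- Among the minimum points take one with largest real part, so that every small circle around it
  -- contains points where `G` is strictly larger. This replaces a connectedness argument.
  obtain ⟨c, ⟨hcR, hcm⟩, hcmax⟩ := hZ.exists_isMaxOn ⟨z₀, hz₀, hm.ge⟩
    Complex.continuous_re.continuousOn
  have hcm : G c ≤ m := hcm
  have hcK : c ∉ K := fun hc => by
    have := (hGK c hc).trans hcm
    rw [← EReal.coe_zero, EReal.coe_le_coe_iff] at this
    linarith
  obtain ⟨r₀, hr₀, hball⟩ := Metric.isOpen_iff.1 hKc.isClosed.isOpen_compl c hcK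
  set r := r₀ / 2 with hr
  have hr0 : 0 < r := by positivity
  have hmean : ∫ x, φ x ∂(circ c r) = φ c := by
    refine integral_circ_of_tendstoUniformly h hK hφ hr0 fun y hy => ?_
    by_contra! hcon
    refine hball (Metric.mem_ball.2 ?_) hy
    rw [dist_comm, dist_eq_norm]; linarith
  -- Any angle with positive cosine moves to the right; `π / 3` also lies strictly inside `(0, 2π)`,
  -- as `circ_pos_of_isOpen` requires.
  set p := circleMap c r (Real.pi / 3) with hp
  have hpm : (m : EReal) < G p := by
    rcases le_or_gt R' ‖p‖ with hw | hw
    · exact (EReal.coe_lt_coe_iff.2 hmη).trans_le (hGinf p hw)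
    · by_contra! hcon
      have h1 := hcmax (show p ∈ Metric.closedBall (0 : ℂ) R' ∩ G ⁻¹' Set.Iic (m : EReal) from
        ⟨mem_closedBall_zero_iff.2 hw.le, hcon⟩)
      have h2 : p.re = c.re + r / 2 := by
        have h3 : p = c + ((r * Real.cos (Real.pi / 3) : ℝ) : ℂ) +
            ((r * Real.sin (Real.pi / 3) : ℝ) : ℂ) * Complex.I := by
          rw [hp, circleMap, Complex.exp_mul_I]
          push_cast
          ring
        rw [h3, Real.cos_pi_div_three]
        simp
        ring
      simp only [Set.mem_ofPred_eq, h2] at h1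
      linarith
  obtain ⟨n₀, hn₀⟩ := (hlt p m).1 hpm
  set δ := (g n₀ p - φ p - m) / 2 with hδ
  have hδ0 : 0 < δ := by rw [hδ]; linarith
  let U : Set ℂ := {w | m + δ < g n₀ w - φ w}
  have hU : IsOpen U := isOpen_lt continuous_const ((hgc n₀).sub hφc)
  have hpU : p ∈ U := by change m + δ < g n₀ p - φ p; rw [hδ]; linarith
  have hUpos : 0 < (circ c r).real U := by
    refine ENNReal.toReal_pos (circ_pos_of_isOpen hU hpU ?_).ne' (measure_ne_top _ _)
    constructor <;> linarith [Real.pi_pos]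
  -- Cutting off at `δ` makes the supremum finite and dominated. Its mean over the circle is at most
  -- `0`, while it is nonnegative everywhere and at least `δ` on the charged set `U`.
  let ψ : ℕ → ℂ → ℝ := fun n w => min (g n w - φ w - m) δ
  have hψc : ∀ n, Continuous (ψ n) := fun n => (((hgc n).sub hφc).sub continuous_const).min
    continuous_const
  have hψm : ∀ w, Monotone fun n => ψ n w := fun w i j hij =>
    min_le_min (by linarith [hgm w hij]) le_rfl
  have hψb : ∀ w, BddAbove (Set.range fun n => ψ n w) := fun w =>
    ⟨δ, by rintro _ ⟨n, rfl⟩; exact min_le_right _ _⟩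
  have hbdd := bddBy_circ c hr0.le
  have hint : ∀ {f : ℂ → ℝ}, Continuous f → Integrable f (circ c r) := by
    intro f hf
    obtain ⟨C, hC⟩ := (isCompact_closedBall (0 : ℂ) (‖c‖ + r)).exists_bound_of_continuousOn
      hf.continuousOn
    refine Integrable.of_bound hf.aestronglyMeasurable C ?_
    filter_upwards [hbdd] with y hy
    exact hC y (by simpa using hy)
  have hψ0 : ∀ n, ∫ x, ψ n x ∂(circ c r) ≤ 0 := by
    intro n
    have h1 : ∫ x, ψ n x ∂(circ c r) ≤ ∫ x, (g n x - φ x - m) ∂(circ c r) :=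
      integral_mono (hint (hψc n)) (hint (((hgc n).sub hφc).sub continuous_const))
        fun w => min_le_left _ _
    rw [integral_sub (hint (f := fun x => g n x - φ x) ((hgc n).sub hφc)) (integrable_const _),
      integral_sub (hint (hgc n)) (hint hφc), hmean] at h1
    simp only [integral_const, probReal_univ, one_smul] at h1
    linarith [hgs n c r hr0, (hle c m).1 hcm n]
  have hlim : Tendsto (fun n => ∫ x, ψ n x ∂(circ c r)) atTop
      (𝓝 (∫ x, (⨆ n, ψ n x) ∂(circ c r))) := by
    obtain ⟨C, hC⟩ := (isCompact_closedBall (0 : ℂ) (‖c‖ + r)).exists_bound_of_continuousOn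
      (hψc 0).continuousOn
    refine tendsto_integral_of_dominated_convergence (fun _ => max C δ)
      (fun n => (hψc n).aestronglyMeasurable) (integrable_const _) (fun n => ?_)
      (ae_of_all _ fun w => tendsto_atTop_ciSup (hψm w) (hψb w))
    filter_upwards [hbdd] with w hw
    rw [Real.norm_eq_abs, abs_le]
    have h1 := (abs_le.1 (hC w (by simpa using hw))).1
    exact ⟨by linarith [le_max_left C δ, hψm w (Nat.zero_le n)],
      (min_le_right _ _).trans (le_max_right _ _)⟩
  have hle0 : ∫ x, (⨆ n, ψ n x) ∂(circ c r) ≤ 0 := le_of_tendsto' hlim hψ0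
  have hsup0 : ∀ w, 0 ≤ ⨆ n, ψ n w := by
    intro w
    refine le_of_forall_lt fun e he => ?_
    obtain ⟨n, hn⟩ := (hlt w (m + e)).1
      ((EReal.coe_lt_coe_iff.2 (show m + e < m by linarith)).trans_le (hmG w))
    exact (lt_min (by linarith) (he.trans hδ0)).trans_le (le_ciSup (hψb w) n)
  have hsupU : ∀ w ∈ U, δ ≤ ⨆ n, ψ n w := by
    intro w hw
    have hw : m + δ < g n₀ w - φ w := hw
    exact (le_min (by linarith) le_rfl).trans (le_ciSup (hψb w) n₀)
  have hmeas : Measurable fun w => ⨆ n, ψ n w :=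
    Measurable.iSup fun n => (hψc n).measurable
  have hge : ∫ x, U.indicator (fun _ => δ) x ∂(circ c r) ≤ ∫ x, (⨆ n, ψ n x) ∂(circ c r) := by
    refine integral_mono ((integrable_const δ).indicator hU.measurableSet) ?_ fun w => ?_
    · refine Integrable.of_bound hmeas.aestronglyMeasurable δ (ae_of_all _ fun w => ?_)
      rw [Real.norm_eq_abs, abs_of_nonneg (hsup0 w)]
      exact ciSup_le fun n => min_le_right _ _
    · by_cases hw : w ∈ U
      · simpa [hw] using hsupU w hw
      · simpa [hw] using hsup0 w
  rw [integral_indicator hU.measurableSet] at hge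
  simp only [integral_const, MeasureTheory.measureReal_restrict_apply_univ, smul_eq_mul] at hge
  linarith [mul_pos hUpos hδ0]

end

lemma le_neg_log_of_tendstoUniformly {R : ℝ} {κ : Measure ℂ} [IsProbabilityMeasure κ]
    (h : BddBy R κ) {φ : ℂ → ℝ} (hφ : TendstoUniformly (fun n => tpot n κ) φ atTop) {z : ℂ}
    (hz : R < ‖z‖) : φ z ≤ -Real.log (‖z‖ - R) := by
  refine le_of_tendsto' (hφ.tendsto_at z) fun n => ?_
  have : tpot n κ z ≤ ∫ _, -Real.log (‖z‖ - R) ∂κ := by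
    refine integral_mono_ae (integrable_ker h n z) (integrable_const _) ?_
    filter_upwards [h] with y hy
    have h1 : ‖z‖ - R ≤ ‖z - y‖ := by linarith [norm_sub_norm_le z y]
    exact neg_le_neg (Real.log_le_log (by linarith) (h1.trans (le_max_left _ _)))
  simpa using this

lemma tendsto_log_sub_log (R : ℝ) :
    Tendsto (fun t : ℝ => Real.log t - Real.log (t - R)) atTop (𝓝 0) := by
  have h1 : Tendsto (fun t : ℝ => t / (t - R)) atTop (𝓝 1) := by
    have h2 : Tendsto (fun t : ℝ => 1 + R / (t - R)) atTop (𝓝 (1 + 0)) :=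
      tendsto_const_nhds.add (Tendsto.div_atTop tendsto_const_nhds
        (tendsto_atTop_add_const_right _ (-R) tendsto_id))
    rw [add_zero] at h2
    refine h2.congr' ?_
    filter_upwards [eventually_gt_atTop R] with t ht
    have : t - R ≠ 0 := by linarith
    field_simp
    ring
  have h3 := (Real.continuousAt_log one_ne_zero).tendsto.comp h1
  rw [Real.log_one] at h3
  refine h3.congr' ?_
  filter_upwards [eventually_gt_atTop R, eventually_gt_atTop 0] with t ht ht0
  exact Real.log_div ht0.ne' (by linarith)

/-- The principle of domination: if the potential of `ρ` is at most `V`, and a superharmonic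
function at least `V`, almost everywhere with respect to `ρ`, then the superharmonic function
dominates the potential of `ρ` everywhere. -/
lemma potential_le_of_superharmonic {R : ℝ} {ρ : Measure ℂ} [IsProbabilityMeasure ρ]
    (h : BddBy R ρ) {V : ℝ} (hV : ∀ᵐ z ∂ρ, potential ρ z ≤ V) {g : ℕ → ℂ → ℝ}
    (hgc : ∀ n, Continuous (g n)) (hgm : ∀ z, Monotone fun n => g n z)
    (hgs : ∀ n c r, 0 < r → ∫ x, g n x ∂(circ c r) ≤ g n c)
    (hgV : ∀ᵐ z ∂ρ, (V : EReal) ≤ ⨆ n, (g n z : EReal))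
    (hginf : ∀ η > 0, ∃ R', ∀ z : ℂ, R' ≤ ‖z‖ →
      ((-Real.log ‖z‖ - η : ℝ) : EReal) ≤ ⨆ n, (g n z : EReal)) (z : ℂ) :
    potential ρ z ≤ ⨆ n, (g n z : EReal) := by
  rw [potential_le_iff h]
  intro k
  by_contra! hlt
  set G : ℂ → EReal := fun w => ⨆ n, (g n w : EReal) with hG
  have hGbot : G z ≠ ⊥ :=
    (lt_of_lt_of_le (EReal.bot_lt_coe _) (le_iSup (fun n => ((g n z : ℝ) : EReal)) 0)).ne'
  obtain ⟨γ, hγ⟩ : ∃ γ : ℝ, (γ : EReal) = G z :=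
    ⟨(G z).toReal, EReal.coe_toReal (hlt.trans (EReal.coe_lt_top _)).ne hGbot⟩
  have hlt : γ < tpot k ρ z := by
    rw [← EReal.coe_lt_coe_iff, hγ]; exact hlt
  set D := max 1 (R + R) with hD
  -- The error made in replacing `ρ` by its normalized restriction to a set of mass `a`; it tends to
  -- `0` as `a → 1`. The maximum with `0` keeps the lower bound at infinity valid after `e a` is
  -- added to `g`.
  set e : ℝ → ℝ := fun a => max 0 ((V + Real.log D * (1 - a)) / a - V) with he
  -- Remove mass `1 - a` so that the remaining potential is continuous and the minimum principle
  -- applies to it. The removed part contributes at most `k (1 - a)` to the truncated potential at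
  -- level `k`, and at least `-(1 - a) log D` on the disc.
  have key : ∀ ε > 0, ε < 1 → ∃ a : ℝ, 1 - ε ≤ a ∧ a ≤ 1 ∧
      tpot k ρ z ≤ a * (γ + e a) + k * (1 - a) := by
    intro ε hε hε1
    have hGm : Measurable G := Measurable.iSup fun n =>
      (measurable_coe_real_ereal.comp (hgc n).measurable)
    have hA : MeasurableSet {w | potential ρ w ≤ V ∧ (V : EReal) ≤ G w ∧ ‖w‖ ≤ R} :=
      (measurableSet_le (measurable_potential h) measurable_const).inter
        ((measurableSet_le measurable_const hGm).inter
          (measurableSet_le measurable_norm measurable_const))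
    obtain ⟨K, hKA, hK, hKε, φ, hφ⟩ := exists_isCompact_tendstoUniformly h
      (hV.mono fun w hw => (hw.trans_lt (EReal.coe_lt_top V)).ne) hA hε
    set a := ρ.real K with ha
    have ha1 : a ≤ 1 := measureReal_le_one
    have hcompl : ρ Kᶜ ≤ ENNReal.ofReal ε := by
      refine (measure_mono_ae ?_).trans hKε
      filter_upwards [hV, hgV, h] with w h1 h2 h4 h3 using ⟨⟨h1, h2, h4⟩, h3⟩
    have hcr : ρ.real Kᶜ = 1 - a := by
      rw [measureReal_compl hK.measurableSet, probReal_univ]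
    have hcr' : ρ.real Kᶜ ≤ ε := ENNReal.toReal_le_of_le_ofReal hε.le hcompl
    have ha0 : 0 < a := by linarith
    have hρK : ρ K ≠ 0 := fun h0 => by
      rw [ha, Measure.real, h0] at ha0; simp at ha0
    refine ⟨a, by linarith, ha1, ?_⟩
    have hprob : IsProbabilityMeasure (ProbabilityTheory.cond ρ K) :=
      ProbabilityTheory.cond_isProbabilityMeasure hρK
    have hB : BddBy R (ProbabilityTheory.cond ρ K) := (h.restrict K).smul _
    have hz0 : ProbabilityTheory.cond ρ K Kᶜ = 0 := by
      simp [ProbabilityTheory.cond, Measure.restrict_apply hK.measurableSet.compl]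
    have hφ' : TendstoUniformly (fun n => tpot n (ProbabilityTheory.cond ρ K))
        (fun w => a⁻¹ * φ w) atTop := by
      have : (fun n => tpot n (ProbabilityTheory.cond ρ K)) =
          fun n w => a⁻¹ * tpot n (ρ.restrict K) w := by
        funext n w
        rw [ProbabilityTheory.cond, tpot_smul, ENNReal.toReal_inv]
        rfl
      rw [this]
      exact (Real.uniformContinuous_const_mul (x := a⁻¹)).comp_tendstoUniformly hφ
    have hcm : ∀ w n, tpot n (ρ.restrict K) w ≤ φ w := fun w n =>
      (show Monotone fun n => tpot n (ρ.restrict K) w from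
        fun i j hij => tpot_mono (h.restrict K) hij w).ge_of_tendsto (hφ.tendsto_at w) n
    have hmain := le_iSup_of_superharmonic hB hK hz0 hφ' (g := fun n w => g n w + e a)
      (fun n => (hgc n).add continuous_const) (fun w i j hij => by
        simpa using hgm w hij) (fun n c r hr => ?_) (fun w hw => ?_) (fun η hη => ?_) z
    · have h1 : a⁻¹ * φ z ≤ γ + e a := by
        rw [← EReal.coe_le_coe_iff]
        refine hmain.trans (iSup_le fun n => EReal.coe_le_coe_iff.2 ?_)
        have : ((g n z : ℝ) : EReal) ≤ γ := by
          rw [hγ]; exact le_iSup (fun n => ((g n z : ℝ) : EReal)) n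
        linarith [EReal.coe_le_coe_iff.1 this]
      have h2 : φ z ≤ a * (γ + e a) := by
        rwa [inv_mul_le_iff₀ ha0] at h1
      have h3 := tpot_restrict_add_compl h hK.measurableSet k z
      have h4 := tpot_le (h.restrict Kᶜ) k z
      rw [MeasureTheory.measureReal_restrict_apply_univ, hcr] at h4
      linarith [hcm z k]
    · have hi : Integrable (g n) (circ c r) := by
        obtain ⟨C, hC⟩ := (isCompact_closedBall (0 : ℂ) (‖c‖ + r)).exists_bound_of_continuousOn
          (hgc n).continuousOn
        refine Integrable.of_bound (hgc n).aestronglyMeasurable C ?_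
        filter_upwards [bddBy_circ c hr.le] with y hy
        exact hC y (by simpa using hy)
      rw [integral_add hi (integrable_const _)]
      simpa using hgs n c r hr
    · obtain ⟨hwV, hwG, hwR⟩ := hKA hw
      have h1 : φ w ≤ V + Real.log D * (1 - a) := by
        refine le_of_tendsto' (hφ.tendsto_at w) fun n => ?_
        have h2 := tpot_restrict_add_compl h hK.measurableSet n w
        have h3 := EReal.coe_le_coe_iff.1 ((potential_le_iff h).1 hwV n)
        have h4 := le_tpot (h.restrict Kᶜ) (n := n) (x := w) (le_max_left 1 (R + R))
          (le_trans (by linarith) (le_max_right _ _))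
        rw [MeasureTheory.measureReal_restrict_apply_univ, hcr] at h4
        linarith
      have h2 : a⁻¹ * φ w ≤ V + e a := by
        have h3 := le_max_right 0 ((V + Real.log D * (1 - a)) / a - V)
        have h4 : a⁻¹ * φ w ≤ (V + Real.log D * (1 - a)) / a := by
          rw [div_eq_inv_mul]
          exact mul_le_mul_of_nonneg_left h1 (inv_nonneg.2 ha0.le)
        simp only [he]
        linarith
      rw [coe_le_iSup_coe_iff]
      intro ε' hε'
      obtain ⟨n, hn⟩ := coe_le_iSup_coe_iff.1 hwG ε' hε'
      exact ⟨n, by linarith⟩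
    · obtain ⟨R₁, hR₁⟩ := hginf (η / 2) (half_pos hη)
      obtain ⟨R₂, hR₂⟩ := eventually_atTop.1
        ((tendsto_log_sub_log R).eventually (eventually_lt_nhds (half_pos hη)))
      refine ⟨max (max R₁ R₂) (R + 1), fun w hw => ?_⟩
      have h1 : R₁ ≤ ‖w‖ := ((le_max_left _ _).trans (le_max_left _ _)).trans hw
      have h2 : R₂ ≤ ‖w‖ := ((le_max_right _ _).trans (le_max_left _ _)).trans hw
      have h3 : R < ‖w‖ := by linarith [(le_max_right (max R₁ R₂) (R + 1)).trans hw]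
      have h4 := le_neg_log_of_tendstoUniformly hB hφ' h3
      have h5 := hR₂ _ h2
      rw [coe_le_iSup_coe_iff]
      intro ε' hε'
      obtain ⟨n, hn⟩ := coe_le_iSup_coe_iff.1 (hR₁ w h1) ε' hε'
      have h6 := le_max_left 0 ((V + Real.log D * (1 - a)) / a - V)
      exact ⟨n, by simp only [he]; linarith⟩
  have hlim : Tendsto (fun a : ℝ => a * (γ + e a) + k * (1 - a)) (𝓝 1) (𝓝 γ) := by
    have hc : ContinuousAt (fun a : ℝ => a * (γ + e a) + k * (1 - a)) 1 := by
      have : ContinuousAt e 1 := by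
        refine continuousAt_const.max (ContinuousAt.sub (ContinuousAt.div ?_ ?_ one_ne_zero) ?_) <;>
          fun_prop
      fun_prop
    have h1 := hc.tendsto
    simpa [he] using h1
  choose! a ha using key
  have hseq : Tendsto (fun j : ℕ => a (1 / ((j : ℝ) + 2))) atTop (𝓝 1) := by
    have hpos : ∀ j : ℕ, (0 : ℝ) < 1 / ((j : ℝ) + 2) ∧ 1 / ((j : ℝ) + 2) < 1 := fun j =>
      ⟨by positivity, by rw [div_lt_one (by positivity)]; linarith [(Nat.cast_nonneg j : (0:ℝ) ≤ j)]⟩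
    refine tendsto_of_tendsto_of_tendsto_of_le_of_le (g := fun j : ℕ => 1 - 1 / ((j : ℝ) + 2)) ?_
      tendsto_const_nhds (fun j => (ha _ (hpos j).1 (hpos j).2).1)
      (fun j => (ha _ (hpos j).1 (hpos j).2).2.1)
    have : Tendsto (fun j : ℕ => 1 / ((j : ℝ) + 2)) atTop (𝓝 0) :=
      tendsto_const_nhds.div_atTop
        (tendsto_atTop_add_const_right _ 2 tendsto_natCast_atTop_atTop)
    simpa using tendsto_const_nhds.sub this
  refine absurd (ge_of_tendsto' (hlim.comp hseq) fun j => ?_) (not_le.2 hlt)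
  exact (ha _ (by positivity) (by
    rw [div_lt_one (by positivity)]; linarith [(Nat.cast_nonneg j : (0:ℝ) ≤ j)])).2.2

/-! ### Frostman's theorem -/

section
variable {R : ℝ} {ν σ : Measure ℂ} [IsFiniteMeasure ν]

lemma le_tpot_add (h : BddBy R ν) (n : ℕ) {x : ℂ} (hx : ‖x‖ ≤ R) :
    0 ≤ tpot n ν x + Real.log (max 1 (R + R)) * ν.real Set.univ := by
  have := le_tpot h (n := n) (x := x) (le_max_left 1 (R + R))
    (le_trans (by linarith) (le_max_right _ _))
  linarith

/-- Adding the constant makes all truncated potentials nonnegative on the disc, which permits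
monotone convergence. -/
lemma lintegral_iSup_tpot_le [IsFiniteMeasure σ] (h : BddBy R ν) (hσ : BddBy R σ) {M : ℝ}
    (hM : ∀ n, ∫ x, tpot n ν x ∂σ ≤ M) :
    ∫⁻ x, ⨆ n, ENNReal.ofReal (tpot n ν x + Real.log (max 1 (R + R)) * ν.real Set.univ) ∂σ ≤
      ENNReal.ofReal (M + Real.log (max 1 (R + R)) * ν.real Set.univ * σ.real Set.univ) := by
  rw [lintegral_iSup (fun n => ((continuous_tpot h n).measurable.add_const _).ennreal_ofReal)
    fun i j hij x => ENNReal.ofReal_le_ofReal (by linarith [tpot_mono h hij x])]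
  refine iSup_le fun n => ?_
  have hi := (integrable_tpot h hσ n).add
    (integrable_const (Real.log (max 1 (R + R)) * ν.real Set.univ) (μ := σ))
  refine (ofReal_integral_eq_lintegral_ofReal hi ?_).symm.trans_le (ENNReal.ofReal_le_ofReal ?_)
  · filter_upwards [hσ] with x hx using le_tpot_add h n hx
  · simp only [Pi.add_apply]
    rw [integral_add (integrable_tpot h hσ n) (integrable_const _)]
    simp only [integral_const, smul_eq_mul]
    linarith [hM n]

lemma ae_potential_ne_top [IsFiniteMeasure σ] (h : BddBy R ν) (hσ : BddBy R σ) {M : ℝ}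
    (hM : ∀ n, ∫ x, tpot n ν x ∂σ ≤ M) : ∀ᵐ x ∂σ, potential ν x ≠ ⊤ := by
  have h1 := (lintegral_iSup_tpot_le h hσ hM).trans_lt ENNReal.ofReal_lt_top
  have hm : Measurable fun x => ⨆ n,
      ENNReal.ofReal (tpot n ν x + Real.log (max 1 (R + R)) * ν.real Set.univ) :=
    Measurable.iSup fun n => ((continuous_tpot h n).measurable.add_const _).ennreal_ofReal
  filter_upwards [ae_lt_top hm h1.ne, hσ] with x hx hxR
  set F := ⨆ n, ENNReal.ofReal (tpot n ν x + Real.log (max 1 (R + R)) * ν.real Set.univ) with hF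
  have : potential ν x ≤
      ((F.toReal - Real.log (max 1 (R + R)) * ν.real Set.univ : ℝ) : EReal) := by
    rw [potential_le_iff h]
    intro n
    rw [EReal.coe_le_coe_iff, le_sub_iff_add_le, ← ENNReal.ofReal_le_iff_le_toReal hx.ne]
    exact le_iSup (fun n => ENNReal.ofReal
      (tpot n ν x + Real.log (max 1 (R + R)) * ν.real Set.univ)) n
  exact (this.trans_lt (EReal.coe_lt_top _)).ne

/-- A function that is a.e. at least `M` and has mean at most `M` equals `M` a.e.; the mean bound is
phrased for truncations, so that no integral of a possibly infinite potential occurs. -/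
lemma ae_potential_eq [IsProbabilityMeasure σ] (h : BddBy R ν) (hσ : BddBy R σ) {M : ℝ}
    (hM : ∀ n, ∫ x, tpot n ν x ∂σ ≤ M) (hge : ∀ᵐ x ∂σ, (M : EReal) ≤ potential ν x) :
    ∀ᵐ x ∂σ, potential ν x = M := by
  set c := Real.log (max 1 (R + R)) * ν.real Set.univ with hc
  have h1 := lintegral_iSup_tpot_le h hσ hM
  rw [probReal_univ (μ := σ), mul_one, ← hc] at h1
  have hm : Measurable fun x => ⨆ n, ENNReal.ofReal (tpot n ν x + c) :=
    Measurable.iSup fun n => ((continuous_tpot h n).measurable.add_const _).ennreal_ofReal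
  have hle : ∀ᵐ x ∂σ, ENNReal.ofReal (M + c) ≤ ⨆ n, ENNReal.ofReal (tpot n ν x + c) := by
    filter_upwards [hge] with x hx
    rw [potential_eq_iSup h] at hx
    refine ENNReal.le_of_forall_pos_le_add fun ε hε _ => ?_
    obtain ⟨n, hn⟩ := coe_le_iSup_coe_iff.1 hx ε (by exact_mod_cast hε)
    refine le_trans ?_ (add_le_add_left (le_iSup (fun n => ENNReal.ofReal (tpot n ν x + c)) n) _)
    rw [← ENNReal.ofReal_coe_nnreal]
    exact (ENNReal.ofReal_le_ofReal (by linarith)).trans ENNReal.ofReal_add_le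
  have heq := ae_eq_of_ae_le_of_lintegral_le hle (by simp) hm.aemeasurable
    (by simpa using h1)
  have hMc : 0 ≤ M + c := by
    have : ∀ᵐ x ∂σ, 0 ≤ tpot 0 ν x + c := by
      filter_upwards [hσ] with x hx using le_tpot_add h 0 hx
    have h2 := integral_nonneg_of_ae this
    rw [integral_add (integrable_tpot h hσ 0) (integrable_const _)] at h2
    simp only [integral_const, probReal_univ, one_smul] at h2
    linarith [hM 0]
  filter_upwards [heq, hge] with x hx hxge
  refine le_antisymm ((potential_le_iff h).2 fun n => EReal.coe_le_coe_iff.2 ?_) hxge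
  have h2 := (le_iSup (fun n => ENNReal.ofReal (tpot n ν x + c)) n).trans_eq hx.symm
  rw [ENNReal.ofReal_le_ofReal_iff hMc] at h2
  linarith

lemma FiniteEnergy.ae_potential_ne_top (hE : FiniteEnergy ν) (h : BddBy R ν) :
    ∀ᵐ x ∂ν, potential ν x ≠ ⊤ :=
  hE.elim fun _ hM => OPRegular.ae_potential_ne_top h h hM

end

/-- The maximum principle for potentials. -/
lemma potential_le_of_ae_le {R : ℝ} {ρ : Measure ℂ} [IsProbabilityMeasure ρ]
    (h : BddBy R ρ) {V : ℝ} (hV : ∀ᵐ z ∂ρ, potential ρ z ≤ V) (z : ℂ) : potential ρ z ≤ V := by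
  have := potential_le_of_superharmonic h hV (g := fun _ _ => V) (fun _ => continuous_const)
    (fun _ _ _ _ => le_rfl) (fun n c r _ => by simp) (by simp) (fun η hη => ?_) z
  · simpa using this
  · obtain ⟨R', hR'⟩ := eventually_atTop.1 (Real.tendsto_log_atTop.eventually_ge_atTop (-V))
    refine ⟨R', fun z hz => ?_⟩
    simp only [ciSup_const, EReal.coe_le_coe_iff]
    linarith [hR' _ hz]

/-- The principle of domination for potentials of probability measures. -/
lemma potential_le_potential_of_ae {R : ℝ} {ρ ν : Measure ℂ} [IsProbabilityMeasure ρ]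
    [IsProbabilityMeasure ν] (h : BddBy R ρ) (hν : BddBy R ν) {V : ℝ}
    (hV : ∀ᵐ z ∂ρ, potential ρ z ≤ V) (hVν : ∀ᵐ z ∂ρ, (V : EReal) ≤ potential ν z) (z : ℂ) :
    potential ρ z ≤ potential ν z := by
  rw [potential_eq_iSup hν]
  refine potential_le_of_superharmonic h hV (g := fun n => tpot n ν) (continuous_tpot hν)
    (fun z i j hij => tpot_mono hν hij z) (fun n c r hr => integral_tpot_circ_le hν c hr n)
    (by simpa only [potential_eq_iSup hν] using hVν) (fun η hη => ?_) z
  obtain ⟨R₂, hR₂⟩ := eventually_atTop.1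
    ((tendsto_log_sub_log (-R)).eventually (eventually_gt_nhds (neg_lt_zero.2 hη)))
  refine ⟨max R₂ (max 1 (1 - R)), fun z hz => ?_⟩
  have h1 : R₂ ≤ ‖z‖ := (le_max_left _ _).trans hz
  have h2 : 1 - R ≤ ‖z‖ := ((le_max_right _ _).trans (le_max_right _ _)).trans hz
  refine le_trans ?_ (le_iSup (fun n => ((tpot n ν z : ℝ) : EReal)) 0)
  rw [EReal.coe_le_coe_iff]
  have h3 := le_tpot hν (n := 0) (x := z) (D := ‖z‖ + R) (by linarith) le_rfl
  have h4 := hR₂ _ h1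
  rw [probReal_univ, mul_one] at h3
  rw [sub_neg_eq_add] at h4
  linarith

section
variable {R : ℝ} {K : Set ℂ} {ρ : Measure ℂ}

lemma IsEquilibriumMeasure.energy_eq (hK : IsCompact K) (hcap : capacity K ≠ 0)
    (hρ : IsEquilibriumMeasure K ρ) : energy ρ = robin K := by
  rw [hρ.2.2, log_capacity_inv, coe_robin hK hcap]

lemma IsEquilibriumMeasure.measure_compl (hρ : IsEquilibriumMeasure K ρ) : ρ Kᶜ = 0 :=
  measure_compl_eq_zero_of_support_subset hρ.2.1

lemma IsEquilibriumMeasure.integral_le (hK : IsCompact K) (hcap : capacity K ≠ 0)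
    (hρ : IsEquilibriumMeasure K ρ) (h : BddBy R ρ) (n : ℕ) : ∫ x, tpot n ρ x ∂ρ ≤ robin K := by
  have := hρ.1
  rw [← EReal.coe_le_coe_iff, ← hρ.energy_eq hK hcap]
  exact (energy_le_iff h).1 le_rfl n

lemma integral_tpot_mix {σ : Measure ℂ} [IsFiniteMeasure ρ] [IsFiniteMeasure σ]
    (h : BddBy R ρ) (hσ : BddBy R σ) (a b : ℝ≥0∞) (ha : a ≠ ⊤) (hb : b ≠ ⊤) (n : ℕ) :
    ∫ x, tpot n (a • ρ + b • σ) x ∂(a • ρ + b • σ) =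
      a.toReal ^ 2 * ∫ x, tpot n ρ x ∂ρ + 2 * a.toReal * b.toReal * ∫ x, tpot n ρ x ∂σ +
        b.toReal ^ 2 * ∫ x, tpot n σ x ∂σ := by
  have := Measure.smul_finite ρ ha
  have := Measure.smul_finite σ hb
  have h1 : ∀ x, tpot n (a • ρ + b • σ) x = a.toReal * tpot n ρ x + b.toReal * tpot n σ x :=
    fun x => by rw [tpot_add (h.smul a) (hσ.smul b), tpot_smul, tpot_smul]
  simp_rw [h1]
  have i1 : ∀ m : Measure ℂ, BddBy R m → IsFiniteMeasure m → Integrable (fun x =>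
      a.toReal * tpot n ρ x + b.toReal * tpot n σ x) m := fun m hm _ =>
    ((integrable_tpot h hm n).const_mul _).add ((integrable_tpot hσ hm n).const_mul _)
  have i2 : ∀ m : Measure ℂ, BddBy R m → IsFiniteMeasure m → ∫ x,
      (a.toReal * tpot n ρ x + b.toReal * tpot n σ x) ∂m =
      a.toReal * ∫ x, tpot n ρ x ∂m + b.toReal * ∫ x, tpot n σ x ∂m := by
    intro m hm _
    rw [integral_add ((integrable_tpot h hm n).const_mul _) ((integrable_tpot hσ hm n).const_mul _),
      integral_const_mul, integral_const_mul]
  rw [integral_add_measure (i1 _ (h.smul a) inferInstance) (i1 _ (hσ.smul b) inferInstance),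
    integral_smul_measure, integral_smul_measure, i2 ρ h inferInstance, i2 σ hσ inferInstance,
    integral_tpot_comm hσ h n]
  simp only [smul_eq_mul]
  ring

/-- Frostman's theorem, the lower bound. -/
lemma IsEquilibriumMeasure.capacity_setOf_lt (hK : IsCompact K) (hcap : capacity K ≠ 0)
    (hρ : IsEquilibriumMeasure K ρ) : capacity {z ∈ K | potential ρ z < robin K} = 0 := by
  have hprob := hρ.1
  refine capacity_eq_zero_of_forall fun σ R' hσp hσ hσE _ hsupp => ?_
  obtain ⟨R₀, _, hR₀⟩ := exists_norm_le_of_isCompact hK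
  obtain ⟨M, hM⟩ := hσE
  have h : BddBy (max R₀ R') ρ :=
    (bddBy_of_measure_compl hR₀ hρ.measure_compl).mono (le_max_left _ _)
  replace hσ : BddBy (max R₀ R') σ := hσ.mono (le_max_right _ _)
  set V := robin K
  have hae : ∀ᵐ z ∂σ, z ∈ K ∧ potential ρ z < V :=
    mem_ae_iff.2 (measure_compl_eq_zero_of_support_subset hsupp)
  have hφm : Measurable fun z => (potential ρ z).toReal := (measurable_potential h).ereal_toReal
  have hφ : ∀ᵐ z ∂σ, ∀ n, tpot n ρ z ≤ (potential ρ z).toReal := by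
    filter_upwards [hae] with z hz n
    rw [← EReal.coe_le_coe_iff, EReal.coe_toReal (hz.2.trans (EReal.coe_lt_top _)).ne
      (potential_ne_bot h z)]
    exact tpot_le_potential h n z
  have hφV : ∀ᵐ z ∂σ, (potential ρ z).toReal < V := by
    filter_upwards [hae] with z hz
    rw [← EReal.coe_lt_coe_iff, EReal.coe_toReal (hz.2.trans (EReal.coe_lt_top _)).ne
      (potential_ne_bot h z)]
    exact hz.2
  have hφi : Integrable (fun z => (potential ρ z).toReal) σ := by
    refine Integrable.mono' (g := fun z => |tpot 0 ρ z| + |V|)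
      ((integrable_tpot h hσ 0).abs.add (integrable_const _)) hφm.aestronglyMeasurable ?_
    filter_upwards [hφ, hφV] with z h1 h2
    rw [Real.norm_eq_abs, abs_le]
    have h3 := h1 0
    constructor
    · linarith [neg_abs_le (tpot 0 ρ z), abs_nonneg V]
    · linarith [le_abs_self V, abs_nonneg (tpot 0 ρ z)]
  set J := ∫ z, (potential ρ z).toReal ∂σ
  have hJ : J < V := by
    have h1 : J ≤ V := by
      have := integral_mono_ae hφi (integrable_const V) (hφV.mono fun z hz => hz.le)
      simpa using this
    refine lt_of_le_of_ne h1 fun heq => ?_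
    have h2 : ∫ z, (V - (potential ρ z).toReal) ∂σ = 0 := by
      rw [integral_sub (integrable_const _) hφi]
      simp only [integral_const, probReal_univ, one_smul]
      exact sub_eq_zero.2 heq.symm
    have h5 : 0 ≤ᵐ[σ] fun z => V - (potential ρ z).toReal :=
      hφV.mono fun z hz => by simp only [Pi.zero_apply]; linarith
    rw [integral_eq_zero_iff_of_nonneg_ae h5 ((integrable_const V).sub hφi)] at h2
    obtain ⟨z, h3, h4⟩ := (h2.and hφV).exists
    simp only [Pi.zero_apply] at h3
    linarith
  have hJn : ∀ n, ∫ x, tpot n ρ x ∂σ ≤ J := fun n =>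
    integral_mono_ae (integrable_tpot h hσ n) hφi (hφ.mono fun z hz => hz n)
  -- The variational argument: the energy of `(1 - t) ρ + t σ` is at least the minimum `V`, but the
  -- upper bound on the right has derivative `2 (J - V) < 0` at `t = 0`.
  have key : ∀ t : ℝ, 0 < t → t < 1 → V ≤ (1 - t) ^ 2 * V + 2 * (1 - t) * t * J + t ^ 2 * M := by
    intro t ht ht1
    set τ := ENNReal.ofReal (1 - t) • ρ + ENNReal.ofReal t • σ
    have hτp : IsProbabilityMeasure τ := by
      constructor
      simp only [τ, Measure.add_apply, Measure.smul_apply, measure_univ, smul_eq_mul, mul_one]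
      rw [← ENNReal.ofReal_add (by linarith) ht.le]
      simp
    have hτ : BddBy (max R₀ R') τ := by
      unfold BddBy
      rw [ae_add_measure_iff]
      exact ⟨h.smul _, hσ.smul _⟩
    have hτK : τ Kᶜ = 0 := by
      have h1 : σ Kᶜ = 0 := mem_ae_iff.1 (hae.mono fun z hz => hz.1)
      simp [τ, hρ.measure_compl, h1]
    have h1 : (V : EReal) ≤ energy τ := by
      rw [coe_robin hK hcap]; exact minEnergy_le_of_measure_compl hK hτK
    rw [← EReal.coe_le_coe_iff]
    refine h1.trans ((energy_le_iff hτ).2 fun n => EReal.coe_le_coe_iff.2 ?_)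
    rw [integral_tpot_mix h hσ _ _ ENNReal.ofReal_ne_top ENNReal.ofReal_ne_top,
      ENNReal.toReal_ofReal (by linarith), ENNReal.toReal_ofReal ht.le]
    have h2 := hρ.integral_le hK hcap h n
    have h3 : 0 ≤ 2 * (1 - t) * t := mul_nonneg (by linarith) ht.le
    gcongr
    · exact hJn n
    · exact hM n
  have key2 : ∀ t : ℝ, 0 < t → t < 1 → 2 * V ≤ 2 * J + t * (V - 2 * J + M) := by
    intro t ht ht1
    have := key t ht ht1
    refine le_of_mul_le_mul_left ?_ ht
    nlinarith
  have hlim : Tendsto (fun t : ℝ => 2 * J + t * (V - 2 * J + M)) (𝓝[>] 0) (𝓝 (2 * J)) := by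
    have : Continuous fun t : ℝ => 2 * J + t * (V - 2 * J + M) := by fun_prop
    simpa using (this.tendsto 0).mono_left nhdsWithin_le_nhds
  have := ge_of_tendsto hlim (Eventually.mono (Ioo_mem_nhdsGT one_pos) fun t ht =>
    key2 t ht.1 ht.2)
  linarith

lemma IsEquilibriumMeasure.finiteEnergy (hK : IsCompact K) (hcap : capacity K ≠ 0)
    (hρ : IsEquilibriumMeasure K ρ) : FiniteEnergy ρ := by
  obtain ⟨R, _, hR⟩ := exists_norm_le_of_isCompact hK
  exact ⟨robin K, hρ.integral_le hK hcap (bddBy_of_measure_compl hR hρ.measure_compl)⟩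

lemma measurableSet_setOf_potential_lt [IsFiniteMeasure ρ] (hK : IsCompact K) (h : BddBy R ρ)
    (V : ℝ) : MeasurableSet {z ∈ K | potential ρ z < V} :=
  hK.measurableSet.inter (measurableSet_lt (measurable_potential h) measurable_const)

/-- Having finite energy, `ρ` does not charge the exceptional set of the lower bound; and the mean
of its potential is exactly bounded by the Robin constant. -/
lemma IsEquilibriumMeasure.ae_eq (hK : IsCompact K) (hcap : capacity K ≠ 0)
    (hρ : IsEquilibriumMeasure K ρ) : ∀ᵐ z ∂ρ, potential ρ z = robin K := by
  have := hρ.1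
  obtain ⟨R, _, hR⟩ := exists_norm_le_of_isCompact hK
  have h := bddBy_of_measure_compl hR hρ.measure_compl
  refine ae_potential_eq h h (hρ.integral_le hK hcap h) ?_
  have h1 := measure_eq_zero_of_capacity_eq_zero h (hρ.finiteEnergy hK hcap)
    (measurableSet_setOf_potential_lt hK h _) (hρ.capacity_setOf_lt hK hcap)
  filter_upwards [(mem_ae_iff.2 hρ.measure_compl : ∀ᵐ z ∂ρ, z ∈ K), measure_eq_zero_iff_ae_notMem.1 h1]
    with z hz1 hz2
  by_contra! hcon
  exact hz2 ⟨hz1, hcon⟩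

/-- Frostman's theorem, the upper bound. -/
lemma IsEquilibriumMeasure.potential_le (hK : IsCompact K) (hcap : capacity K ≠ 0)
    (hρ : IsEquilibriumMeasure K ρ) (z : ℂ) : potential ρ z ≤ robin K := by
  have := hρ.1
  obtain ⟨R, _, hR⟩ := exists_norm_le_of_isCompact hK
  exact potential_le_of_ae_le (bddBy_of_measure_compl hR hρ.measure_compl)
    ((hρ.ae_eq hK hcap).mono fun z hz => hz.le) z

end

/-! ### The unbounded component of the complement of a compact set -/

section
variable {E : Set ℂ}

lemma mem_unboundedComponent_of_mem {z w : ℂ} (hz : z ∈ unboundedComponent E)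
    (hw : w ∈ connectedComponentIn Eᶜ z) : w ∈ unboundedComponent E :=
  ⟨connectedComponentIn_subset _ _ hw, connectedComponentIn_eq hw ▸ hz.2⟩

lemma isOpen_unboundedComponent (hE : IsClosed E) : IsOpen (unboundedComponent E) := by
  rw [isOpen_iff_mem_nhds]
  intro z hz
  exact mem_of_superset ((hE.isOpen_compl.connectedComponentIn).mem_nhds
    (mem_connectedComponentIn hz.1)) fun w hw => mem_unboundedComponent_of_mem hz hw

/-- The radial ray from `z` to infinity is connected and misses `E`. -/
lemma mem_unboundedComponent_of_norm {R : ℝ} (hR0 : 0 ≤ R) (hR : ∀ x ∈ E, ‖x‖ ≤ R) {z : ℂ}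
    (hz : R < ‖z‖) : z ∈ unboundedComponent E := by
  have hz0 : 0 < ‖z‖ := hR0.trans_lt hz
  set L : Set ℂ := (fun t : ℝ => (t : ℂ) * z) '' Set.Ici 1 with hL
  have hLpre : IsPreconnected L :=
    isPreconnected_Ici.image _ (by fun_prop : Continuous fun t : ℝ => (t : ℂ) * z).continuousOn
  have hnorm : ∀ t : ℝ, 1 ≤ t → ‖(t : ℂ) * z‖ = t * ‖z‖ := fun t ht => by
    rw [norm_mul, Complex.norm_real, Real.norm_eq_abs, abs_of_pos (by linarith)]
  have hLE : L ⊆ Eᶜ := by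
    rintro _ ⟨t, ht, rfl⟩ hmem
    have h1 := hR _ hmem
    have ht : (1 : ℝ) ≤ t := ht
    simp only [hnorm t ht] at h1
    nlinarith
  have hzL : z ∈ L := ⟨1, Set.mem_Ici.2 le_rfl, by simp⟩
  refine ⟨hLE hzL, fun hb => ?_⟩
  obtain ⟨C, hC⟩ := (hb.subset (hLpre.subset_connectedComponentIn hzL hLE)).exists_norm_le
  have h2 := hC _ ⟨max 1 (C / ‖z‖ + 1), Set.mem_Ici.2 (le_max_left _ _), rfl⟩
  simp only [hnorm _ (le_max_left _ _)] at h2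
  have h3 : (C / ‖z‖ + 1) * ‖z‖ ≤ max 1 (C / ‖z‖ + 1) * ‖z‖ :=
    mul_le_mul_of_nonneg_right (le_max_right _ _) hz0.le
  rw [add_mul, div_mul_cancel₀ _ hz0.ne'] at h3
  linarith

lemma isCompact_compl_unboundedComponent (hE : IsCompact E) :
    IsCompact (unboundedComponent E)ᶜ := by
  obtain ⟨R, hR1, hR⟩ := exists_norm_le_of_isCompact hE
  refine (isCompact_closedBall (0 : ℂ) R).of_isClosed_subset
    (isOpen_unboundedComponent hE.isClosed).isClosed_compl fun z hz => ?_
  by_contra hcon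
  exact hz (mem_unboundedComponent_of_norm (by linarith) hR (by simpa using hcon))

lemma subset_compl_unboundedComponent : E ⊆ (unboundedComponent E)ᶜ :=
  fun _ hz h => h.1 hz

/-- A boundary point outside `E` would have an open component meeting `Ω`, and so would lie in the
open set `Ω`. -/
lemma frontier_unboundedComponent_subset (hE : IsClosed E) :
    frontier (unboundedComponent E) ⊆ E := by
  intro z hz
  by_contra hzE
  have hO := isOpen_unboundedComponent hE
  have h1 : connectedComponentIn Eᶜ z ∈ 𝓝 z :=
    hE.isOpen_compl.connectedComponentIn.mem_nhds (mem_connectedComponentIn hzE)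
  obtain ⟨w, hw1, hw2⟩ := mem_closure_iff_nhds.1 hz.1 _ h1
  have h2 : z ∈ connectedComponentIn Eᶜ w := by
    rw [← connectedComponentIn_eq hw1]; exact mem_connectedComponentIn hzE
  exact hz.2 (hO.interior_eq.symm ▸ mem_unboundedComponent_of_mem hw2 h2)

end

/-! ### Equilibrium measures live on the outer boundary -/

section
variable {K : Set ℂ} {ρ : Measure ℂ}

lemma finiteEnergy_circ (c : ℂ) {r : ℝ} (hr : 0 < r) : FiniteEnergy (circ c r) := by
  refine ⟨-Real.log r, fun n => ?_⟩
  have := integral_mono (integrable_tpot (bddBy_circ c hr.le) (bddBy_circ c hr.le) n)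
    (integrable_const (-Real.log r)) (μ := circ c r) fun y => (tpot_circ_le_log hr n).trans
      (neg_le_neg (Real.log_le_log hr (le_max_left r ‖c - y‖)))
  simpa using this

/-- The bounding circle has finite energy, so the potential equals the Robin constant a.e. on it,
and superharmonicity carries this value to the centre. Equality between the centre value and the
circle mean forces the measure to leave the open disc empty. -/
lemma IsEquilibriumMeasure.of_closedBall_subset (hK : IsCompact K) (hcap : capacity K ≠ 0)
    (hρ : IsEquilibriumMeasure K ρ) {z : ℂ} {r : ℝ} (hr : 0 < r)
    (hzr : Metric.closedBall z r ⊆ K) :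
    potential ρ z = robin K ∧ ρ (Metric.ball z r) = 0 := by
  have hprob := hρ.1
  obtain ⟨R, _, hR⟩ := exists_norm_le_of_isCompact hK
  have h := bddBy_of_measure_compl hR hρ.measure_compl
  have hcb := bddBy_circ z hr.le
  set V := robin K
  have hle : ∀ n x, tpot n ρ x ≤ V := fun n x =>
    EReal.coe_le_coe_iff.1 ((potential_le_iff h).1 (hρ.potential_le hK hcap x) n)
  have hcirc : ∀ᵐ x ∂(circ z r), potential ρ x = V := by
    have h1 := measure_eq_zero_of_capacity_eq_zero hcb (finiteEnergy_circ z hr)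
      (measurableSet_setOf_potential_lt hK h _) (hρ.capacity_setOf_lt hK hcap)
    filter_upwards [ae_circ z hr.le, measure_eq_zero_iff_ae_notMem.1 h1] with x hx1 hx2
    refine le_antisymm (hρ.potential_le hK hcap x) ?_
    by_contra! hcon
    refine hx2 ⟨hzr ?_, hcon⟩
    rw [mem_closedBall_iff_norm, hx1]
  have hint : ∀ n, Integrable (tpot n ρ) (circ z r) := fun n =>
    integrable_tpot (h.mono (le_max_left R (‖z‖ + r))) (hcb.mono (le_max_right R (‖z‖ + r))) n
  have hlim : Tendsto (fun n => ∫ x, tpot n ρ x ∂(circ z r)) atTop (𝓝 V) := by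
    have : ∫ _, V ∂(circ z r) = V := by simp
    rw [← this]
    refine integral_tendsto_of_tendsto_of_monotone hint (integrable_const _)
      (ae_of_all _ fun x i j hij => tpot_mono h hij x) ?_
    filter_upwards [hcirc] with x hx
    have := tendsto_tpot_toReal h (x := x) (by rw [hx]; exact EReal.coe_ne_top _)
    simpa [hx] using this
  refine ⟨le_antisymm (hρ.potential_le hK hcap z) ?_, ?_⟩
  · rw [potential_eq_iSup h, coe_le_iSup_coe_iff]
    intro ε hε
    obtain ⟨n, hn⟩ := (hlim.eventually (lt_mem_nhds (show V - ε < V by linarith))).exists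
    exact ⟨n, hn.trans_le (integral_tpot_circ_le h z hr n)⟩
  -- With `e^{-N} < r` the kernel at level `N` exceeds its circle average strictly on the open disc
  -- and nowhere falls below it.
  · obtain ⟨N, hN⟩ := exists_nat_gt (-Real.log r)
    have hNr : Real.exp (-N) < r := by
      rw [← Real.lt_log_iff_exp_lt hr]; linarith
    have hmi : Integrable (fun y => -Real.log (max r ‖z - y‖)) ρ := by
      refine Integrable.of_bound (C := |Real.log r| + (‖z‖ + R + r))
        (Measurable.aestronglyMeasurable (by fun_prop)) ?_
      filter_upwards [h] with y hy
      have h1 := Real.log_le_log hr (le_max_left r ‖z - y‖)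
      have h2 := Real.log_le_sub_one_of_pos (lt_max_of_lt_left hr : 0 < max r ‖z - y‖)
      have h3 : max r ‖z - y‖ ≤ ‖z‖ + R + r :=
        max_le (by linarith [norm_nonneg z, norm_nonneg y])
          (by linarith [norm_sub_le z y])
      rw [norm_neg, Real.norm_eq_abs, abs_le]
      constructor
      · linarith [neg_abs_le (Real.log r), norm_nonneg z, norm_nonneg y]
      · linarith [abs_nonneg (Real.log r)]
    have h1 : V ≤ ∫ y, -Real.log (max r ‖z - y‖) ∂ρ := by
      refine le_of_tendsto' hlim fun n => ?_
      rw [integral_tpot_circ h z hr.le]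
      exact integral_mono (integrable_tpot (hcb.mono (le_max_right R (‖z‖ + r)))
        (h.mono (le_max_left R (‖z‖ + r))) n) hmi fun y => tpot_circ_le_log hr n
    have h2 : ∫ y, (ker N z y - -Real.log (max r ‖z - y‖)) ∂ρ ≤ 0 := by
      rw [integral_sub (integrable_ker h N z) hmi]
      have := hle N z
      rw [tpot] at this
      linarith
    have h3 : ∀ y, ker N z y - -Real.log (max r ‖z - y‖) =
        Real.log (max r ‖z - y‖) - Real.log (max ‖z - y‖ (Real.exp (-N))) := fun y => by
      rw [ker]; ring
    simp_rw [h3] at h2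
    have h4 : ∀ y, 0 ≤ Real.log (max r ‖z - y‖) - Real.log (max ‖z - y‖ (Real.exp (-N))) :=
      fun y => sub_nonneg.2 (Real.log_le_log (ker_arg_pos N z y)
        (max_le (le_max_right _ _) (hNr.le.trans (le_max_left _ _))))
    have hi : Integrable (fun y => Real.log (max r ‖z - y‖) -
        Real.log (max ‖z - y‖ (Real.exp (-N)))) ρ := by
      simp_rw [← h3]; exact (integrable_ker h N z).sub hmi
    have h5 := (integral_eq_zero_iff_of_nonneg h4 hi).1
      (le_antisymm h2 (integral_nonneg h4))
    rw [measure_eq_zero_iff_ae_notMem]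
    filter_upwards [h5] with y hy hmem
    rw [mem_ball_iff_norm'] at hmem
    simp only [Pi.zero_apply] at hy
    have h6 := Real.log_lt_log (ker_arg_pos N z y) (max_lt (hmem.trans_le (le_max_left r _))
      (hNr.trans_le (le_max_left r ‖z - y‖)))
    linarith

lemma exists_closedBall_subset_of_mem_interior {z : ℂ} (hz : z ∈ interior K) :
    ∃ r > 0, Metric.closedBall z r ⊆ K :=
  Metric.nhds_basis_closedBall.mem_iff.1 (mem_interior_iff_mem_nhds.1 hz)

lemma IsEquilibriumMeasure.measure_interior (hK : IsCompact K) (hcap : capacity K ≠ 0)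
    (hρ : IsEquilibriumMeasure K ρ) : ρ (interior K) = 0 := by
  refine measure_null_of_locally_null _ fun z hz => ?_
  obtain ⟨r, hr, hzr⟩ := exists_closedBall_subset_of_mem_interior hz
  exact ⟨_, mem_nhdsWithin_of_mem_nhds (Metric.ball_mem_nhds z hr),
    (hρ.of_closedBall_subset hK hcap hr hzr).2⟩

end

section
variable {E : Set ℂ} {ρ : Measure ℂ}

lemma capacity_compl_unboundedComponent_ne_zero (hcap : capacity E ≠ 0) :
    capacity (unboundedComponent E)ᶜ ≠ 0 := by
  rw [Ne, capacity_eq_zero_iff] at hcap ⊢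
  intro h
  have := minEnergy_anti (subset_compl_unboundedComponent (E := E))
  rw [h, top_le_iff] at this
  exact hcap this

lemma IsEquilibriumMeasure.measure_compl_frontier (hE : IsCompact E) (hcap : capacity E ≠ 0)
    (hρ : IsEquilibriumMeasure (unboundedComponent E)ᶜ ρ) :
    ρ (frontier (unboundedComponent E))ᶜ = 0 := by
  have hF := isCompact_compl_unboundedComponent hE
  have hcF := capacity_compl_unboundedComponent_ne_zero hcap
  rw [← frontier_compl]
  refine measure_mono_null (t := (unboundedComponent E)ᶜᶜ ∪ interior (unboundedComponent E)ᶜ) ?_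
    (measure_union_null hρ.measure_compl (hρ.measure_interior hF hcF))
  intro z hz
  by_contra hcon
  rw [Set.mem_union, not_or, Set.notMem_compl_iff] at hcon
  exact hz ⟨subset_closure hcon.1, hcon.2⟩

/-- Filling the holes of `E` does not change the capacity: the equilibrium measure of the filled set
lives on `∂Ω ⊆ E`, hence competes for `E`. -/
lemma minEnergy_compl_unboundedComponent (hE : IsCompact E) (hcap : capacity E ≠ 0) :
    minEnergy (unboundedComponent E)ᶜ = minEnergy E := by
  refine le_antisymm (minEnergy_anti subset_compl_unboundedComponent) ?_
  have hF := isCompact_compl_unboundedComponent hE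
  have hcF := capacity_compl_unboundedComponent_ne_zero hcap
  obtain ⟨ρ, hρ⟩ := exists_isEquilibriumMeasure hF hcF
  have := hρ.1
  rw [← coe_robin hF hcF, ← hρ.energy_eq hF hcF]
  exact minEnergy_le_of_measure_compl hE (measure_mono_null
    (Set.compl_subset_compl.2 (frontier_unboundedComponent_subset hE.isClosed))
    (hρ.measure_compl_frontier hE hcap))

lemma robin_compl_unboundedComponent (hE : IsCompact E) (hcap : capacity E ≠ 0) :
    robin (unboundedComponent E)ᶜ = robin E := by
  rw [robin, robin, minEnergy_compl_unboundedComponent hE hcap]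

lemma IsEquilibriumMeasure.compl_unboundedComponent (hE : IsCompact E) (hcap : capacity E ≠ 0)
    (hρ : IsEquilibriumMeasure E ρ) : IsEquilibriumMeasure (unboundedComponent E)ᶜ ρ :=
  ⟨hρ.1, hρ.2.1.trans subset_compl_unboundedComponent, by
    rw [hρ.2.2, log_capacity_inv, log_capacity_inv, minEnergy_compl_unboundedComponent hE hcap]⟩

end

/-! ### The lower envelope theorem -/

lemma le_of_ae_le_potential {R : ℝ} {ν σ : Measure ℂ} [IsFiniteMeasure ν] [IsProbabilityMeasure σ]
    (h : BddBy R ν) (hσ : BddBy R σ) {c L : ℝ} (hL : ∀ n, ∫ x, tpot n ν x ∂σ ≤ L)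
    (hc : ∀ᵐ x ∂σ, (c : EReal) ≤ potential ν x) : c ≤ L := by
  by_contra! hlt
  have h1 := ae_potential_eq h hσ hL (by
    filter_upwards [hc] with x hx using (EReal.coe_le_coe_iff.2 hlt.le).trans hx)
  obtain ⟨x, hx, hx'⟩ := (h1.and hc).exists
  rw [hx, EReal.coe_le_coe_iff] at hx'
  exact absurd hx' (not_le.2 hlt)

lemma integral_tpot_le_of_ae {R : ℝ} {ν σ : Measure ℂ} [IsFiniteMeasure ν] [IsProbabilityMeasure σ]
    (h : BddBy R ν) (hσ : BddBy R σ) {c : ℝ}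
    (hc : ∀ᵐ x ∂σ, potential ν x ≤ c) (n : ℕ) : ∫ x, tpot n ν x ∂σ ≤ c := by
  have := integral_mono_ae (integrable_tpot h hσ n) (integrable_const c) (by
    filter_upwards [hc] with x hx
    exact EReal.coe_le_coe_iff.1 ((tpot_le_potential h n x).trans hx))
  simpa using this

/-- A set charged by a measure of finite energy carries a probability measure with continuous
potential. Such measures are the test measures of the lower envelope theorem. -/
lemma exists_cond_tendstoUniformly {R : ℝ} {σ : Measure ℂ} [IsFiniteMeasure σ] (hσ : BddBy R σ)
    (hE : FiniteEnergy σ) {A : Set ℂ} (hA : MeasurableSet A) (hA0 : σ A ≠ 0) :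
    ∃ κ : Measure ℂ, IsProbabilityMeasure κ ∧ BddBy R κ ∧ (∀ᵐ x ∂κ, x ∈ A) ∧
      ∃ φ : ℂ → ℝ, TendstoUniformly (fun n => tpot n κ) φ atTop := by
  have hpos : 0 < (σ A).toReal := ENNReal.toReal_pos hA0 (measure_ne_top _ _)
  obtain ⟨K, hKA, hK, hKs, φ, hφ⟩ := exists_isCompact_tendstoUniformly hσ
    (hE.ae_potential_ne_top hσ) hA (half_pos hpos)
  have hσK : σ K ≠ 0 := by
    intro h0
    have h1 : σ A ≤ ENNReal.ofReal ((σ A).toReal / 2) := by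
      calc σ A ≤ σ (A \ K ∪ K) := measure_mono fun x hx => by
            by_cases hxK : x ∈ K
            · exact Or.inr hxK
            · exact Or.inl ⟨hx, hxK⟩
        _ ≤ σ (A \ K) + σ K := measure_union_le _ _
        _ ≤ _ := by rw [h0, add_zero]; exact hKs
    have h2 := (ENNReal.le_ofReal_iff_toReal_le (measure_ne_top σ A) (by positivity)).1 h1
    linarith
  refine ⟨ProbabilityTheory.cond σ K, ProbabilityTheory.cond_isProbabilityMeasure hσK,
    (hσ.restrict K).smul _, ?_, fun x => (σ K).toReal⁻¹ * φ x, ?_⟩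
  · refine Measure.ae_smul_measure ?_ _
    filter_upwards [ae_restrict_mem hK.measurableSet] with x hx using hKA hx
  · have : (fun n => tpot n (ProbabilityTheory.cond σ K)) =
        fun n x => (σ K).toReal⁻¹ * tpot n (σ.restrict K) x := by
      ext n x
      rw [ProbabilityTheory.cond, tpot_smul, ENNReal.toReal_inv]
    rw [this]
    exact (uniformContinuous_const_smul ((σ K).toReal⁻¹ : ℝ)).comp_tendstoUniformly hφ

/-- The lower envelope theorem: along a weakly convergent sequence of probability measures,
eventual lower bounds for the potentials pass to the limit, off sets that are not charged by
measures of finite energy. -/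
lemma ae_le_potential_of_tendsto {R : ℝ} {ν : ℕ → ProbabilityMeasure ℂ} {ν' : ProbabilityMeasure ℂ}
    {σ : Measure ℂ} [IsFiniteMeasure σ] (hν : Tendsto ν atTop (𝓝 ν')) (h : ∀ i, BddBy R (ν i))
    (h' : BddBy R ν') (hσ : BddBy R σ) (hE : FiniteEnergy σ) {a : ℝ}
    (hae : ∀ᵐ z ∂σ, ∀ᶠ j in atTop, (a : EReal) ≤ potential (ν j) z) :
    ∀ᵐ z ∂σ, (a : EReal) ≤ potential ν' z := by
  -- The failure set is cut into countably many pieces with a fixed gap and a fixed starting index.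
  have key : ∀ k m : ℕ, σ {z | potential ν' z ≤ ((a - 1 / (k + 1) : ℝ) : EReal) ∧
      ∀ j ≥ m, (a : EReal) ≤ potential (ν j) z} = 0 := by
    intro k m
    by_contra h0
    have hA : MeasurableSet {z | potential ν' z ≤ ((a - 1 / (k + 1) : ℝ) : EReal) ∧
        ∀ j ≥ m, (a : EReal) ≤ potential (ν j) z} := by
      have : MeasurableSet (⋂ j, ⋂ (_ : j ≥ m), {z | (a : EReal) ≤ potential (ν j) z}) :=
        MeasurableSet.iInter fun j => MeasurableSet.iInter fun _ =>
          measurableSet_le measurable_const (measurable_potential (h j))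
      convert (measurableSet_le (measurable_potential h')
        (measurable_const (a := ((a - 1 / (k + 1) : ℝ) : EReal)))).inter this using 1
      refine Set.ext fun z => ?_
      simp
    obtain ⟨κ, hκp, hκ, hκA, φ, hφ⟩ := exists_cond_tendstoUniformly hσ hE hA h0
    have hφc := continuous_of_tendstoUniformly_tpot hκ hφ
    -- By symmetry the `κ`-mean of the potential of `m` is the `m`-integral of the continuous
    -- function `φ`, to which weak convergence applies.
    have hle : ∀ (m : Measure ℂ) [IsProbabilityMeasure m], BddBy R m →
        Tendsto (fun n => ∫ x, tpot n m x ∂κ) atTop (𝓝 (∫ x, φ x ∂m)) := by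
      intro m _ hm
      simpa only [integral_tpot_comm hκ hm] using (integral_tendsto_of_tendstoUniformly hκ hφ hm).2
    have hup : ∫ x, φ x ∂(ν' : Measure ℂ) ≤ a - 1 / (k + 1) :=
      le_of_tendsto' (hle ν' h') fun n => integral_tpot_le_of_ae h' hκ
        (by filter_upwards [hκA] with x hx using hx.1) n
    have hlow : ∀ j ≥ m, a ≤ ∫ x, φ x ∂(ν j : Measure ℂ) := fun j hj =>
      le_of_ae_le_potential (h j) hκ
        ((monotone_nat_of_le_succ fun n => integral_mono (integrable_tpot (h j) hκ n)
          (integrable_tpot (h j) hκ _) fun x => tpot_mono (h j) n.le_succ x).ge_of_tendsto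
          (hle (ν j) (h j)))
        (by filter_upwards [hκA] with x hx using hx.2 j hj)
    have := ge_of_tendsto (tendsto_integral_of_bddBy hν h h' hφc)
      (eventually_atTop.2 ⟨m, hlow⟩)
    have : (0 : ℝ) < 1 / (k + 1) := by positivity
    linarith
  have h2 := ae_all_iff.2 fun k => ae_all_iff.2 fun m => measure_eq_zero_iff_ae_notMem.1 (key k m)
  filter_upwards [h2, hae] with z hz hz'
  obtain ⟨m, hm⟩ := eventually_atTop.1 hz'
  by_contra! hlt
  obtain ⟨c, hc1, hc2⟩ := EReal.lt_iff_exists_real_btwn.1 hlt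
  rw [EReal.coe_lt_coe_iff] at hc2
  obtain ⟨k, hk⟩ := exists_nat_one_div_lt (sub_pos.2 hc2)
  exact hz k m ⟨hc1.le.trans (EReal.coe_le_coe_iff.2 (by linarith)), hm⟩

/-! ### Orthogonal polynomials -/

section
open Polynomial

lemma integrable_of_continuous {R : ℝ} {μ : Measure ℂ} [IsFiniteMeasure μ] (h : BddBy R μ)
    {F : Type*} [NormedAddCommGroup F] [SecondCountableTopology F] [MeasurableSpace F] [BorelSpace F]
    {f : ℂ → F} (hf : Continuous f) : Integrable f μ := by
  obtain ⟨C, hC⟩ := (isCompact_closedBall (0 : ℂ) R).exists_bound_of_continuousOn hf.continuousOn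
  refine Integrable.of_bound hf.aestronglyMeasurable C ?_
  filter_upwards [h.ae_mem] with y hy using hC y hy

/-- The inner product of polynomials in `L²(μ)`. -/
def innerL2 (μ : Measure ℂ) (P Q : ℂ[X]) : ℂ := ∫ z, (starRingEnd ℂ) (P.eval z) * Q.eval z ∂μ

/-- The square of the norm of a polynomial in `L²(μ)`. -/
def normSqL2 (μ : Measure ℂ) (P : ℂ[X]) : ℝ := ∫ z, ‖P.eval z‖ ^ 2 ∂μ

lemma innerL2_self (μ : Measure ℂ) (P : ℂ[X]) : innerL2 μ P P = (normSqL2 μ P : ℂ) := by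
  rw [innerL2, normSqL2, ← integral_complex_ofReal]
  congr 1
  ext z
  rw [Complex.conj_mul']
  norm_cast

lemma innerL2_comm (μ : Measure ℂ) (P Q : ℂ[X]) :
    innerL2 μ P Q = (starRingEnd ℂ) (innerL2 μ Q P) := by
  rw [innerL2, innerL2, ← integral_conj]
  congr 1
  ext z
  simp [mul_comm]

lemma innerL2_C_mul_right (μ : Measure ℂ) (P Q : ℂ[X]) (c : ℂ) :
    innerL2 μ P (C c * Q) = c * innerL2 μ P Q := by
  rw [innerL2, innerL2, ← integral_const_mul]
  congr 1
  ext z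
  simp
  ring

lemma normSqL2_nonneg (μ : Measure ℂ) (P : ℂ[X]) : 0 ≤ normSqL2 μ P :=
  integral_nonneg fun _ => by positivity

section
variable {R : ℝ} {μ : Measure ℂ} [IsFiniteMeasure μ]

lemma innerL2_add_right (h : BddBy R μ) (P Q Q' : ℂ[X]) :
    innerL2 μ P (Q + Q') = innerL2 μ P Q + innerL2 μ P Q' := by
  rw [innerL2, innerL2, innerL2, ← integral_add (integrable_of_continuous h (by fun_prop))
    (integrable_of_continuous h (by fun_prop))]
  simp [mul_add]

lemma innerL2_sum_right (h : BddBy R μ) (P : ℂ[X]) {ι : Type*} (s : Finset ι) (Q : ι → ℂ[X]) :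
    innerL2 μ P (∑ i ∈ s, Q i) = ∑ i ∈ s, innerL2 μ P (Q i) := by
  classical
  induction s using Finset.induction_on with
  | empty => simp [innerL2]
  | insert a s ha ih => rw [Finset.sum_insert ha, Finset.sum_insert ha, innerL2_add_right h, ih]

/-- A polynomial vanishing a.e. vanishes on the support by continuity, and the support is infinite.
-/
lemma eq_zero_of_normSqL2 (h : BddBy R μ) (hinf : μ.support.Infinite) {P : ℂ[X]}
    (hP : normSqL2 μ P = 0) : P = 0 := by
  have h1 := (integral_eq_zero_iff_of_nonneg (fun z => by positivity)
    (integrable_of_continuous h (f := fun z => ‖P.eval z‖ ^ 2) (by fun_prop))).1 hP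
  refine P.eq_zero_of_infinite_isRoot (hinf.mono fun z hz => ?_)
  by_contra hne
  have hopen : IsOpen {z | P.eval z ≠ 0} :=
    isOpen_ne_fun (by fun_prop) continuous_const
  have h2 : 0 < μ {z | P.eval z ≠ 0} :=
    Measure.mem_support_iff_forall z |>.1 hz _ (hopen.mem_nhds hne)
  refine h2.ne' (measure_eq_zero_iff_ae_notMem.2 ?_)
  filter_upwards [h1] with w hw
  simpa using hw

lemma L2norm_eq (h : BddBy R μ) (P : ℂ[X]) :
    L2norm μ P = ENNReal.ofReal (Real.sqrt (normSqL2 μ P)) := by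
  rw [L2norm, eLpNorm_eq_lintegral_rpow_enorm_toReal (by norm_num) (by norm_num),
    Real.sqrt_eq_rpow, ← ENNReal.ofReal_rpow_of_nonneg (normSqL2_nonneg μ P) (by norm_num), normSqL2,
    ofReal_integral_eq_lintegral_ofReal
      (integrable_of_continuous h (f := fun z => ‖P.eval z‖ ^ 2) (by fun_prop))
      (Eventually.of_forall fun z => by positivity)]
  simp only [ENNReal.toReal_ofNat]
  congr 2
  ext z
  rw [ENNReal.ofReal_pow (norm_nonneg _), ofReal_norm]
  norm_cast

lemma L2norm_toReal (h : BddBy R μ) (P : ℂ[X]) :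
    (L2norm μ P).toReal = Real.sqrt (normSqL2 μ P) := by
  rw [L2norm_eq h, ENNReal.toReal_ofReal (Real.sqrt_nonneg _)]

lemma monicOP_eq (μ : Measure ℂ) (n : ℕ) : monicOP μ n = X ^ n - ∑ k ∈ Finset.range n,
    C (innerL2 μ (monicOP μ k) (X ^ n) / innerL2 μ (monicOP μ k) (monicOP μ k)) * monicOP μ k := by
  rw [monicOP, Finset.sum_range]
  simp [innerL2]

lemma monicOP_monic_natDegree (μ : Measure ℂ) (n : ℕ) :
    (monicOP μ n).Monic ∧ (monicOP μ n).natDegree = n := by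
  induction n using Nat.strong_induction_on with
  | _ n ih =>
    have hlt : (∑ k ∈ Finset.range n, C (innerL2 μ (monicOP μ k) (X ^ n) /
        innerL2 μ (monicOP μ k) (monicOP μ k)) * monicOP μ k).degree < (n : WithBot ℕ) := by
      refine lt_of_le_of_lt (degree_sum_le _ _) ((Finset.sup_lt_iff (by simp)).2 fun k hk => ?_)
      have hk := Finset.mem_range.1 hk
      refine (degree_mul_le _ _).trans_lt ((add_le_add degree_C_le le_rfl).trans_lt ?_)
      rw [degree_eq_natDegree (ih k hk).1.ne_zero, (ih k hk).2, zero_add]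
      exact_mod_cast hk
    rw [monicOP_eq]
    refine ⟨monic_X_pow_sub hlt, natDegree_eq_of_degree_eq_some ?_⟩
    rw [degree_sub_eq_left_of_degree_lt (by simpa using hlt), degree_X_pow]

lemma monicOP_monic (μ : Measure ℂ) (n : ℕ) : (monicOP μ n).Monic := (monicOP_monic_natDegree μ n).1

lemma natDegree_monicOP (μ : Measure ℂ) (n : ℕ) : (monicOP μ n).natDegree = n :=
  (monicOP_monic_natDegree μ n).2

lemma normSqL2_monicOP_pos (h : BddBy R μ) (hinf : μ.support.Infinite) (n : ℕ) :
    0 < normSqL2 μ (monicOP μ n) :=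
  lt_of_le_of_ne (normSqL2_nonneg _ _) fun h0 =>
    (monicOP_monic μ n).ne_zero (eq_zero_of_normSqL2 h hinf h0.symm)

lemma innerL2_monicOP_of_lt (h : BddBy R μ) (hinf : μ.support.Infinite) {n : ℕ} :
    ∀ {j : ℕ}, j < n → innerL2 μ (monicOP μ j) (monicOP μ n) = 0 := by
  induction n using Nat.strong_induction_on with
  | _ n ih =>
    intro j hj
    have hne : innerL2 μ (monicOP μ j) (monicOP μ j) ≠ 0 := by
      rw [innerL2_self]
      exact_mod_cast (normSqL2_monicOP_pos h hinf j).ne'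
    conv_lhs => rw [monicOP_eq μ n]
    rw [sub_eq_add_neg, innerL2_add_right h, ← neg_one_mul, ← C_1, ← C_neg, innerL2_C_mul_right,
      innerL2_sum_right h, Finset.sum_eq_single j]
    · rw [innerL2_C_mul_right, div_mul_cancel₀ _ hne]
      ring
    · intro k hk hkj
      rw [innerL2_C_mul_right]
      rcases lt_or_gt_of_ne hkj with hlt | hlt
      · rw [innerL2_comm μ (monicOP μ j), ih j hj hlt, map_zero, mul_zero]
      · rw [ih k (Finset.mem_range.1 hk) hlt, mul_zero]
    · intro hj'
      exact absurd (Finset.mem_range.2 hj) hj'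

lemma innerL2_monicOP_of_ne (h : BddBy R μ) (hinf : μ.support.Infinite) {j n : ℕ} (hjn : j ≠ n) :
    innerL2 μ (monicOP μ j) (monicOP μ n) = 0 := by
  rcases lt_or_gt_of_ne hjn with hlt | hlt
  · exact innerL2_monicOP_of_lt h hinf hlt
  · rw [innerL2_comm, innerL2_monicOP_of_lt h hinf hlt, map_zero]

lemma exists_eq_sum_monicOP (μ : Measure ℂ) (n : ℕ) : ∀ Q : ℂ[X], Q.degree < (n : WithBot ℕ) →
    ∃ c : ℕ → ℂ, Q = ∑ k ∈ Finset.range n, C (c k) * monicOP μ k := by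
  induction n with
  | zero =>
    intro Q hQ
    exact ⟨0, by simpa using hQ⟩
  | succ n ih =>
    intro Q hQ
    obtain ⟨c, hc⟩ := ih (Q - C (Q.coeff n) * monicOP μ n) (by
      rw [degree_lt_iff_coeff_zero] at hQ ⊢
      intro m hm
      rcases eq_or_lt_of_le hm with rfl | hlt
      · have := (monicOP_monic μ n).coeff_natDegree
        rw [natDegree_monicOP] at this
        simp [this]
      · rw [coeff_sub, hQ m hlt, coeff_C_mul,
          coeff_eq_zero_of_natDegree_lt (p := monicOP μ n) (by rwa [natDegree_monicOP])]
        simp)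
    refine ⟨Function.update c n (Q.coeff n), ?_⟩
    rw [Finset.sum_range_succ, Function.update_self]
    rw [sub_eq_iff_eq_add] at hc
    conv_lhs => rw [hc]
    congr 1
    refine Finset.sum_congr rfl fun k hk => ?_
    rw [Function.update_of_ne (Finset.mem_range.1 hk).ne]

lemma normSqL2_sum_monicOP (h : BddBy R μ) (hinf : μ.support.Infinite) (n : ℕ) (c : ℕ → ℂ) :
    normSqL2 μ (∑ k ∈ Finset.range n, C (c k) * monicOP μ k) =
      ∑ k ∈ Finset.range n, ‖c k‖ ^ 2 * normSqL2 μ (monicOP μ k) := by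
  have : ((normSqL2 μ (∑ k ∈ Finset.range n, C (c k) * monicOP μ k) : ℝ) : ℂ) =
      ((∑ k ∈ Finset.range n, ‖c k‖ ^ 2 * normSqL2 μ (monicOP μ k) : ℝ) : ℂ) := by
    rw [← innerL2_self, innerL2_sum_right h, Complex.ofReal_sum]
    refine Finset.sum_congr rfl fun k hk => ?_
    rw [innerL2_C_mul_right, innerL2_comm, innerL2_sum_right h, Finset.sum_eq_single k]
    · rw [innerL2_C_mul_right, innerL2_self]
      simp only [map_mul, Complex.conj_ofReal, Complex.ofReal_mul, Complex.ofReal_pow]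
      rw [← mul_assoc, Complex.mul_conj']
    · intro j _ hj
      rw [innerL2_C_mul_right, innerL2_monicOP_of_ne h hinf hj.symm, mul_zero]
    · intro hk'
      exact absurd hk hk'
  exact_mod_cast this

lemma normSqL2_coeff_le (h : BddBy R μ) (hinf : μ.support.Infinite) (n : ℕ) (c : ℕ → ℂ) {k : ℕ}
    (hk : k < n) : ‖c k‖ ^ 2 * normSqL2 μ (monicOP μ k) ≤
      normSqL2 μ (∑ k ∈ Finset.range n, C (c k) * monicOP μ k) := by
  rw [normSqL2_sum_monicOP h hinf]
  exact Finset.single_le_sum (f := fun k => ‖c k‖ ^ 2 * normSqL2 μ (monicOP μ k))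
    (fun i _ => mul_nonneg (by positivity) (normSqL2_nonneg _ _)) (Finset.mem_range.2 hk)

/-- The monic orthogonal polynomials have minimal norm. -/
lemma normSqL2_monicOP_le (h : BddBy R μ) (hinf : μ.support.Infinite) {Y : ℂ[X]} (hY : Y.Monic) :
    normSqL2 μ (monicOP μ Y.natDegree) ≤ normSqL2 μ Y := by
  obtain ⟨c, hc⟩ := exists_eq_sum_monicOP μ (Y.natDegree + 1) Y
    (degree_lt_iff_coeff_zero _ _ |>.2 fun m hm => coeff_eq_zero_of_natDegree_lt hm)
  have h1 : c Y.natDegree = 1 := by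
    have := congrArg (fun P => P.coeff Y.natDegree) hc
    simp only [hY.coeff_natDegree, finsetSum_coeff, coeff_C_mul] at this
    rw [Finset.sum_range_succ, Finset.sum_eq_zero fun k hk => ?_] at this
    · have h2 := (monicOP_monic μ Y.natDegree).coeff_natDegree
      rw [natDegree_monicOP] at h2
      rw [h2] at this
      simpa using this.symm
    · rw [coeff_eq_zero_of_natDegree_lt (p := monicOP μ k)
        (by rw [natDegree_monicOP]; exact Finset.mem_range.1 hk), mul_zero]
  have := normSqL2_coeff_le h hinf (Y.natDegree + 1) c (Nat.lt_succ_self _)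
  rw [h1, ← hc] at this
  simpa using this

/-- The zeros of the orthogonal polynomials lie in the convex hull of the support. -/
lemma mem_closedConvexHull_of_isRoot (h : BddBy R μ) (hinf : μ.support.Infinite) {n : ℕ} {w : ℂ}
    (hw : (monicOP μ n).IsRoot w) : w ∈ closedConvexHull ℝ μ.support := by
  by_contra hout
  obtain ⟨Q, hQ⟩ := dvd_iff_isRoot.2 hw
  have hQm : Q.Monic := (monic_X_sub_C w).of_mul_monic_left (hQ ▸ monicOP_monic μ n)
  -- Fejér's argument: moving a zero outside the hull to its nearest point `v` brings it strictly
  -- closer to every point of the support and lowers the norm, contrary to minimality.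
  obtain ⟨v, hv, hmin⟩ := exists_norm_eq_iInf_of_complete_convex (K := closedConvexHull ℝ μ.support)
    (hinf.nonempty.mono subset_closedConvexHull) isClosed_closedConvexHull.isComplete
    (convex_closedConvexHull) w
  have hproj := (norm_eq_iInf_iff_real_inner_le_zero convex_closedConvexHull hv).1 hmin
  have hvw : 0 < ‖w - v‖ := norm_pos_iff.2 (sub_ne_zero.2 fun he => hout (he ▸ hv))
  have hcloser : ∀ z ∈ μ.support, ‖z - v‖ ^ 2 + ‖w - v‖ ^ 2 ≤ ‖z - w‖ ^ 2 := by
    intro z hz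
    have h1 := hproj z (subset_closedConvexHull hz)
    have h2 : z - w = (z - v) - (w - v) := by ring
    rw [h2, norm_sub_sq_real (z - v), real_inner_comm]
    linarith
  have hnd : ((X - C v) * Q).natDegree = n := by
    rw [← natDegree_monicOP μ n, hQ, (monic_X_sub_C v).natDegree_mul hQm,
      (monic_X_sub_C w).natDegree_mul hQm, natDegree_X_sub_C, natDegree_X_sub_C]
  have hle := normSqL2_monicOP_le h hinf ((monic_X_sub_C v).mul hQm)
  rw [hnd, hQ] at hle
  have hsup : ∀ᵐ z ∂μ, z ∈ μ.support := μ.support_mem_ae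
  have hsum : normSqL2 μ ((X - C v) * Q) + ‖w - v‖ ^ 2 * normSqL2 μ Q ≤
      normSqL2 μ ((X - C w) * Q) := by
    have hi : ∀ P : ℂ[X], Integrable (fun z => ‖P.eval z‖ ^ 2) μ := fun P =>
      integrable_of_continuous h (by fun_prop)
    simp only [normSqL2]
    rw [← integral_const_mul, ← integral_add (hi _) ((hi Q).const_mul _)]
    refine integral_mono_ae (integrable_of_continuous h (by fun_prop))
      (integrable_of_continuous h (by fun_prop)) ?_
    filter_upwards [hsup] with z hz
    simp only [eval_mul, eval_sub, eval_X, eval_C, norm_mul, mul_pow, ← add_mul]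
    exact mul_le_mul_of_nonneg_right (hcloser z hz) (by positivity)
  have hQ0 : 0 < normSqL2 μ Q := lt_of_le_of_ne (normSqL2_nonneg _ _) fun h0 =>
    hQm.ne_zero (eq_zero_of_normSqL2 h hinf h0.symm)
  have := mul_pos (pow_pos hvw 2) hQ0
  linarith

end
end

/-! ### Averages of point masses and zeros of polynomials -/

section
open Polynomial

/-- The normalized counting measure of a multiset of points. -/
def avg (s : Multiset ℂ) : Measure ℂ :=
  (Multiset.card s : ℝ≥0∞)⁻¹ • (s.map Measure.dirac).sum

lemma ae_avg {s : Multiset ℂ} {p : ℂ → Prop} (h : ∀ w ∈ s, p w) : ∀ᵐ w ∂avg s, p w := by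
  refine Measure.ae_smul_measure ?_ _
  induction s using Multiset.induction_on with
  | empty => simp
  | cons a s ih =>
    rw [Multiset.map_cons, Multiset.sum_cons, ae_add_measure_iff]
    refine ⟨?_, ih fun w hw => h w (Multiset.mem_cons_of_mem hw)⟩
    rw [ae_dirac_eq]
    exact h a (Multiset.mem_cons_self a s)

lemma bddBy_avg {s : Multiset ℂ} {R : ℝ} (h : ∀ w ∈ s, ‖w‖ ≤ R) : BddBy R (avg s) := ae_avg h

lemma avg_compl {s : Multiset ℂ} {K : Set ℂ} (h : ∀ w ∈ s, w ∈ K) : avg s Kᶜ = 0 :=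
  ae_avg h

open Classical in
lemma sum_dirac_apply (s : Multiset ℂ) (A : Set ℂ) :
    (s.map Measure.dirac).sum A = Multiset.card (s.filter (· ∈ A)) := by
  induction s using Multiset.induction_on with
  | empty => simp
  | cons a s ih =>
    rw [Multiset.map_cons, Multiset.sum_cons, Measure.add_apply, ih, Measure.dirac_apply,
      Multiset.filter_cons]
    by_cases ha : a ∈ A <;> simp [ha, add_comm]

open Classical in
lemma avg_apply (s : Multiset ℂ) (A : Set ℂ) :
    avg s A = (Multiset.card (s.filter (· ∈ A)) : ℝ≥0∞) / Multiset.card s := by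
  rw [avg, Measure.smul_apply, sum_dirac_apply, smul_eq_mul, mul_comm, div_eq_mul_inv]

lemma isProbabilityMeasure_avg {s : Multiset ℂ} (hs : s ≠ 0) : IsProbabilityMeasure (avg s) := by
  classical
  refine ⟨?_⟩
  rw [avg_apply]
  simp only [Set.mem_univ, Multiset.filter_true]
  exact ENNReal.div_self (by simpa using hs) (by simp)

lemma integral_avg (s : Multiset ℂ) (f : ℂ → ℝ) :
    ∫ w, f w ∂avg s = (s.map f).sum / Multiset.card s := by
  have : Integrable f (s.map Measure.dirac).sum ∧
      ∫ w, f w ∂(s.map Measure.dirac).sum = (s.map f).sum := by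
    induction s using Multiset.induction_on with
    | empty => simp
    | cons a s ih =>
      have ha : Integrable f (Measure.dirac a) := integrable_dirac (by simp)
      rw [Multiset.map_cons, Multiset.sum_cons, Multiset.map_cons, Multiset.sum_cons,
        integral_add_measure ha ih.1, ih.2, integral_dirac]
      exact ⟨ha.add_measure ih.1, rfl⟩
  rw [avg, integral_smul_measure, this.2]
  simp [div_eq_inv_mul]

lemma tpot_avg (n : ℕ) (s : Multiset ℂ) (z : ℂ) :
    tpot n (avg s) z = (s.map (ker n z)).sum / Multiset.card s :=
  integral_avg s _

lemma log_norm_prod {s : Multiset ℂ} {z : ℂ} (hz : z ∉ s) :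
    Real.log ‖(s.map (z - ·)).prod‖ = (s.map fun w => Real.log ‖z - w‖).sum := by
  induction s using Multiset.induction_on with
  | empty => simp
  | cons a s ih =>
    rw [Multiset.mem_cons, not_or] at hz
    rw [Multiset.map_cons, Multiset.prod_cons, norm_mul, Real.log_mul, ih hz.2, Multiset.map_cons,
      Multiset.sum_cons]
    · exact norm_ne_zero_iff.2 (sub_ne_zero.2 hz.1)
    · rw [norm_ne_zero_iff, ne_eq, Multiset.prod_eq_zero_iff, Multiset.mem_map]
      rintro ⟨w, hw, hw'⟩
      exact hz.2 (sub_eq_zero.1 hw' ▸ hw)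

lemma tpot_avg_le {s : Multiset ℂ} {z : ℂ} (hz : z ∉ s) (n : ℕ) :
    tpot n (avg s) z ≤ -Real.log ‖(s.map (z - ·)).prod‖ / Multiset.card s := by
  rw [tpot_avg, log_norm_prod hz]
  refine div_le_div_of_nonneg_right ?_ (Nat.cast_nonneg _)
  rw [← Multiset.sum_map_neg', Multiset.map_map]
  exact Multiset.sum_map_le_sum_map _ _ fun w hw => ker_le_neg_log n (by rintro rfl; exact hz hw)

lemma potential_avg_of_notMem {s : Multiset ℂ} {z : ℂ} (hz : z ∉ s) :
    potential (avg s) z =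
      ((-Real.log ‖(s.map (z - ·)).prod‖ / Multiset.card s : ℝ) : EReal) := by
  rcases eq_or_ne s 0 with rfl | hs
  · simp [potential, avg]
  have := isProbabilityMeasure_avg hs
  obtain ⟨R, hR⟩ : ∃ R, ∀ w ∈ s, ‖w‖ ≤ R := by
    obtain ⟨R, hR⟩ := (s.toFinset.image fun w => ‖w‖).bddAbove
    exact ⟨R, fun w hw => hR (by simpa using ⟨w, hw, rfl⟩)⟩
  have hB := bddBy_avg hR
  refine le_antisymm ((potential_le_iff hB).2 fun n =>
    EReal.coe_le_coe_iff.2 (tpot_avg_le hz n)) ?_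
  have h1 : ∀ᶠ n : ℕ in atTop, ∀ w ∈ s.toFinset, Real.exp (-n) ≤ ‖z - w‖ := by
    rw [Finset.eventually_all]
    intro w hw
    have h2 : Tendsto (fun n : ℕ => Real.exp (-n)) atTop (𝓝 0) :=
      Real.tendsto_exp_neg_atTop_nhds_zero.comp tendsto_natCast_atTop_atTop
    refine (h2.eventually (gt_mem_nhds (norm_pos_iff.2 (sub_ne_zero.2 ?_)))).mono
      fun n hn => hn.le
    rintro rfl
    exact hz (Multiset.mem_toFinset.1 hw)
  obtain ⟨n, hn⟩ := h1.exists
  refine le_trans (EReal.coe_le_coe_iff.2 ?_) (tpot_le_potential hB n z)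
  rw [tpot_avg, log_norm_prod hz, ← Multiset.sum_map_neg', Multiset.map_map]
  refine le_of_eq ?_
  congr 2
  exact Multiset.map_congr rfl fun w hw => (ker_of_le (hn w (Multiset.mem_toFinset.2 hw))).symm

lemma potential_avg_of_mem {s : Multiset ℂ} {z : ℂ} (hz : z ∈ s) : potential (avg s) z = ⊤ := by
  have hs : s ≠ 0 := by rintro rfl; simp at hz
  have := isProbabilityMeasure_avg hs
  obtain ⟨R, hR⟩ : ∃ R, ∀ w ∈ s, ‖w‖ ≤ R := by
    obtain ⟨R, hR⟩ := (s.toFinset.image fun w => ‖w‖).bddAbove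
    exact ⟨R, fun w hw => hR (by simpa using ⟨w, hw, rfl⟩)⟩
  have hB := bddBy_avg hR
  obtain ⟨t, rfl⟩ := Multiset.exists_cons_of_mem hz
  refine EReal.eq_top_iff_forall_lt _ |>.2 fun y => ?_
  rw [lt_potential_iff hB]
  have hc : (0 : ℝ) < Multiset.card (z ::ₘ t) := by simp; positivity
  obtain ⟨n, hn⟩ := exists_nat_gt (y * Multiset.card (z ::ₘ t) - (t.map (ker 0 z)).sum)
  refine ⟨n, EReal.coe_lt_coe_iff.2 ?_⟩
  rw [tpot_avg, lt_div_iff₀ hc, Multiset.map_cons, Multiset.sum_cons, ker_self]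
  have : (t.map (ker 0 z)).sum ≤ (t.map (ker n z)).sum :=
    Multiset.sum_map_le_sum_map _ _ fun w _ => ker_mono n.zero_le z w
  linarith

lemma eval_eq_prod_roots {P : ℂ[X]} (hP : P.Monic) (z : ℂ) :
    P.eval z = (P.roots.map (z - ·)).prod := by
  conv_lhs => rw [(IsAlgClosed.splits P).eq_prod_roots_of_monic hP]
  rw [eval_multiset_prod, Multiset.map_map]
  simp

lemma card_roots_eq (P : ℂ[X]) : Multiset.card P.roots = P.natDegree :=
  (IsAlgClosed.splits P).natDegree_eq_card_roots.symm

lemma potential_avg_roots {P : ℂ[X]} (hP : P.Monic) {z : ℂ} (hz : P.eval z ≠ 0) :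
    potential (avg P.roots) z = ((-Real.log ‖P.eval z‖ / P.natDegree : ℝ) : EReal) := by
  rw [potential_avg_of_notMem fun h => hz (isRoot_of_mem_roots h), ← eval_eq_prod_roots hP,
    card_roots_eq]

lemma potential_avg_roots_eq_top {P : ℂ[X]} (hP : P ≠ 0) {z : ℂ} (hz : P.eval z = 0) :
    potential (avg P.roots) z = ⊤ :=
  potential_avg_of_mem ((mem_roots hP).2 hz)

end

/-! ### Polynomials that are small on a compact set, and the upper bound for the norms -/

section
open Polynomial

/-- A greedy choice in the spirit of Leja points: each new point is one where the polynomial with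
zeros at the earlier points is not small. -/
lemma exists_seq_multiset {E : Set ℂ} {v : ℝ}
    (h : ∀ P : ℂ[X], P.Monic → 1 ≤ P.natDegree → ∃ z ∈ E, Real.exp (-(v * P.natDegree)) ≤ ‖P.eval z‖) :
    ∃ (s : ℕ → Multiset ℂ) (a : ℕ → ℂ), s 0 = 0 ∧ ∀ n, s (n + 1) = a n ::ₘ s n ∧ a n ∈ E ∧
      Real.exp (-(v * Multiset.card (s n))) ≤ ‖((s n).map (a n - ·)).prod‖ := by
  have key : ∀ s : Multiset ℂ, ∃ z ∈ E, Real.exp (-(v * Multiset.card s)) ≤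
      ‖(s.map (z - ·)).prod‖ := by
    intro s
    rcases eq_or_ne s 0 with rfl | hs
    · obtain ⟨z, hz, _⟩ := h X monic_X (by simp)
      exact ⟨z, hz, by simp⟩
    · have hd : ((s.map fun w => X - C w).prod).natDegree = Multiset.card s :=
        natDegree_multiset_prod_X_sub_C_eq_card s
      obtain ⟨z, hz, hz'⟩ := h (s.map fun w => X - C w).prod
        (monic_multiset_prod_of_monic _ _ fun w _ => monic_X_sub_C w)
        (by rw [hd]; exact Multiset.card_pos.2 hs)
      refine ⟨z, hz, ?_⟩
      rw [hd, eval_multiset_prod, Multiset.map_map] at hz'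
      simpa using hz'
  choose f hf1 hf2 using key
  let s : ℕ → Multiset ℂ := fun n => Nat.rec 0 (fun _ t => f t ::ₘ t) n
  exact ⟨s, fun n => f (s n), rfl, fun n => ⟨rfl, hf1 _, hf2 _⟩⟩

lemma sum_ker_cons (k : ℕ) (a : ℂ) (s : Multiset ℂ) :
    ((a ::ₘ s).map fun x => ((a ::ₘ s).map (ker k x)).sum).sum =
      k + 2 * (s.map (ker k a)).sum + (s.map fun x => (s.map (ker k x)).sum).sum := by
  simp only [Multiset.map_cons, Multiset.sum_cons, Multiset.sum_map_add, ker_self]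
  have : (s.map fun x => ker k x a) = s.map (ker k a) :=
    Multiset.map_congr rfl fun x _ => ker_comm k x a
  rw [this]
  ring

/-- Otherwise the greedy points would have average pair energy at most `v`, and a weak limit of
their counting measures would be a probability measure on `E` of energy at most `v`. -/
lemma exists_monic_lt {E : Set ℂ} (hE : IsCompact E) {v : ℝ} (hv : (v : EReal) < minEnergy E) :
    ∃ P : ℂ[X], P.Monic ∧ 1 ≤ P.natDegree ∧
      ∀ z ∈ E, ‖P.eval z‖ < Real.exp (-(v * P.natDegree)) := by
  by_contra! hcon
  obtain ⟨s, a, h0, hs⟩ := exists_seq_multiset hcon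
  have hcard : ∀ n, Multiset.card (s n) = n := by
    intro n
    induction n with
    | zero => simp [h0]
    | succ n ih => rw [(hs n).1, Multiset.card_cons, ih]
  have hmem : ∀ n, ∀ w ∈ s n, w ∈ E := by
    intro n
    induction n with
    | zero => simp [h0]
    | succ n ih =>
      intro w hw
      rw [(hs n).1, Multiset.mem_cons] at hw
      rcases hw with rfl | hw
      exacts [(hs n).2.1, ih w hw]
  -- The diagonal contributes `n k`, which is negligible against `n²` at a fixed truncation level
  -- `k`; the other pairs contribute at most `v n (n - 1)`.
  have hsum : ∀ k n : ℕ, ((s n).map fun x => ((s n).map (ker k x)).sum).sum ≤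
      n * k + v * (n * (n - 1)) := by
    intro k n
    induction n with
    | zero => simp [h0]
    | succ n ih =>
      rw [(hs n).1, sum_ker_cons]
      have h1 := (hs n).2.2
      rw [hcard] at h1
      have hnm : a n ∉ s n := by
        intro hmem
        have : ((s n).map (a n - ·)).prod = 0 :=
          Multiset.prod_eq_zero (Multiset.mem_map.2 ⟨a n, hmem, sub_self _⟩)
        rw [this, norm_zero] at h1
        exact absurd h1 (not_le.2 (Real.exp_pos _))
      have h2 : ((s n).map (ker k (a n))).sum ≤ v * n := by
        calc ((s n).map (ker k (a n))).sum
            ≤ ((s n).map fun w => -Real.log ‖a n - w‖).sum :=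
              Multiset.sum_map_le_sum_map _ _ fun w hw =>
                ker_le_neg_log k (by rintro rfl; exact hnm hw)
          _ = -Real.log ‖((s n).map (a n - ·)).prod‖ := by
              rw [log_norm_prod hnm, ← Multiset.sum_map_neg', Multiset.map_map]
              rfl
          _ ≤ v * n := by
              have := (Real.le_log_iff_exp_le (lt_of_lt_of_le (Real.exp_pos _) h1)).2 h1
              linarith
      push_cast
      nlinarith
  have hne : ∀ n, s (n + 1) ≠ 0 := fun n h => by
    have := hcard (n + 1)
    rw [h] at this
    simp at this
  obtain ⟨ν, hν, φ, hφ, hlim⟩ := exists_subseq_tendsto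
    (fun n => ⟨avg (s (n + 1)), isProbabilityMeasure_avg (hne n)⟩) hE
    fun n => avg_compl (hmem _)
  obtain ⟨R, _, hR⟩ := exists_norm_le_of_isCompact hE
  have hB : BddBy R ν := bddBy_of_measure_compl hR hν
  have hen : energy (ν : Measure ℂ) ≤ v := by
    rw [energy_le_iff hB]
    intro k
    rw [EReal.coe_le_coe_iff]
    have h1 := tendsto_integral_tpot hlim
      (fun n => bddBy_avg fun w hw => hR w (hmem _ w hw)) hB k
    have h2 : Tendsto (fun n : ℕ => ((k : ℝ) - v) * (1 / ((φ n : ℝ) + 1)) + v) atTop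
        (𝓝 (((k : ℝ) - v) * 0 + v)) :=
      ((tendsto_one_div_add_atTop_nhds_zero_nat.comp hφ.tendsto_atTop).const_mul _).add_const _
    rw [mul_zero, zero_add] at h2
    refine le_of_tendsto_of_tendsto' h1 h2 fun n => ?_
    have h3 := hsum k (φ n + 1)
    change ∫ x, tpot k (avg (s (φ n + 1))) x ∂(avg (s (φ n + 1))) ≤ _
    rw [integral_avg]
    simp only [tpot_avg, hcard, Multiset.sum_map_div]
    have hpos : (0 : ℝ) < (φ n : ℝ) + 1 := by positivity
    push_cast at h3 ⊢
    rw [div_div, div_le_iff₀ (by positivity)]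
    refine h3.trans (le_of_eq ?_)
    field_simp
    ring
  exact absurd ((minEnergy_le_of_measure_compl hE hν).trans hen) (not_le.2 hv)

/-- An infinite remainder would accumulate at a nonisolated point of the support outside `U`. The
finitely many leftover points can then be made zeros of a fixed polynomial factor. -/
lemma finite_support_sdiff {μ : Measure ℂ} (hcompact : IsCompact μ.support) {U : Set ℂ}
    (hU : IsOpen U) (hsub : essSpectrum μ ⊆ U) : (μ.support \ U).Finite := by
  by_contra hinf
  obtain ⟨x, hx, hacc⟩ := Set.Infinite.exists_accPt_of_subset_isCompact hinf (hcompact.diff hU)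
    subset_rfl
  exact hx.2 (hsub ⟨hx.1, hacc.mono (Filter.principal_mono.2 Set.sdiff_subset)⟩)

lemma normSqL2_le_of_bound {R : ℝ} {μ : Measure ℂ} [IsFiniteMeasure μ] (h : BddBy R μ) {P : ℂ[X]}
    {D : ℝ} (hP : ∀ z ∈ μ.support, ‖P.eval z‖ ≤ D) : normSqL2 μ P ≤ D ^ 2 * μ.real Set.univ := by
  have : ∫ z, ‖P.eval z‖ ^ 2 ∂μ ≤ ∫ _, D ^ 2 ∂μ := by
    refine integral_mono_ae (integrable_of_continuous h (by fun_prop)) (integrable_const _) ?_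
    filter_upwards [μ.support_mem_ae] with z hz
    exact pow_le_pow_left₀ (norm_nonneg _) (hP z hz) 2
  rwa [integral_const, smul_eq_mul, mul_comm] at this

/-- The norm of the monic orthogonal polynomial. -/
def opNorm (μ : Measure ℂ) (n : ℕ) : ℝ := Real.sqrt (normSqL2 μ (monicOP μ n))

/-- The exponential rate of decay `-(1/n) log ‖X_n‖` of the norms. -/
def rate (μ : Measure ℂ) (n : ℕ) : ℝ := -Real.log (opNorm μ n) / n

section
variable {μ : Measure ℂ} [IsFiniteMeasure μ]

lemma opNorm_pos {R : ℝ} (h : BddBy R μ) (hinf : μ.support.Infinite) (n : ℕ) : 0 < opNorm μ n :=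
  Real.sqrt_pos.2 (normSqL2_monicOP_pos h hinf n)

lemma opNorm_le_of_bound {R : ℝ} (h : BddBy R μ) (hinf : μ.support.Infinite) {P : ℂ[X]}
    (hPm : P.Monic) {D : ℝ} (hD : 0 ≤ D) (hP : ∀ z ∈ μ.support, ‖P.eval z‖ ≤ D) :
    opNorm μ P.natDegree ≤ D * Real.sqrt (μ.real Set.univ) := by
  refine (Real.sqrt_le_sqrt ((normSqL2_monicOP_le h hinf hPm).trans
    (normSqL2_le_of_bound h hP))).trans_eq ?_
  rw [Real.sqrt_mul (by positivity), Real.sqrt_sq hD]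

lemma exists_opNorm_le (hcompact : IsCompact μ.support) (hinf : μ.support.Infinite)
    (hE : IsCompact (essSpectrum μ)) {v : ℝ} (hv : (v : EReal) < minEnergy (essSpectrum μ)) :
    ∃ B : ℝ, ∀ᶠ n : ℕ in atTop, opNorm μ n ≤ B * Real.exp (-(v * n)) := by
  obtain ⟨P, hPm, hP1, hP⟩ := exists_monic_lt hE hv
  obtain ⟨R, hR1, hR⟩ := exists_norm_le_of_isCompact hcompact
  have hB : BddBy R μ := bddBy_of_measure_compl hR Measure.measure_compl_support
  set m := P.natDegree with hm
  have hfin := finite_support_sdiff hcompact (U := {z | ‖P.eval z‖ < Real.exp (-(v * m))})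
    (isOpen_lt (by fun_prop) continuous_const) hP
  set T : ℂ[X] := ∏ t ∈ hfin.toFinset, (X - C t) with hT
  have hTm : T.Monic := monic_prod_of_monic _ _ fun t _ => monic_X_sub_C t
  obtain ⟨A, hA⟩ := hcompact.exists_bound_of_continuousOn
    (f := fun z => T.eval z) (by fun_prop)
  set D := |A| * R ^ m * Real.exp (|v| * (T.natDegree + m)) with hD
  refine ⟨D * Real.sqrt (μ.real Set.univ), eventually_atTop.2 ⟨T.natDegree, fun n hn => ?_⟩⟩
  -- The comparison polynomial `P ^ k * T * X ^ r` has degree exactly `n`: `P ^ k` gives the decay,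
  -- `T` cancels the points where `P` is not small, and `X ^ r` fills up the degree.
  set k := (n - T.natDegree) / m
  set r := (n - T.natDegree) % m
  have hr : r < m := Nat.mod_lt _ hP1
  have hkr : m * k + r + T.natDegree = n := by
    rw [Nat.div_add_mod, Nat.sub_add_cancel hn]
  have hYm : (P ^ k * T * X ^ r).Monic := ((hPm.pow k).mul hTm).mul (monic_X.pow r)
  have hYd : (P ^ k * T * X ^ r).natDegree = n := by
    rw [((hPm.pow k).mul hTm).natDegree_mul (monic_X.pow r), (hPm.pow k).natDegree_mul hTm,
      hPm.natDegree_pow, natDegree_X_pow, ← hm, ← hkr]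
    ring
  have hexp : Real.exp (-(v * m)) ^ k ≤
      Real.exp (|v| * (T.natDegree + m)) * Real.exp (-(v * n)) := by
    rw [← Real.exp_nat_mul, ← Real.exp_add]
    refine Real.exp_le_exp.2 ?_
    rw [← hkr]
    push_cast
    have h1 : v * (r + T.natDegree) ≤ |v| * (r + T.natDegree) :=
      mul_le_mul_of_nonneg_right (le_abs_self v) (by positivity)
    have h2 : |v| * (r + T.natDegree) ≤ |v| * (T.natDegree + m) := by
      refine mul_le_mul_of_nonneg_left ?_ (abs_nonneg v)
      have : (r : ℝ) ≤ m := by exact_mod_cast hr.le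
      linarith
    linarith
  have hbound : ∀ z ∈ μ.support, ‖(P ^ k * T * X ^ r).eval z‖ ≤ D * Real.exp (-(v * n)) := by
    intro z hz
    by_cases hzU : ‖P.eval z‖ < Real.exp (-(v * m))
    · simp only [eval_mul, eval_pow, eval_X, norm_mul, norm_pow]
      calc ‖P.eval z‖ ^ k * ‖T.eval z‖ * ‖z‖ ^ r
          ≤ (Real.exp (|v| * (T.natDegree + m)) * Real.exp (-(v * n))) * |A| * R ^ m := by
            gcongr
            · exact (pow_le_pow_left₀ (norm_nonneg _) hzU.le k).trans hexp
            · exact (hA z hz).trans (le_abs_self A)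
            · exact (pow_le_pow_left₀ (norm_nonneg _) (hR z hz) r).trans
                (pow_le_pow_right₀ hR1 hr.le)
        _ = D * Real.exp (-(v * n)) := by rw [hD]; ring
    · have : T.eval z = 0 := by
        rw [hT, eval_prod]
        exact Finset.prod_eq_zero (hfin.mem_toFinset.2 ⟨hz, hzU⟩) (by simp)
      simp only [eval_mul, this, mul_zero, zero_mul, norm_zero]
      positivity
  have := opNorm_le_of_bound hB hinf hYm (by positivity) hbound
  rw [hYd] at this
  linarith

/-- The norms of the monic orthogonal polynomials decay at least at the rate given by the
capacity of the essential spectrum. -/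
lemma eventually_le_rate (hcompact : IsCompact μ.support) (hinf : μ.support.Infinite)
    (hE : IsCompact (essSpectrum μ)) {v : ℝ} (hv : (v : EReal) < minEnergy (essSpectrum μ)) :
    ∀ᶠ n : ℕ in atTop, v ≤ rate μ n := by
  -- A slightly better rate `v' > v` absorbs the constant `B` for large `n`.
  obtain ⟨v', hv1, hv2⟩ := EReal.lt_iff_exists_real_btwn.1 hv
  rw [EReal.coe_lt_coe_iff] at hv1
  obtain ⟨B, hB⟩ := exists_opNorm_le hcompact hinf hE hv2
  obtain ⟨R, _, hR⟩ := exists_norm_le_of_isCompact hcompact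
  have hBdd : BddBy R μ := bddBy_of_measure_compl hR Measure.measure_compl_support
  have h1 : ∀ᶠ n : ℕ in atTop, Real.log B ≤ (v' - v) * n :=
    (tendsto_natCast_atTop_atTop.const_mul_atTop (sub_pos.2 hv1)).eventually_ge_atTop _
  filter_upwards [hB, h1, eventually_gt_atTop 0] with n hn hn1 hn0
  have hpos := opNorm_pos hBdd hinf n
  have hBpos : 0 < B := by
    by_contra! hB0
    exact absurd (hpos.trans_le hn) (not_lt.2 (mul_nonpos_of_nonpos_of_nonneg hB0
      (Real.exp_pos _).le))
  have h2 := Real.log_le_log hpos hn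
  rw [Real.log_mul hBpos.ne' (Real.exp_pos _).ne', Real.log_exp] at h2
  rw [rate, le_div_iff₀ (by exact_mod_cast hn0)]
  linarith

end
end

/-! ### Polynomials attached to the points of the unbounded component -/

section
open Polynomial

/-- Runge's pole pushing: `1 / (z - w₀)` is a geometric series in `1 / (z - w)`, uniformly
convergent on `E` because `‖w - w₀‖` is less than the distance from `w` to `E`. -/
lemma exists_polynomial_inv_of_near {E : Set ℂ} (hE : IsCompact E) {w₀ w : ℂ} (hw₀ : w₀ ∉ E)
    (hw : ‖w - w₀‖ < Metric.infDist w E) {p : ℂ[X]} (hp0 : p.eval 0 = 1)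
    (hp : ∀ z ∈ E, ‖p.eval (z - w₀)⁻¹‖ < 1) :
    ∃ q : ℂ[X], q.eval 0 = 1 ∧ ∀ z ∈ E, ‖q.eval (z - w)⁻¹‖ < 1 := by
  have hd : 0 < Metric.infDist w E := (norm_nonneg _).trans_lt hw
  set ρ := ‖w - w₀‖ / Metric.infDist w E with hρ
  have hρ1 : ρ < 1 := (div_lt_one hd).2 hw
  have hρ0 : 0 ≤ ρ := by positivity
  have htube : ∀ᶠ u : ℂ in 𝓝 0, ∀ z ∈ E, ‖p.eval ((z - w₀)⁻¹ * (1 - u))‖ < 1 := by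
    refine hE.eventually_forall_of_forall_eventually fun z hz => ?_
    have hne : z - w₀ ≠ 0 := sub_ne_zero.2 fun h => hw₀ (h ▸ hz)
    have hc : ContinuousAt (fun x : ℂ × ℂ => ‖p.eval ((x.2 - w₀)⁻¹ * (1 - x.1))‖) (0, z) := by
      refine (p.continuous.norm.continuousAt).comp (ContinuousAt.mul (ContinuousAt.inv₀ ?_ hne) ?_)
      all_goals fun_prop
    refine hc.eventually_lt continuousAt_const ?_
    simpa using hp z hz
  obtain ⟨ε, hε, hball⟩ := Metric.eventually_nhds_iff.1 htube
  obtain ⟨N, hN⟩ := exists_pow_lt_of_lt_one hε hρ1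
  -- The partial sum multiplies `1 / (z - w₀)` by `1 - t ^ N`, within the tolerance found above; its
  -- factor `X` preserves the value `1` at `0`.
  refine ⟨p.comp (X * ∑ j ∈ Finset.range N, (C (-(w - w₀)) * X) ^ j), by simp [hp0], fun z hz => ?_⟩
  have hzw : Metric.infDist w E ≤ ‖z - w‖ := by
    rw [← dist_eq_norm, dist_comm]
    exact Metric.infDist_le_dist_of_mem hz
  have hzw0 : 0 < ‖z - w‖ := hd.trans_le hzw
  have hne : z - w ≠ 0 := norm_pos_iff.1 hzw0
  have hne0 : z - w₀ ≠ 0 := sub_ne_zero.2 fun h => hw₀ (h ▸ hz)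
  set t : ℂ := -(w - w₀) * (z - w)⁻¹ with ht
  have htρ : ‖t‖ ≤ ρ := by
    rw [ht, norm_mul, norm_neg, norm_inv, hρ, div_eq_mul_inv]
    gcongr
  have h1t : 1 - t = (z - w₀) * (z - w)⁻¹ := by
    rw [ht]
    field_simp
    ring
  have ht1 : t ≠ 1 := fun h => by
    rw [h, norm_one] at htρ
    linarith
  have heq : (X * ∑ j ∈ Finset.range N, (C (-(w - w₀)) * X) ^ j).eval (z - w)⁻¹ =
      (z - w₀)⁻¹ * (1 - t ^ N) := by
    have hgeom : (∑ j ∈ Finset.range N, t ^ j) * (1 - t) = 1 - t ^ N := by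
      rw [geom_sum_eq ht1, ← neg_sub t 1, mul_neg, div_mul_cancel₀ _ (sub_ne_zero.2 ht1), neg_sub]
    rw [← hgeom, h1t]
    simp only [eval_mul, eval_X, eval_finsetSum, eval_pow, eval_C, ← ht]
    field_simp
  rw [eval_comp, heq]
  refine hball ?_ z hz
  rw [dist_zero_right, norm_pow]
  exact (pow_le_pow_left₀ (norm_nonneg _) htρ N).trans_lt hN

/-- The admissible poles form a set that is open and relatively closed in the component, and it
contains distant points. -/
lemma exists_polynomial_inv {E : Set ℂ} (hE : IsCompact E) {z₀ : ℂ}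
    (hz₀ : z₀ ∈ unboundedComponent E) :
    ∃ p : ℂ[X], p.eval 0 = 1 ∧ ∀ z ∈ E, ‖p.eval (z - z₀)⁻¹‖ < 1 := by
  rcases E.eq_empty_or_nonempty with rfl | hne
  · exact ⟨1, by simp, by simp⟩
  set A : Set ℂ := {w | w ∉ E ∧ ∃ p : ℂ[X], p.eval 0 = 1 ∧ ∀ z ∈ E, ‖p.eval (z - w)⁻¹‖ < 1}
  have hpos : ∀ w ∉ E, 0 < Metric.infDist w E := fun w hw =>
    (hE.isClosed.notMem_iff_infDist_pos hne).1 hw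
  have hopen : IsOpen A := by
    rw [Metric.isOpen_iff]
    rintro w₀ ⟨hw₀, p, hp0, hp⟩
    refine ⟨Metric.infDist w₀ E / 2, half_pos (hpos w₀ hw₀), fun w hw => ?_⟩
    rw [Metric.mem_ball] at hw
    have h1 : Metric.infDist w₀ E ≤ Metric.infDist w E + dist w₀ w :=
      Metric.infDist_le_infDist_add_dist
    rw [dist_comm] at h1
    have h2 : dist w w₀ < Metric.infDist w E := by linarith
    refine ⟨fun hwE => ?_, exists_polynomial_inv_of_near hE hw₀ (by rwa [← dist_eq_norm]) hp0 hp⟩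
    rw [Metric.infDist_zero_of_mem hwE] at h2
    exact absurd h2 (not_lt.2 dist_nonneg)
  have hclosed : closure A ∩ connectedComponentIn Eᶜ z₀ ⊆ A := by
    rintro w ⟨hwA, hwc⟩
    have hwE : w ∉ E := connectedComponentIn_subset _ _ hwc
    obtain ⟨w₀, ⟨hw₀, p, hp0, hp⟩, hd⟩ := Metric.mem_closure_iff.1 hwA _ (hpos w hwE)
    exact ⟨hwE, exists_polynomial_inv_of_near hE hw₀ (by rwa [← dist_eq_norm]) hp0 hp⟩
  have hmeet : (connectedComponentIn Eᶜ z₀ ∩ A).Nonempty := by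
    obtain ⟨R, hR1, hR⟩ := exists_norm_le_of_isCompact hE
    obtain ⟨w, hw, hwR⟩ : ∃ w ∈ connectedComponentIn Eᶜ z₀, 2 * R < ‖w‖ := by
      by_contra! hcon
      exact hz₀.2 (isBounded_iff_forall_norm_le.2 ⟨_, hcon⟩)
    -- At a distant pole this polynomial in `1 / (z - w)` is `z / (z - w)`, of modulus below `1` on
    -- `E` because `‖w‖ > 2R`.
    refine ⟨w, hw, connectedComponentIn_subset _ _ hw, 1 + C w * X, by simp, fun z hz => ?_⟩
    have h1 : ‖z‖ < ‖z - w‖ := by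
      have := norm_sub_norm_le w z
      rw [norm_sub_rev] at this
      linarith [hR z hz]
    have h2 : z - w ≠ 0 := norm_pos_iff.1 ((norm_nonneg z).trans_lt h1)
    have h3 : (1 + C w * X).eval (z - w)⁻¹ = z / (z - w) := by
      simp only [eval_add, eval_one, eval_mul, eval_C, eval_X]
      field_simp
      ring
    rw [h3, norm_div, div_lt_one (norm_pos_iff.2 h2)]
    exact h1
  exact (isPreconnected_connectedComponentIn.subset_of_closure_inter_subset hopen hmeet hclosed
    (mem_connectedComponentIn hz₀.1)).2

/-- The polynomial `(z - z₀) ^ d * p (1 / (z - z₀))`. -/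
lemma exists_monic_of_inv (p : ℂ[X]) (hp0 : p.eval 0 = 1) (z₀ : ℂ) :
    ∃ h : ℂ[X], h.Monic ∧ ∀ z ≠ z₀, h.eval z = (z - z₀) ^ h.natDegree * p.eval (z - z₀)⁻¹ := by
  set d := p.natDegree with hd
  set g : ℂ[X] := ∑ j ∈ Finset.range d, C (p.coeff (j + 1)) * (X - C z₀) ^ (d - (j + 1)) with hg
  have hXd : ((X - C z₀) ^ d).natDegree = d := by simp
  have hXm : ((X - C z₀) ^ d).Monic := (monic_X_sub_C z₀).pow d
  have hlt : g.degree < ((X - C z₀) ^ d).degree := by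
    rw [degree_eq_natDegree hXm.ne_zero, hXd]
    refine lt_of_le_of_lt (degree_sum_le _ _) ((Finset.sup_lt_iff (by simp)).2 fun j hj => ?_)
    have hj := Finset.mem_range.1 hj
    refine (degree_mul_le _ _).trans_lt ((add_le_add degree_C_le degree_le_natDegree).trans_lt ?_)
    rw [zero_add, natDegree_pow, natDegree_X_sub_C, mul_one]
    exact_mod_cast (by omega : d - (j + 1) < d)
  have hm : ((X - C z₀) ^ d + g).Monic := hXm.add_of_left hlt
  have hnd : ((X - C z₀) ^ d + g).natDegree = d := by
    rw [natDegree_add_eq_left_of_degree_lt hlt, hXd]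
  refine ⟨_, hm, fun z hz => ?_⟩
  have hne : z - z₀ ≠ 0 := sub_ne_zero.2 hz
  rw [hnd, eval_eq_sum_range (p := p), Finset.sum_range_succ', ← hd, coeff_zero_eq_eval_zero, hp0, mul_add,
    add_comm, Finset.mul_sum]
  simp only [eval_add, eval_pow, eval_sub, eval_X, eval_C, hg, eval_finsetSum, eval_mul, pow_zero,
    mul_one]
  congr 1
  refine Finset.sum_congr rfl fun j hj => ?_
  have hj := Finset.mem_range.1 hj
  rw [pow_sub₀ _ hne (by omega), inv_pow]
  ring

/-- Around each point `z₀` of the unbounded component there is a disc and a monic polynomial which,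
on the support, is less than half of any monic polynomial of the same degree with all its zeros in
the disc. -/
lemma exists_monic_half {μ : Measure ℂ} (hcompact : IsCompact μ.support)
    (hE : IsCompact (essSpectrum μ)) {z₀ : ℂ} (hz₀ : z₀ ∈ unboundedComponent (essSpectrum μ)) :
    ∃ h : ℂ[X], h.Monic ∧ ∃ r > 0, ∀ z ∈ μ.support, h.eval z = 0 ∨
      (r < ‖z - z₀‖ ∧ ‖h.eval z‖ ≤ 1 / 2 * (‖z - z₀‖ - r) ^ h.natDegree) := by
  obtain ⟨p, hp0, hp⟩ := exists_polynomial_inv hE hz₀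
  obtain ⟨f, hfm, hf⟩ := exists_monic_of_inv p hp0 z₀
  set d := f.natDegree with hd
  obtain ⟨θ, hθ0, hθ1, hθ⟩ : ∃ θ : ℝ, 0 ≤ θ ∧ θ < 1 ∧ ∀ z ∈ essSpectrum μ,
      ‖p.eval (z - z₀)⁻¹‖ < θ := by
    rcases (essSpectrum μ).eq_empty_or_nonempty with h0 | hne
    · exact ⟨0, le_rfl, one_pos, by simp [h0]⟩
    · obtain ⟨x, hx, hmax⟩ := hE.exists_isMaxOn hne
        (f := fun z => ‖p.eval (z - z₀)⁻¹‖) (p.continuous.norm.comp_continuousOn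
          (ContinuousOn.inv₀ (by fun_prop) fun z hz => sub_ne_zero.2 fun h => hz₀.1 (h ▸ hz)))
      obtain ⟨θ, h1, h2⟩ := exists_between (hp x hx)
      exact ⟨θ, (norm_nonneg _).trans h1.le, h2, fun z hz => (hmax hz).trans_lt h1⟩
  obtain ⟨δ, hδ, hδE⟩ : ∃ δ > 0, ∀ z ∈ essSpectrum μ, δ < ‖z - z₀‖ := by
    obtain ⟨δ, hδ, hsub⟩ := Metric.isOpen_iff.1 hE.isClosed.isOpen_compl z₀ hz₀.1
    refine ⟨δ / 2, half_pos hδ, fun z hz => ?_⟩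
    by_contra! hle
    exact hsub (by rw [Metric.mem_ball, dist_eq_norm]; linarith) hz
  set U : Set ℂ := {z | δ < ‖z - z₀‖ ∧ ‖f.eval z‖ < θ * ‖z - z₀‖ ^ d}
  have hU : IsOpen U := by
    have h1 : IsOpen {z : ℂ | δ < ‖z - z₀‖} := isOpen_lt (by fun_prop) (by fun_prop)
    have h2 : IsOpen {z | ‖f.eval z‖ < θ * ‖z - z₀‖ ^ d} := isOpen_lt (by fun_prop) (by fun_prop)
    exact h1.inter h2
  have hEU : essSpectrum μ ⊆ U := fun z hz => by
    have hpos := hδ.trans (hδE z hz)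
    refine ⟨hδE z hz, ?_⟩
    rw [hf z (sub_ne_zero.1 (norm_pos_iff.1 hpos)), norm_mul, norm_pow, mul_comm]
    exact mul_lt_mul_of_pos_right (hθ z hz) (pow_pos hpos d)
  have hfin := finite_support_sdiff hcompact hU hEU
  set T : ℂ[X] := ∏ t ∈ hfin.toFinset, (X - C t) with hT
  have hTm : T.Monic := monic_prod_of_monic _ _ fun t _ => monic_X_sub_C t
  obtain ⟨A, hA⟩ := hcompact.exists_bound_of_continuousOn (f := fun z => T.eval z) (by fun_prop)
  -- The target is `1 / 4` because another factor `2` is lost in passing from `‖z - z₀‖` to `‖z -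
  -- z₀‖ - ε δ`.
  obtain ⟨k, hk⟩ : ∃ k : ℕ, θ ^ k * (|A| + 1) ≤ 1 / 4 * δ ^ T.natDegree := by
    have hpos : 0 < 1 / 4 * δ ^ T.natDegree / (|A| + 1) := by positivity
    obtain ⟨k, hk⟩ := exists_pow_lt_of_lt_one hpos hθ1
    exact ⟨k, ((lt_div_iff₀ (by positivity)).1 hk).le⟩
  have hnd : (f ^ k * T).natDegree = k * d + T.natDegree := by
    rw [(hfm.pow k).natDegree_mul hTm, hfm.natDegree_pow]
  obtain ⟨ε, hε0, hε1, hε⟩ : ∃ ε : ℝ, 0 < ε ∧ ε < 1 ∧ 1 / 2 ≤ (1 - ε) ^ (f ^ k * T).natDegree := by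
    have hc : Tendsto (fun ε : ℝ => (1 - ε) ^ (f ^ k * T).natDegree) (𝓝[>] 0) (𝓝 1) := by
      have : Continuous fun ε : ℝ => (1 - ε) ^ (f ^ k * T).natDegree := by fun_prop
      simpa using (this.tendsto 0).mono_left nhdsWithin_le_nhds
    obtain ⟨ε, h1, h2, h3⟩ := ((hc.eventually (lt_mem_nhds (by norm_num : (1 / 2 : ℝ) < 1))).and
      (Ioo_mem_nhdsGT one_pos)).exists
    exact ⟨ε, h2, h3, h1.le⟩
  refine ⟨f ^ k * T, (hfm.pow k).mul hTm, ε * δ, by positivity, fun z hz => ?_⟩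
  by_cases hzU : z ∈ U
  · right
    have h1 : ε * δ < ‖z - z₀‖ := by nlinarith [hzU.1]
    refine ⟨h1, ?_⟩
    have hlow : (1 - ε) * ‖z - z₀‖ ≤ ‖z - z₀‖ - ε * δ := by nlinarith [hzU.1]
    have hpow : ((1 - ε) * ‖z - z₀‖) ^ (f ^ k * T).natDegree ≤
        (‖z - z₀‖ - ε * δ) ^ (f ^ k * T).natDegree :=
      pow_le_pow_left₀ (mul_nonneg (by linarith) (norm_nonneg _)) hlow _
    rw [mul_pow] at hpow
    have hδT : δ ^ T.natDegree ≤ ‖z - z₀‖ ^ T.natDegree := pow_le_pow_left₀ hδ.le hzU.1.le _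
    calc ‖(f ^ k * T).eval z‖ = ‖f.eval z‖ ^ k * ‖T.eval z‖ := by simp
      _ ≤ (θ * ‖z - z₀‖ ^ d) ^ k * (|A| + 1) := by
          gcongr
          · exact hzU.2.le
          · exact (hA z hz).trans ((le_abs_self A).trans (by linarith))
      _ = (θ ^ k * (|A| + 1)) * ‖z - z₀‖ ^ (k * d) := by rw [mul_pow, ← pow_mul, mul_comm d k]; ring
      _ ≤ (1 / 4 * ‖z - z₀‖ ^ T.natDegree) * ‖z - z₀‖ ^ (k * d) := by
          refine mul_le_mul_of_nonneg_right (hk.trans ?_) (by positivity)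
          gcongr
      _ = 1 / 2 * (1 / 2 * ‖z - z₀‖ ^ (f ^ k * T).natDegree) := by rw [hnd, pow_add]; ring
      _ ≤ 1 / 2 * ((1 - ε) ^ (f ^ k * T).natDegree * ‖z - z₀‖ ^ (f ^ k * T).natDegree) := by
          gcongr
      _ ≤ _ := by gcongr
  · left
    have : T.eval z = 0 := by
      rw [hT, eval_prod]
      exact Finset.prod_eq_zero (hfin.mem_toFinset.2 ⟨hz, hzU⟩) (by simp)
    simp [this]

section
variable {R : ℝ} {μ : Measure ℂ} [IsFiniteMeasure μ] {h : ℂ[X]} {z₀ : ℂ} {r : ℝ}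

/-- Exchanging the factors with zeros in the disc for `h` at least halves the modulus at every point
of the support. -/
lemma normSqL2_mul_le_quarter (hB : BddBy R μ)
    (hs : ∀ z ∈ μ.support, h.eval z = 0 ∨
      (r < ‖z - z₀‖ ∧ ‖h.eval z‖ ≤ 1 / 2 * (‖z - z₀‖ - r) ^ h.natDegree))
    {t : Multiset ℂ} (ht : ∀ w ∈ t, w ∈ Metric.ball z₀ r) (hc : Multiset.card t = h.natDegree)
    (B : ℂ[X]) : normSqL2 μ (h * B) ≤ 1 / 4 * normSqL2 μ ((t.map fun w => X - C w).prod * B) := by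
  rw [normSqL2, normSqL2, ← integral_const_mul]
  refine integral_mono_ae (integrable_of_continuous hB (by fun_prop))
    (integrable_of_continuous hB (by fun_prop)) ?_
  filter_upwards [μ.support_mem_ae] with z hz
  rw [eval_mul, eval_mul, norm_mul, norm_mul, mul_pow, mul_pow, ← mul_assoc]
  refine mul_le_mul_of_nonneg_right ?_ (by positivity)
  rcases hs z hz with h0 | ⟨hr, hle⟩
  · rw [h0, norm_zero, zero_pow two_ne_zero]
    positivity
  · have hprod : (‖z - z₀‖ - r) ^ h.natDegree ≤ ‖(t.map fun w => X - C w).prod.eval z‖ := by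
      rw [← hc]
      clear hc hle
      induction t using Multiset.induction_on with
      | empty => simp
      | cons a t ih =>
        rw [Multiset.map_cons, Multiset.prod_cons, eval_mul, norm_mul, Multiset.card_cons, pow_succ']
        refine mul_le_mul ?_ (ih fun w hw => ht w (Multiset.mem_cons_of_mem hw))
          (pow_nonneg (by linarith) _) (norm_nonneg _)
        have h1 := ht a (Multiset.mem_cons_self a t)
        rw [Metric.mem_ball, dist_eq_norm] at h1
        have h2 := norm_sub_norm_le (z - z₀) (a - z₀)
        rw [sub_sub_sub_cancel_right] at h2
        rw [eval_sub, eval_X, eval_C]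
        linarith
    have h3 : ‖h.eval z‖ ≤ 1 / 2 * ‖(t.map fun w => X - C w).prod.eval z‖ := by linarith
    calc ‖h.eval z‖ ^ 2 ≤ (1 / 2 * ‖(t.map fun w => X - C w).prod.eval z‖) ^ 2 := by gcongr
      _ = _ := by ring

open Classical in
/-- The orthogonal polynomials have boundedly many zeros near each point of the unbounded
component. -/
lemma card_roots_ball_lt (hB : BddBy R μ) (hinf : μ.support.Infinite) (hm : h.Monic)
    (hs : ∀ z ∈ μ.support, h.eval z = 0 ∨
      (r < ‖z - z₀‖ ∧ ‖h.eval z‖ ≤ 1 / 2 * (‖z - z₀‖ - r) ^ h.natDegree)) (n : ℕ) :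
    Multiset.card ((monicOP μ n).roots.filter (· ∈ Metric.ball z₀ r)) < h.natDegree := by
  by_contra! hge
  obtain ⟨t, ht⟩ := Multiset.card_pos_iff_exists_mem.1
    ((Multiset.card_powersetCard _ _).symm ▸ Nat.choose_pos hge)
  obtain ⟨ht, hc⟩ := Multiset.mem_powersetCard.1 ht
  -- Were there `deg h` zeros in the disc, replacing them by the zeros of `h` would quarter the
  -- minimal squared norm.
  obtain ⟨B, hXB⟩ : (t.map fun w => X - C w).prod ∣ monicOP μ n :=
    (Multiset.prod_X_sub_C_dvd_iff_le_roots (monicOP_monic μ n).ne_zero t).2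
      (ht.trans (Multiset.filter_le _ _))
  have htm : (t.map fun w => X - C w).prod.Monic :=
    monic_multiset_prod_of_monic _ _ fun w _ => monic_X_sub_C w
  have hBm : B.Monic := htm.of_mul_monic_left (hXB ▸ monicOP_monic μ n)
  have hd : (h * B).natDegree = n := by
    rw [hm.natDegree_mul hBm, ← hc, ← natDegree_multiset_prod_X_sub_C_eq_card t,
      ← htm.natDegree_mul hBm, ← hXB, natDegree_monicOP]
  have h1 := normSqL2_monicOP_le hB hinf (hm.mul hBm)
  have h2 := normSqL2_mul_le_quarter hB hs (t := t)
    (fun w hw => Multiset.of_mem_filter (Multiset.mem_of_le ht hw)) hc B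
  rw [hd] at h1
  rw [← hXB] at h2
  linarith [normSqL2_monicOP_pos hB hinf n]

/-- The orthogonal polynomials are not small near a point of the unbounded component. -/
lemma exists_opNorm_le_eval (hB : BddBy R μ) (hinf : μ.support.Infinite)
    (hcompact : IsCompact μ.support) (hm : h.Monic)
    (hs : ∀ z ∈ μ.support, h.eval z = 0 ∨
      (r < ‖z - z₀‖ ∧ ‖h.eval z‖ ≤ 1 / 2 * (‖z - z₀‖ - r) ^ h.natDegree))
    {t : Finset ℂ} (ht : ∀ w ∈ t, w ∈ Metric.ball z₀ r) (hc : t.card = h.natDegree) :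
    ∃ c > 0, ∀ n ≥ t.card, ∃ w ∈ t, c * opNorm μ n ≤ ‖(monicOP μ n).eval w‖ := by
  classical
  obtain ⟨L, hL⟩ := hcompact.exists_bound_of_continuousOn
    (f := fun z => ∑ w ∈ t, ‖(Lagrange.basis t id w).eval z‖) (by fun_prop)
  -- Chosen so that values at the nodes below `opNorm μ n / √(2D)` make the squared norm of the
  -- interpolant at most half that of the orthogonal polynomial.
  set D := (|L| + 1) ^ 2 * (μ.real Set.univ + 1) with hD
  have hD0 : 0 < D := by positivity
  refine ⟨Real.sqrt (1 / (2 * D)), Real.sqrt_pos.2 (by positivity), fun n hn => ?_⟩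
  by_contra! hlt
  set P := monicOP μ n with hP
  set W : ℂ[X] := (t.val.map fun w => X - C w).prod with hW
  have hWm : W.Monic := monic_multiset_prod_of_monic _ _ fun w _ => monic_X_sub_C w
  have hWd : W.natDegree = t.card := natDegree_multiset_prod_X_sub_C_eq_card _
  -- `P - J` vanishes at the nodes, so its node factor can be exchanged for `h`. Minimality gives
  -- `‖P‖² ≤ ‖P - J‖² / 4 ≤ (‖P‖² + ‖J‖²) / 2`, so `J`, and with it some node value of `P`, cannot
  -- be small.
  set J : ℂ[X] := Lagrange.interpolate t id fun w => P.eval w with hJ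
  have hinj : Set.InjOn (id : ℂ → ℂ) t := Set.injOn_id _
  have hJd : J.degree < t.card := Lagrange.degree_interpolate_lt _ hinj
  have hJP : J.degree < P.degree := by
    rw [degree_eq_natDegree (monicOP_monic μ n).ne_zero, natDegree_monicOP]
    exact hJd.trans_le (by exact_mod_cast hn)
  have hPJm : (P - J).Monic := (monicOP_monic μ n).sub_of_left hJP
  have hPJd : (P - J).natDegree = n := by
    rw [natDegree_eq_of_degree_eq (degree_sub_eq_left_of_degree_lt hJP), natDegree_monicOP]
  obtain ⟨B, hXB⟩ : W ∣ P - J := by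
    refine (Multiset.prod_X_sub_C_dvd_iff_le_roots hPJm.ne_zero _).2 ?_
    refine (Multiset.le_iff_subset t.nodup).2 fun w hw => (mem_roots hPJm.ne_zero).2 ?_
    have := Lagrange.eval_interpolate_at_node (fun w => P.eval w) hinj hw
    rw [id] at this
    rw [IsRoot, eval_sub, hJ, this, sub_self]
  have hBm : B.Monic := hWm.of_mul_monic_left (hXB ▸ hPJm)
  have hd : (h * B).natDegree = n := by
    rw [hm.natDegree_mul hBm, ← hc, ← hWd, ← hWm.natDegree_mul hBm, ← hXB, hPJd]
  have h1 := normSqL2_monicOP_le hB hinf (hm.mul hBm)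
  have h2 := normSqL2_mul_le_quarter hB hs (t := t.val) ht hc B
  rw [hd] at h1
  rw [← hW, ← hXB] at h2
  have h3 : normSqL2 μ (P - J) ≤ 2 * normSqL2 μ P + 2 * normSqL2 μ J := by
    have hi : ∀ Q : ℂ[X], Integrable (fun z => ‖Q.eval z‖ ^ 2) μ := fun Q =>
      integrable_of_continuous hB (by fun_prop)
    simp only [normSqL2]
    rw [← integral_const_mul, ← integral_const_mul,
      ← integral_add ((hi _).const_mul _) ((hi _).const_mul _)]
    refine integral_mono (hi _) (((hi _).const_mul _).add ((hi _).const_mul _)) fun z => ?_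
    simp only [eval_sub]
    have := norm_sub_le (P.eval z) (J.eval z)
    have h4 := pow_le_pow_left₀ (norm_nonneg _) this 2
    nlinarith [sq_nonneg (‖P.eval z‖ - ‖J.eval z‖)]
  have hop : 0 < opNorm μ n := opNorm_pos hB hinf n
  have h4 : normSqL2 μ J ≤ (Real.sqrt (1 / (2 * D)) * opNorm μ n * (|L| + 1)) ^ 2 *
      μ.real Set.univ := by
    refine normSqL2_le_of_bound hB fun z hz => ?_
    rw [hJ, Lagrange.interpolate_apply, eval_finsetSum]
    calc ‖∑ w ∈ t, (C (P.eval w) * Lagrange.basis t id w).eval z‖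
        ≤ ∑ w ∈ t, Real.sqrt (1 / (2 * D)) * opNorm μ n * ‖(Lagrange.basis t id w).eval z‖ := by
          refine norm_sum_le_of_le _ fun w hw => ?_
          rw [eval_mul, eval_C, norm_mul]
          exact mul_le_mul_of_nonneg_right (hlt w hw).le (norm_nonneg _)
      _ = Real.sqrt (1 / (2 * D)) * opNorm μ n * ∑ w ∈ t, ‖(Lagrange.basis t id w).eval z‖ := by
          rw [Finset.mul_sum]
      _ ≤ _ := by
          refine mul_le_mul_of_nonneg_left ?_ (by positivity)
          have := (le_abs_self _).trans (hL z hz)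
          exact this.trans ((le_abs_self L).trans (by linarith))
  have h5 : opNorm μ n ^ 2 = normSqL2 μ P := Real.sq_sqrt (normSqL2_nonneg _ _)
  rw [mul_pow, mul_pow, Real.sq_sqrt (by positivity), h5] at h4
  have hPpos := normSqL2_monicOP_pos hB hinf n
  rw [← hP] at hPpos h1
  have h6 : 1 / (2 * D) * normSqL2 μ P * (|L| + 1) ^ 2 * μ.real Set.univ ≤ 1 / 2 * normSqL2 μ P := by
    calc 1 / (2 * D) * normSqL2 μ P * (|L| + 1) ^ 2 * μ.real Set.univ
        ≤ 1 / (2 * D) * normSqL2 μ P * (|L| + 1) ^ 2 * (μ.real Set.univ + 1) := by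
          gcongr; linarith
      _ = 1 / (2 * D) * normSqL2 μ P * D := by rw [hD]; ring
      _ = 1 / 2 * normSqL2 μ P := by field_simp
  linarith

end
end

/-! ### Zero counting measures and their limits -/

section
open Polynomial

lemma roots_monicOP_succ_ne_zero (μ : Measure ℂ) (n : ℕ) : (monicOP μ (n + 1)).roots ≠ 0 := by
  rw [← Multiset.card_pos, card_roots_eq, natDegree_monicOP]
  exact n.succ_pos

/-- The normalized zero counting measure of the orthogonal polynomial of degree `n + 1`. -/
def zeroMeasure (μ : Measure ℂ) (n : ℕ) : ProbabilityMeasure ℂ :=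
  ⟨avg (monicOP μ (n + 1)).roots, isProbabilityMeasure_avg (roots_monicOP_succ_ne_zero μ n)⟩

lemma coe_zeroMeasure (μ : Measure ℂ) (n : ℕ) :
    (zeroMeasure μ n : Measure ℂ) = avg (monicOP μ (n + 1)).roots := rfl

/-- `ν` is the weak limit of the zero counting measures along the sequence `N`. -/
structure IsZeroLimit (μ : Measure ℂ) (N : ℕ → ℕ) (ν : ProbabilityMeasure ℂ) : Prop where
  tendsto_atTop : Tendsto N atTop atTop
  tendsto_nhds : Tendsto (fun j => zeroMeasure μ (N j)) atTop (𝓝 ν)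
  measure_compl : (ν : Measure ℂ) (closedConvexHull ℝ μ.support)ᶜ = 0

section
variable {R : ℝ} {μ : Measure ℂ}

lemma closedConvexHull_subset_closedBall (hR : ∀ z ∈ μ.support, ‖z‖ ≤ R) :
    closedConvexHull ℝ μ.support ⊆ Metric.closedBall 0 R :=
  closedConvexHull_min (fun z hz => by simpa using hR z hz) (convex_closedBall 0 R)
    Metric.isClosed_closedBall

lemma bddBy_of_support (hR : ∀ z ∈ μ.support, ‖z‖ ≤ R) : BddBy R μ :=
  bddBy_of_measure_compl hR Measure.measure_compl_support

lemma isCompact_closedConvexHull_support (hcompact : IsCompact μ.support) :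
    IsCompact (closedConvexHull ℝ μ.support) := by
  obtain ⟨R, _, hR⟩ := exists_norm_le_of_isCompact hcompact
  exact (isCompact_closedBall 0 R).of_isClosed_subset isClosed_closedConvexHull
    (closedConvexHull_subset_closedBall hR)

lemma bddBy_of_closedConvexHull (hR : ∀ z ∈ μ.support, ‖z‖ ≤ R) {ν : Measure ℂ}
    (hν : ν (closedConvexHull ℝ μ.support)ᶜ = 0) : BddBy R ν :=
  bddBy_of_measure_compl (fun z hz => by
    simpa using closedConvexHull_subset_closedBall hR hz) hν

lemma IsZeroLimit.bddBy {N : ℕ → ℕ} {ν : ProbabilityMeasure ℂ} (hν : IsZeroLimit μ N ν)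
    (hR : ∀ z ∈ μ.support, ‖z‖ ≤ R) : BddBy R (ν : Measure ℂ) :=
  bddBy_of_closedConvexHull hR hν.measure_compl

variable [IsFiniteMeasure μ]

lemma zeroMeasure_compl (h : BddBy R μ) (hinf : μ.support.Infinite) (n : ℕ) :
    (zeroMeasure μ n : Measure ℂ) (closedConvexHull ℝ μ.support)ᶜ = 0 :=
  avg_compl fun _ hw => mem_closedConvexHull_of_isRoot h hinf (isRoot_of_mem_roots hw)

lemma bddBy_zeroMeasure (hR : ∀ z ∈ μ.support, ‖z‖ ≤ R) (hinf : μ.support.Infinite) (n : ℕ) :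
    BddBy R (zeroMeasure μ n : Measure ℂ) :=
  bddBy_of_closedConvexHull hR (zeroMeasure_compl (bddBy_of_support hR) hinf n)

lemma exists_isZeroLimit (hcompact : IsCompact μ.support) (hinf : μ.support.Infinite)
    {N : ℕ → ℕ} (hN : Tendsto N atTop atTop) :
    ∃ ν : ProbabilityMeasure ℂ, ∃ φ : ℕ → ℕ, StrictMono φ ∧ IsZeroLimit μ (N ∘ φ) ν := by
  obtain ⟨R, _, hR⟩ := exists_norm_le_of_isCompact hcompact
  obtain ⟨ν, hν, φ, hφ, hlim⟩ := exists_subseq_tendsto (fun j => zeroMeasure μ (N j))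
    (isCompact_closedConvexHull_support hcompact) fun j =>
      zeroMeasure_compl (bddBy_of_support hR) hinf _
  exact ⟨ν, φ, hφ, hN.comp hφ.tendsto_atTop, hlim, hν⟩

lemma norm_eval_orthonormalOP (h : BddBy R μ) (n : ℕ) (z : ℂ) :
    ‖(orthonormalOP μ n).eval z‖ = ‖(monicOP μ n).eval z‖ / opNorm μ n := by
  rw [orthonormalOP, L2norm_toReal h, eval_mul, eval_C, norm_mul, norm_inv, Complex.norm_real,
    Real.norm_of_nonneg (Real.sqrt_nonneg _), opNorm, div_eq_inv_mul]

/-- The identity linking growth and potential theory; at the zeros both sides are `-∞`. The degree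
is `n + 1` so that the counting measure is a probability measure. -/
lemma log_rootOP (h : BddBy R μ) (hinf : μ.support.Infinite) (n : ℕ) (z : ℂ) :
    ENNReal.log (rootOP μ (n + 1) z) =
      (rate μ (n + 1) : EReal) - potential (zeroMeasure μ n : Measure ℂ) z := by
  have hop := opNorm_pos h hinf (n + 1)
  have hn : (0 : ℝ) < ((n + 1 : ℕ) : ℝ) := by positivity
  rw [rootOP, ← ofReal_norm, norm_eval_orthonormalOP h, coe_zeroMeasure]
  by_cases hz : (monicOP μ (n + 1)).eval z = 0
  · rw [potential_avg_roots_eq_top (monicOP_monic μ _).ne_zero hz, hz, norm_zero, zero_div,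
      ENNReal.ofReal_zero, ENNReal.zero_rpow_of_pos (by positivity), ENNReal.log_zero]
    simp
  · rw [potential_avg_roots (monicOP_monic μ _) hz, natDegree_monicOP, ENNReal.log_rpow,
      ENNReal.log_ofReal_of_pos (div_pos (norm_pos_iff.2 hz) hop), ← EReal.coe_sub, rate,
      Real.log_div (norm_ne_zero_iff.2 hz) hop.ne', ← EReal.coe_mul]
    congr 1
    field_simp
    ring

lemma L2norm_rpow (h : BddBy R μ) (hinf : μ.support.Infinite) {n : ℕ} :
    L2norm μ (monicOP μ n) ^ ((1 : ℝ) / n) = EReal.exp (-(rate μ n : EReal)) := by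
  rw [← EReal.coe_neg, rate, EReal.exp_coe, L2norm_eq h, ENNReal.ofReal_rpow_of_pos]
  · rw [← opNorm, Real.rpow_def_of_pos (opNorm_pos h hinf n)]
    congr 2
    ring
  · exact opNorm_pos h hinf n

/-- The principle of descent along the zero counting measures. -/
lemma IsZeroLimit.potential_le {N : ℕ → ℕ} {ν : ProbabilityMeasure ℂ} (hν : IsZeroLimit μ N ν)
    (hR : ∀ z ∈ μ.support, ‖z‖ ≤ R) (hinf : μ.support.Infinite) {z : ℕ → ℂ} {z' : ℂ}
    (hz : Tendsto z atTop (𝓝 z')) {c : ℕ → ℝ} {c' : ℝ} (hc : Tendsto c atTop (𝓝 c'))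
    (hle : ∃ᶠ j in atTop, potential (zeroMeasure μ (N j) : Measure ℂ) (z j) ≤ c j) :
    potential (ν : Measure ℂ) z' ≤ c' := by
  refine (potential_le_iff (hν.bddBy hR)).2 fun k => EReal.coe_le_coe_iff.2 ?_
  refine le_of_tendsto_of_tendsto_of_frequently (tendsto_tpot hν.tendsto_nhds
    (fun j => bddBy_zeroMeasure hR hinf _) (hν.bddBy hR) k hz) hc (hle.mono fun j hj => ?_)
  exact EReal.coe_le_coe_iff.1
    ((tpot_le_potential (bddBy_zeroMeasure hR hinf _) k (z j)).trans hj)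

lemma isClosed_setOf_potential_le {ν : Measure ℂ} [IsFiniteMeasure ν] (h : BddBy R ν) (c : EReal) :
    IsClosed {z | potential ν z ≤ c} :=
  (lowerSemicontinuous_potential h).isClosed_preimage c

/-- On the closure of the unbounded component the potential of a limit of the zero counting
measures is at most the limit of the rates. -/
lemma IsZeroLimit.potential_le_of_tendsto_rate {N : ℕ → ℕ} {ν : ProbabilityMeasure ℂ}
    (hν : IsZeroLimit μ N ν) (hcompact : IsCompact μ.support) (hinf : μ.support.Infinite)
    (hE : IsCompact (essSpectrum μ)) {a : ℝ}
    (ha : Tendsto (fun j => rate μ (N j + 1)) atTop (𝓝 a)) :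
    ∀ z ∈ closure (unboundedComponent (essSpectrum μ)), potential (ν : Measure ℂ) z ≤ a := by
  obtain ⟨R, _, hR⟩ := exists_norm_le_of_isCompact hcompact
  have hclosed := isClosed_setOf_potential_le (hν.bddBy hR) a
  have hsub : unboundedComponent (essSpectrum μ) ⊆ {z | potential (ν : Measure ℂ) z ≤ a} := by
    intro z₀ hz₀
    rw [← hclosed.closure_eq, Metric.mem_closure_iff]
    intro ε hε
    obtain ⟨h, hm, r, hr, hs⟩ := exists_monic_half hcompact hE hz₀
    have hballinf : (Metric.ball z₀ (min ε r)).Infinite :=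
      infinite_of_mem_nhds z₀ (Metric.ball_mem_nhds z₀ (lt_min hε hr))
    obtain ⟨t, ht, hcard⟩ := hballinf.exists_subset_card_eq h.natDegree
    obtain ⟨c, hc, hcn⟩ := exists_opNorm_le_eval (bddBy_of_support hR) hinf hcompact hm hs
      (t := t) (fun w hw => Metric.ball_subset_ball (min_le_right _ _) (ht hw)) hcard
    have hN : ∀ᶠ j in atTop, t.card ≤ N j + 1 :=
      (hν.tendsto_atTop.eventually_ge_atTop t.card).mono fun j hj => hj.trans (Nat.le_succ _)
    have hev : ∀ᶠ j in atTop, ∃ w ∈ t, potential (zeroMeasure μ (N j) : Measure ℂ) w ≤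
        ((rate μ (N j + 1) - Real.log c / ((N j : ℝ) + 1) : ℝ) : EReal) := by
      filter_upwards [hN] with j hj
      obtain ⟨w, hw, hle⟩ := hcn _ hj
      refine ⟨w, hw, ?_⟩
      have hop := opNorm_pos (bddBy_of_support hR) hinf (N j + 1)
      have hpos : 0 < ‖(monicOP μ (N j + 1)).eval w‖ := (mul_pos hc hop).trans_le hle
      rw [coe_zeroMeasure, potential_avg_roots (monicOP_monic μ _) (norm_pos_iff.1 hpos),
        natDegree_monicOP, EReal.coe_le_coe_iff]
      have hlog := Real.log_le_log (mul_pos hc hop) hle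
      rw [Real.log_mul hc.ne' hop.ne'] at hlog
      rw [rate]
      push_cast
      rw [← sub_div]
      exact div_le_div_of_nonneg_right (by linarith) (by positivity)
    -- By the pigeonhole principle one of the finitely many nodes works infinitely often. Descent at
    -- that node gives a point within `ε` of `z₀` with the required bound, and the sublevel set is
    -- closed.
    have hfreq : ∃ w ∈ t, ∃ᶠ j in atTop, potential (zeroMeasure μ (N j) : Measure ℂ) w ≤
        ((rate μ (N j + 1) - Real.log c / ((N j : ℝ) + 1) : ℝ) : EReal) := by
      by_contra! hcon
      have h1 : ∀ᶠ j in atTop, ∀ w ∈ t, ¬ potential (zeroMeasure μ (N j) : Measure ℂ) w ≤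
        ((rate μ (N j + 1) - Real.log c / ((N j : ℝ) + 1) : ℝ) : EReal) :=
        (Finset.eventually_all t).2 fun w hw => (hcon w hw).mono fun _ h => not_le.2 h
      obtain ⟨j, hj1, w, hw, hj2⟩ := (h1.and hev).exists
      exact hj1 w hw hj2
    obtain ⟨w, hw, hfw⟩ := hfreq
    have hlim : Tendsto (fun j => rate μ (N j + 1) - Real.log c / ((N j : ℝ) + 1)) atTop
        (𝓝 a) := by
      have h1 : Tendsto (fun j => Real.log c * (1 / ((N j : ℝ) + 1))) atTop
          (𝓝 (Real.log c * 0)) :=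
        (tendsto_one_div_add_atTop_nhds_zero_nat.comp hν.tendsto_atTop).const_mul _
      simpa [div_eq_mul_inv] using ha.sub h1
    refine ⟨w, hν.potential_le hR hinf tendsto_const_nhds hlim hfw, ?_⟩
    have := ht hw
    rw [Metric.mem_ball, dist_comm] at this
    exact this.trans_le (min_le_left _ _)
  exact fun z hz => (closure_minimal hsub hclosed) hz

/-- Limits of the zero counting measures do not charge the unbounded component. -/
lemma IsZeroLimit.measure_unboundedComponent {N : ℕ → ℕ} {ν : ProbabilityMeasure ℂ}
    (hν : IsZeroLimit μ N ν) (hcompact : IsCompact μ.support) (hinf : μ.support.Infinite)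
    (hE : IsCompact (essSpectrum μ)) :
    (ν : Measure ℂ) (unboundedComponent (essSpectrum μ)) = 0 := by
  classical
  obtain ⟨R, _, hR⟩ := exists_norm_le_of_isCompact hcompact
  refine measure_null_of_locally_null _ fun z₀ hz₀ => ?_
  obtain ⟨h, hm, r, hr, hs⟩ := exists_monic_half hcompact hE hz₀
  refine ⟨Metric.ball z₀ r, mem_nhdsWithin_of_mem_nhds (Metric.ball_mem_nhds z₀ hr), ?_⟩
  -- The portmanteau inequality for the open disc, which contains boundedly many of the `N j + 1`
  -- zeros.
  have h1 := ProbabilityMeasure.le_liminf_measure_open_of_tendsto hν.tendsto_nhds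
    (Metric.isOpen_ball (x := z₀) (ε := r))
  have h2 : Tendsto (fun j => (h.natDegree : ℝ≥0∞) / ((N j + 1 : ℕ) : ℝ≥0∞)) atTop (𝓝 0) := by
    have h3 := ENNReal.Tendsto.const_mul (a := (h.natDegree : ℝ≥0∞))
      (ENNReal.tendsto_inv_nat_nhds_zero.comp ((tendsto_add_atTop_nat 1).comp hν.tendsto_atTop))
      (Or.inr (ENNReal.natCast_ne_top _))
    rw [mul_zero] at h3
    exact h3
  refine le_antisymm (h1.trans ?_) bot_le
  rw [← h2.liminf_eq]
  refine liminf_le_liminf (Eventually.of_forall fun j => ?_)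
  simp only [coe_zeroMeasure, avg_apply, card_roots_eq, natDegree_monicOP]
  gcongr
  have := card_roots_ball_lt (bddBy_of_support hR) hinf hm hs (N j + 1)
  exact this.le

end
end

/-! ### Comparison of limits of zero counting measures with the equilibrium measure -/

/-- The rest of `ν` has potential bounded below on the disc, so the restricted part has potential
bounded above on `A`. -/
lemma FiniteEnergy.restrict_of_potential_le {R : ℝ} {ν : Measure ℂ} [IsFiniteMeasure ν]
    (h : BddBy R ν) {A : Set ℂ} (hA : MeasurableSet A) {V : ℝ}
    (hV : ∀ z ∈ A, potential ν z ≤ V) : FiniteEnergy (ν.restrict A) := by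
  set c := Real.log (max 1 (R + R)) * (ν.restrict Aᶜ).real Set.univ
  have hint : Integrable (fun _ : ℂ => V + c) (ν.restrict A) := integrable_const _
  refine ⟨∫ _, (V + c) ∂(ν.restrict A), fun n => ?_⟩
  refine integral_mono_ae (integrable_tpot (h.restrict A) (h.restrict A) n) hint ?_
  filter_upwards [ae_restrict_mem hA, h.restrict A] with x hx hxR
  have h1 := tpot_restrict_add_compl h hA n x
  have h2 := le_tpot_add (h.restrict Aᶜ) n hxR
  have h3 := EReal.coe_le_coe_iff.1 ((tpot_le_potential h n x).trans (hV x hx))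
  linarith

/-- Markov's inequality for the nonnegative defects `V - tpot n ν`, whose means become arbitrarily
small. -/
lemma ae_le_potential_of_integral {R : ℝ} {ν σ : Measure ℂ} [IsFiniteMeasure ν]
    [IsProbabilityMeasure σ] (h : BddBy R ν) (hσ : BddBy R σ) {V : ℝ}
    (hle : ∀ᵐ z ∂σ, potential ν z ≤ V) (hlim : ∀ ε > 0, ∃ n, V - ε < ∫ x, tpot n ν x ∂σ) :
    ∀ᵐ z ∂σ, (V : EReal) ≤ potential ν z := by
  have key : ∀ k : ℕ, σ {z | potential ν z ≤ ((V - 1 / (k + 1) : ℝ) : EReal)} = 0 := by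
    intro k
    rw [← measureReal_eq_zero_iff (measure_ne_top _ _)]
    have hk : (0 : ℝ) < 1 / (k + 1) := by positivity
    refine le_antisymm (le_of_forall_pos_le_add fun ε hε => ?_) measureReal_nonneg
    obtain ⟨n, hn⟩ := hlim (1 / (k + 1) * ε) (by positivity)
    have h1 := mul_meas_ge_le_integral_of_nonneg (μ := σ) (f := fun x => V - tpot n ν x)
      (by
        filter_upwards [hle] with x hx
        exact sub_nonneg.2 (EReal.coe_le_coe_iff.1 ((tpot_le_potential h n x).trans hx)))
      ((integrable_const _).sub (integrable_tpot h hσ n)) (1 / (k + 1))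
    rw [integral_sub (integrable_const _) (integrable_tpot h hσ n)] at h1
    simp only [integral_const, probReal_univ, one_smul] at h1
    have h2 : σ.real {z | potential ν z ≤ ((V - 1 / (k + 1) : ℝ) : EReal)} ≤
        σ.real {x | 1 / ((k : ℝ) + 1) ≤ V - tpot n ν x} := by
      refine measureReal_mono fun x hx => ?_
      have := EReal.coe_le_coe_iff.1 ((tpot_le_potential h n x).trans hx)
      show 1 / ((k : ℝ) + 1) ≤ V - tpot n ν x
      linarith
    have h3 : 1 / ((k : ℝ) + 1) * σ.real {z | potential ν z ≤ ((V - 1 / (k + 1) : ℝ) : EReal)} ≤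
        1 / (k + 1) * ε := (mul_le_mul_of_nonneg_left h2 hk.le).trans (by linarith)
    linarith [le_of_mul_le_mul_left h3 hk]
  filter_upwards [ae_all_iff.2 fun k => measure_eq_zero_iff_ae_notMem.1 (key k)] with z hz
  by_contra! hlt
  obtain ⟨c, hc1, hc2⟩ := EReal.lt_iff_exists_real_btwn.1 hlt
  rw [EReal.coe_lt_coe_iff] at hc2
  obtain ⟨k, hk⟩ := exists_nat_one_div_lt (sub_pos.2 hc2)
  exact hz k (hc1.le.trans (EReal.coe_le_coe_iff.2 (by linarith)))

section
variable {E : Set ℂ} {ρ : Measure ℂ}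

lemma IsEquilibriumMeasure.ae_mem_frontier (hE : IsCompact E) (hcap : capacity E ≠ 0)
    (hρ : IsEquilibriumMeasure E ρ) : ∀ᵐ z ∂ρ, z ∈ frontier (unboundedComponent E) :=
  (hρ.compl_unboundedComponent hE hcap).measure_compl_frontier hE hcap

lemma IsEquilibriumMeasure.measurableSet_exceptional (hE : IsCompact E)
    (hρ : IsEquilibriumMeasure E ρ) :
    MeasurableSet {z ∈ (unboundedComponent E)ᶜ | potential ρ z < robin E} := by
  have := hρ.1
  obtain ⟨R, _, hR⟩ := exists_norm_le_of_isCompact hE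
  exact measurableSet_setOf_potential_lt (isCompact_compl_unboundedComponent hE)
    (bddBy_of_measure_compl hR hρ.measure_compl) _

lemma IsEquilibriumMeasure.capacity_exceptional (hE : IsCompact E) (hcap : capacity E ≠ 0)
    (hρ : IsEquilibriumMeasure E ρ) :
    capacity {z ∈ (unboundedComponent E)ᶜ | potential ρ z < robin E} = 0 := by
  have := (hρ.compl_unboundedComponent hE hcap).capacity_setOf_lt
    (isCompact_compl_unboundedComponent hE) (capacity_compl_unboundedComponent_ne_zero hcap)
  rwa [robin_compl_unboundedComponent hE hcap] at this

lemma IsEquilibriumMeasure.potential_eq_of_mem_interior (hE : IsCompact E) (hcap : capacity E ≠ 0)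
    (hρ : IsEquilibriumMeasure E ρ) {z : ℂ} (hz : z ∈ interior (unboundedComponent E)ᶜ) :
    potential ρ z = robin E := by
  obtain ⟨r, hr, hzr⟩ := exists_closedBall_subset_of_mem_interior hz
  rw [← robin_compl_unboundedComponent hE hcap]
  exact ((hρ.compl_unboundedComponent hE hcap).of_closedBall_subset
    (isCompact_compl_unboundedComponent hE) (capacity_compl_unboundedComponent_ne_zero hcap)
    hr hzr).1

lemma frontier_subset_compl_unboundedComponent (hE : IsCompact E) :
    frontier (unboundedComponent E) ⊆ (unboundedComponent E)ᶜ := by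
  rw [(isOpen_unboundedComponent hE.isClosed).frontier_eq]
  exact fun z hz => hz.2

/-- A measure off the unbounded component whose potential is at most the Robin constant on the
closure of that component has a potential that dominates the equilibrium potential. -/
lemma IsEquilibriumMeasure.potential_le_potential (hE : IsCompact E) (hcap : capacity E ≠ 0)
    (hρ : IsEquilibriumMeasure E ρ) {R : ℝ} {ν : Measure ℂ} [IsProbabilityMeasure ν]
    (hν : BddBy R ν) (hν0 : ν (unboundedComponent E) = 0)
    (hle : ∀ z ∈ closure (unboundedComponent E), potential ν z ≤ robin E) (z : ℂ) :
    potential ρ z ≤ potential ν z := by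
  have hρp := hρ.1
  obtain ⟨R₀, _, hR₀⟩ := exists_norm_le_of_isCompact hE
  have h : BddBy (max R R₀) ρ :=
    (bddBy_of_measure_compl hR₀ hρ.measure_compl).mono (le_max_right _ _)
  replace hν : BddBy (max R R₀) ν := hν.mono (le_max_left _ _)
  have hBm : MeasurableSet (frontier (unboundedComponent E)) := isClosed_frontier.measurableSet
  have hfin : FiniteEnergy (ν.restrict (frontier (unboundedComponent E))) :=
    FiniteEnergy.restrict_of_potential_le hν hBm fun z hz => hle z (frontier_subset_closure hz)
  have hN := measure_eq_zero_of_capacity_eq_zero (hν.restrict _) hfin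
    (hρ.measurableSet_exceptional hE) (hρ.capacity_exceptional hE hcap)
  -- In the interior of the filled set equality holds at every point; on `∂Ω` the measure `ν` has
  -- bounded potential, hence finite energy, and misses the exceptional set.
  have hae : ∀ᵐ z ∂ν, potential ρ z = robin E := by
    filter_upwards [measure_eq_zero_iff_ae_notMem.1 hν0,
      (ae_restrict_iff' hBm).1 (measure_eq_zero_iff_ae_notMem.1 hN)] with z hz1 hz2
    by_cases hzi : z ∈ interior (unboundedComponent E)ᶜ
    · exact hρ.potential_eq_of_mem_interior hE hcap hzi
    · have hzB : z ∈ frontier (unboundedComponent E) := by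
        rw [← frontier_compl]
        exact ⟨subset_closure hz1, hzi⟩
      have h1 := hz2 hzB
      refine le_antisymm (hρ.potential_le hE hcap z) (not_lt.1 fun hlt => h1 ⟨hz1, hlt⟩)
  -- The mutual energy computed from the other side: the potential of `ν` has `ρ`-mean at least the
  -- Robin constant.
  have h1 : ∀ ε > 0, ∃ n, robin E - ε < ∫ x, tpot n ν x ∂ρ := by
    intro ε hε
    by_contra! hcon
    have := le_of_ae_le_potential h hν (c := robin E) (L := robin E - ε)
      (fun n => by rw [integral_tpot_comm h hν]; exact hcon n)
      (by filter_upwards [hae] with z hz using hz.ge)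
    linarith
  have h2 : ∀ᵐ z ∂ρ, potential ν z ≤ robin E := by
    filter_upwards [hρ.ae_mem_frontier hE hcap] with z hz using hle z (frontier_subset_closure hz)
  exact potential_le_potential_of_ae h hν
    ((hρ.ae_eq hE hcap).mono fun z hz => hz.le) (ae_le_potential_of_integral hν h h2 h1) z

lemma potential_eq_tpot {R : ℝ} {κ : Measure ℂ} [IsFiniteMeasure κ] (h : BddBy R κ) {x : ℂ} {n : ℕ}
    (hx : ∀ᵐ w ∂κ, Real.exp (-n) ≤ ‖x - w‖) : potential κ x = tpot n κ x := by
  refine le_antisymm ((potential_le_iff h).2 fun k => EReal.coe_le_coe_iff.2 ?_)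
    (tpot_le_potential h n x)
  refine integral_mono_ae (integrable_ker h k x) (integrable_ker h n x) ?_
  filter_upwards [hx] with w hw
  rw [ker_of_le hw]
  refine ker_le_neg_log k fun h => ?_
  rw [h, sub_self, norm_zero] at hw
  exact absurd hw (not_le.2 (Real.exp_pos _))

lemma circ_pos_of_mem {U : Set ℂ} (hU : IsOpen U) {c z : ℂ} {r : ℝ} (hr : 0 < r) (hz : z ∈ U)
    (hzr : ‖z - c‖ = r) : 0 < circ c r U := by
  obtain ⟨θ₁, hθ₁⟩ : ∃ θ, circleMap c r θ = z := by
    have : z ∈ Metric.sphere c |r| := by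
      rw [mem_sphere_iff_norm, hzr, abs_of_pos hr]
    rwa [← range_circleMap] at this
  obtain ⟨θ, hθ, hθe⟩ := (periodic_circleMap c r).exists_mem_Ico₀ Real.two_pi_pos θ₁
  have h1 : circleMap c r ⁻¹' U ∈ 𝓝[>] θ := by
    refine mem_nhdsWithin_of_mem_nhds ((hU.preimage (continuous_circleMap c r)).mem_nhds ?_)
    rw [Set.mem_preimage, ← hθe, hθ₁]
    exact hz
  obtain ⟨θ', hθ', hlt⟩ := (Filter.nonempty_of_mem (inter_mem h1 (Ioo_mem_nhdsGT hθ.2)))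
  exact circ_pos_of_isOpen hU hθ' ⟨hθ.1.trans_lt hlt.1, hlt.2⟩

/-- Off a compact convex set, domination of logarithmic potentials of probability measures on the
set is equality. -/
lemma potential_eq_of_notMem_convex {H : Set ℂ} (hH : IsCompact H) (hconv : Convex ℝ H)
    (hne : H.Nonempty) {ρ ν : Measure ℂ} [IsProbabilityMeasure ρ] [IsProbabilityMeasure ν]
    (hρ : ρ Hᶜ = 0) (hν : ν Hᶜ = 0) (hle : ∀ z, potential ρ z ≤ potential ν z) {z : ℂ}
    (hz : z ∉ H) : potential ρ z = potential ν z := by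
  obtain ⟨R, hR1, hR⟩ := exists_norm_le_of_isCompact hH
  have hBρ := bddBy_of_measure_compl hR hρ
  have hBν := bddBy_of_measure_compl hR hν
  obtain ⟨v, hv, hmin⟩ := exists_norm_eq_iInf_of_complete_convex hne hH.isClosed.isComplete hconv z
  have hproj := (norm_eq_iInf_iff_real_inner_le_zero hconv hv).1 hmin
  set d := ‖z - v‖ with hd
  have hd0 : 0 < d := norm_pos_iff.2 (sub_ne_zero.2 fun he => hz (he ▸ hv))
  -- A circle through `z` enclosing `H` is obtained by placing the centre far behind the nearest
  -- point `v`. With `s d = (2R)²`, every `w ∈ H` has `‖c - w‖² ≤ s² + s d ≤ (s + d / 2)²`.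
  set s := (2 * R) ^ 2 / d with hs
  have hs0 : 0 < s := by positivity
  have hsd : s * d = (2 * R) ^ 2 := by rw [hs]; field_simp
  set c : ℂ := v - (s / d : ℝ) • (z - v) with hc
  have hzc : ‖z - c‖ = s + d := by
    have : z - c = (1 + s / d : ℝ) • (z - v) := by
      rw [hc, add_smul, one_smul]; ring
    rw [this, norm_smul, Real.norm_of_nonneg (by positivity), ← hd]
    field_simp
    ring
  have hin : ∀ w ∈ H, ‖c - w‖ ≤ s + d / 2 := by
    intro w hw
    have h1 := hproj w hw
    have h2 : c - w = -((w - v) + (s / d : ℝ) • (z - v)) := by rw [hc]; ring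
    have h3 : ‖w - v‖ ≤ 2 * R := (norm_sub_le _ _).trans (by linarith [hR w hw, hR v hv])
    have h4 : ‖c - w‖ ^ 2 ≤ (s + d / 2) ^ 2 := by
      rw [h2, norm_neg, norm_add_sq_real, real_inner_smul_right, real_inner_comm, norm_smul,
        Real.norm_of_nonneg (by positivity), ← hd, div_mul_cancel₀ _ hd0.ne']
      have h5 : s / d * inner ℝ (z - v) (w - v) ≤ 0 :=
        mul_nonpos_of_nonneg_of_nonpos (by positivity) h1
      nlinarith [pow_le_pow_left₀ (norm_nonneg _) h3 2]
    exact le_of_sq_le_sq h4 (by positivity)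
  have hr : 0 < s + d := by positivity
  obtain ⟨n, hn⟩ : ∃ n : ℕ, Real.exp (-n) ≤ d / 2 := by
    obtain ⟨n, hn⟩ := exists_nat_gt (-Real.log (d / 2))
    exact ⟨n, by rw [← Real.le_log_iff_exp_le (by positivity)]; linarith⟩
  have hinside : ∀ κ : Measure ℂ, κ Hᶜ = 0 → ∀ᵐ w ∂κ, ‖c - w‖ ≤ s + d - Real.exp (-n) := by
    intro κ hκ
    filter_upwards [show ∀ᵐ w ∂κ, w ∈ H from hκ] with w hw
    linarith [hin w hw]
  have hpot : ∀ (κ : Measure ℂ) [IsProbabilityMeasure κ], κ Hᶜ = 0 → ∀ x, ‖x - c‖ = s + d →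
      potential κ x = tpot n κ x := by
    intro κ _ hκ x hx
    refine potential_eq_tpot (bddBy_of_measure_compl hR hκ) ?_
    filter_upwards [hinside κ hκ] with w hw
    have := norm_sub_norm_le (x - c) (w - c)
    rw [sub_sub_sub_cancel_right, norm_sub_rev w c] at this
    linarith
  have hcirc : ∀ (κ : Measure ℂ) [IsProbabilityMeasure κ], κ Hᶜ = 0 →
      ∫ x, tpot n κ x ∂(circ c (s + d)) = -Real.log (s + d) := by
    intro κ _ hκ
    have := integral_tpot_circ_of_inside hr (bddBy_of_measure_compl hR hκ) (hinside κ hκ)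
    simpa using this
  have hcρ := continuous_tpot hBρ n
  have hcν := continuous_tpot hBν n
  have hnonneg : 0 ≤ᵐ[circ c (s + d)] fun x => tpot n ν x - tpot n ρ x := by
    filter_upwards [ae_circ c hr.le] with x hx
    have := hle x
    rw [hpot ρ hρ x hx, hpot ν hν x hx, EReal.coe_le_coe_iff] at this
    exact sub_nonneg.2 this
  have hcb := bddBy_circ c hr.le
  have hiν : Integrable (fun x => tpot n ν x) (circ c (s + d)) := integrable_of_continuous hcb hcν
  have hiρ : Integrable (fun x => tpot n ρ x) (circ c (s + d)) := integrable_of_continuous hcb hcρ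
  -- Both potentials have mean `-log (s + d)` on the circle, so their continuous nonnegative
  -- difference vanishes there, in particular at `z`.
  have h0 : ∫ x, (tpot n ν x - tpot n ρ x) ∂(circ c (s + d)) = 0 := by
    rw [integral_sub hiν hiρ, hcirc ν hν, hcirc ρ hρ, sub_self]
  have hae := (integral_eq_zero_iff_of_nonneg_ae hnonneg (hiν.sub hiρ)).1 h0
  rw [hpot ρ hρ z hzc, hpot ν hν z hzc]
  by_contra hne'
  have hopen : IsOpen {x | tpot n ν x - tpot n ρ x ≠ 0} :=
    isOpen_ne_fun (hcν.sub hcρ) continuous_const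
  refine (circ_pos_of_mem hopen hr (z := z) (fun h => hne' ?_) hzc).ne'
    (measure_eq_zero_iff_ae_notMem.2 ?_)
  · rw [sub_eq_zero.1 h]
  · filter_upwards [hae] with x hx
    exact not_not.2 hx

end

/-! ### Regularity and the growth of the orthonormal polynomials -/

lemma coe_sub_le_coe_iff {r y : ℝ} {p : EReal} :
    (r : EReal) - p ≤ y ↔ ((r - y : ℝ) : EReal) ≤ p := by
  induction p using EReal.rec with
  | bot => simp [sub_eq_add_neg]
  | coe p =>
    rw [← EReal.coe_sub, EReal.coe_le_coe_iff, EReal.coe_le_coe_iff]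
    exact ⟨fun h => by linarith, fun h => by linarith⟩
  | top => simp [sub_eq_add_neg]

lemma coe_sub_lt_coe_iff {r y : ℝ} {p : EReal} :
    (r : EReal) - p < y ↔ ((r - y : ℝ) : EReal) < p := by
  induction p using EReal.rec with
  | bot => simp [sub_eq_add_neg]
  | coe p =>
    rw [← EReal.coe_sub, EReal.coe_lt_coe_iff, EReal.coe_lt_coe_iff]
    exact ⟨fun h => by linarith, fun h => by linarith⟩
  | top =>
    refine ⟨fun _ => EReal.coe_lt_top _, fun _ => ?_⟩
    rw [sub_eq_add_neg, EReal.neg_top, EReal.add_bot]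
    exact EReal.bot_lt_coe y

lemma exists_strictMono_succ {P : ℕ → Prop} (h : ∃ᶠ n in atTop, P n) :
    ∃ N : ℕ → ℕ, StrictMono N ∧ ∀ j, P (N j + 1) := by
  refine extraction_of_frequently_atTop (P := fun n => P (n + 1)) (frequently_atTop.2 fun a => ?_)
  obtain ⟨b, hb, hPb⟩ := frequently_atTop.1 h (a + 1)
  exact ⟨b - 1, by omega, by rwa [Nat.sub_add_cancel (by omega)]⟩

lemma limsup_le_exp {f : ℕ → ℝ≥0∞} {g : EReal}
    (h : ∀ y : ℝ, g < y → ∀ᶠ n in atTop, f n ≤ EReal.exp y) : limsup f atTop ≤ EReal.exp g := by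
  refine le_of_forall_gt_imp_ge_of_dense fun b hb => ?_
  have hb' : g < ENNReal.log b := by rwa [← EReal.exp_lt_exp_iff, ENNReal.exp_log]
  obtain ⟨y, hy1, hy2⟩ := EReal.lt_iff_exists_real_btwn.1 hb'
  refine (limsup_le_of_le (by isBoundedDefault) (h y hy1)).trans ?_
  rw [← ENNReal.exp_log b]
  exact EReal.exp_le_exp_iff.2 hy2.le

section
variable {E : Set ℂ}

lemma greenFunction_of_capacity_eq_zero (hcap : capacity E = 0) (z : ℂ) :
    greenFunction E z = ⊤ := if_pos hcap

lemma greenFunction_eq (hE : IsCompact E) (hcap : capacity E ≠ 0) (z : ℂ) :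
    greenFunction E z = (robin E : EReal) - potential (equilibriumMeasure E) z := by
  rw [greenFunction, if_neg hcap, log_capacity_inv, coe_robin hE hcap]

lemma greenFunction_lt_iff (hE : IsCompact E) (hcap : capacity E ≠ 0) {z : ℂ} {y : ℝ} :
    greenFunction E z < y ↔ ((robin E - y : ℝ) : EReal) < potential (equilibriumMeasure E) z := by
  rw [greenFunction_eq hE hcap, coe_sub_lt_coe_iff]

lemma nonneg_of_greenFunction_lt (hE : IsCompact E) {z : ℂ} {y : ℝ}
    (h : greenFunction E z < y) : 0 < y := by
  have hcap : capacity E ≠ 0 := fun h0 => by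
    rw [greenFunction_of_capacity_eq_zero h0] at h
    exact not_top_lt h
  have h1 := ((greenFunction_lt_iff hE hcap).1 h).trans_le
    ((isEquilibriumMeasure_equilibriumMeasure hE hcap).potential_le hE hcap z)
  rw [EReal.coe_lt_coe_iff] at h1
  linarith

/-- The Green's function vanishes quasi-everywhere on the boundary of the unbounded component. -/
lemma quasiEverywhereOn_greenFunction (hE : IsCompact E) :
    QuasiEverywhereOn (frontier (unboundedComponent E)) fun z => greenFunction E z = 0 := by
  by_cases hcap : capacity E = 0
  -- Here `∂Ω ⊆ E` is itself an exceptional set.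
  · refine ⟨E, hE.measurableSet, hcap, fun z hz => ?_⟩
    exact absurd (frontier_unboundedComponent_subset hE.isClosed hz.1) hz.2
  · have hρ := isEquilibriumMeasure_equilibriumMeasure hE hcap
    refine ⟨_, hρ.measurableSet_exceptional hE, hρ.capacity_exceptional hE hcap, fun z hz => ?_⟩
    have h1 : potential (equilibriumMeasure E) z = robin E :=
      le_antisymm (hρ.potential_le hE hcap z) (not_lt.1 fun hlt =>
        hz.2 ⟨frontier_subset_compl_unboundedComponent hE hz.1, hlt⟩)
    change greenFunction E z = 0
    rw [greenFunction_eq hE hcap, h1, ← EReal.coe_sub, sub_self, EReal.coe_zero]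

lemma QuasiEverywhereOn.mono {S : Set ℂ} {p q : ℂ → Prop} (h : QuasiEverywhereOn S p)
    (hpq : ∀ z, p z → q z) : QuasiEverywhereOn S q := by
  obtain ⟨N, hN, hcap, hp⟩ := h
  exact ⟨N, hN, hcap, fun z hz => hpq z (hp z hz)⟩

/-- A property that holds quasi-everywhere holds almost everywhere for measures of finite energy. -/
lemma QuasiEverywhereOn.ae {S : Set ℂ} {p : ℂ → Prop} (h : QuasiEverywhereOn S p) {R : ℝ}
    {σ : Measure ℂ} [IsFiniteMeasure σ] (hσ : BddBy R σ) (hE : FiniteEnergy σ)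
    (hS : ∀ᵐ z ∂σ, z ∈ S) : ∀ᵐ z ∂σ, p z := by
  obtain ⟨N, hN, hcap, hp⟩ := h
  filter_upwards [hS, measure_eq_zero_iff_ae_notMem.1
    (measure_eq_zero_of_capacity_eq_zero hσ hE hN hcap)] with z h1 h2 using hp z ⟨h1, h2⟩

end

lemma GreenUpperBound.boundaryUpperBound {μ : Measure ℂ} {E : Set ℂ} (hE : IsCompact E)
    (h : GreenUpperBound μ E) : BoundaryUpperBound μ E :=
  (quasiEverywhereOn_greenFunction hE).mono fun z hz => by
    simpa [hz] using h.1 z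

section
variable {μ : Measure ℂ} [IsFiniteMeasure μ]

lemma rootOP_le_exp_iff {R : ℝ} (h : BddBy R μ) (hinf : μ.support.Infinite) (n : ℕ) (z : ℂ)
    (y : ℝ) : rootOP μ (n + 1) z ≤ EReal.exp (y : EReal) ↔
      ((rate μ (n + 1) - y : ℝ) : EReal) ≤ potential (zeroMeasure μ n : Measure ℂ) z := by
  rw [← coe_sub_le_coe_iff, ← log_rootOP h hinf, ← EReal.exp_le_exp_iff, ENNReal.exp_log]

lemma isRegularMeasure_iff {R : ℝ} (h : BddBy R μ) (hinf : μ.support.Infinite) (E : Set ℂ) :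
    IsRegularMeasure μ E ↔ Tendsto (fun n => (rate μ n : EReal)) atTop (𝓝 (minEnergy E)) := by
  rw [IsRegularMeasure, capacity_eq]
  simp only [L2norm_rpow h hinf]
  constructor
  · intro h1
    have h2 := ((ENNReal.continuous_log.tendsto _).comp h1).neg
    simpa [Function.comp_def] using h2
  · intro h1
    exact (ENNReal.continuous_exp.tendsto _).comp h1.neg

lemma IsRegularMeasure.tendsto_rate {R : ℝ} (h : BddBy R μ) (hinf : μ.support.Infinite) {E : Set ℂ}
    (hE : IsCompact E) (hcap : capacity E ≠ 0) (hreg : IsRegularMeasure μ E) :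
    Tendsto (rate μ) atTop (𝓝 (robin E)) := by
  rw [isRegularMeasure_iff h hinf, ← coe_robin hE hcap] at hreg
  exact EReal.tendsto_coe.1 hreg

/-- For a regular measure, limits of the zero counting measures have potentials that dominate the
equilibrium potential. -/
lemma IsZeroLimit.equilibrium_le {N : ℕ → ℕ} {ν : ProbabilityMeasure ℂ} (hν : IsZeroLimit μ N ν)
    (hcompact : IsCompact μ.support) (hinf : μ.support.Infinite) (hE : IsCompact (essSpectrum μ))
    (hcap : capacity (essSpectrum μ) ≠ 0)
    (hreg : Tendsto (rate μ) atTop (𝓝 (robin (essSpectrum μ)))) (z : ℂ) :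
    potential (equilibriumMeasure (essSpectrum μ)) z ≤ potential (ν : Measure ℂ) z := by
  obtain ⟨R, _, hR⟩ := exists_norm_le_of_isCompact hcompact
  exact (isEquilibriumMeasure_equilibriumMeasure hE hcap).potential_le_potential hE hcap
    (hν.bddBy hR) (hν.measure_unboundedComponent hcompact hinf hE)
    (hν.potential_le_of_tendsto_rate hcompact hinf hE
      (hreg.comp ((tendsto_add_atTop_nat 1).comp hν.tendsto_atTop))) z

/-- Violations for infinitely many `n` occur at points with a limit `z'`, and along a further
subsequence the zero measures tend to some `ν`. Descent gives `Φ_ν(z') ≤ I - g(z')`, domination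
gives `Φ_{ρ_E}(z') ≤ Φ_ν(z')`, and together they contradict `g > G_E`. -/
lemma IsRegularMeasure.limsupLEUniformlyOnCompacts (hcompact : IsCompact μ.support)
    (hinf : μ.support.Infinite) (hE : IsCompact (essSpectrum μ))
    (hreg : IsRegularMeasure μ (essSpectrum μ)) :
    LimsupLEUniformlyOnCompacts (rootOP μ) (greenFunction (essSpectrum μ)) := by
  intro K hK g hg hlt
  obtain ⟨R, _, hR⟩ := exists_norm_le_of_isCompact hcompact
  have hB := bddBy_of_support hR
  by_cases hcap : capacity (essSpectrum μ) = 0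
  · refine Eventually.of_forall fun n z hz => ?_
    have := hlt z hz
    rw [greenFunction_of_capacity_eq_zero hcap] at this
    exact absurd this not_top_lt
  have hrate := hreg.tendsto_rate hB hinf hE hcap
  by_contra hcon
  obtain ⟨N, hN, hNP⟩ := exists_strictMono_succ (not_eventually.1 hcon)
  push Not at hNP
  choose z hzK hz using hNP
  obtain ⟨z', hz'K, φ, hφ, hzlim⟩ := hK.tendsto_subseq hzK
  obtain ⟨ν, ψ, hψ, hν⟩ := exists_isZeroLimit hcompact hinf
    (hN.tendsto_atTop.comp hφ.tendsto_atTop)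
  have hzlim' : Tendsto (fun j => z (φ (ψ j))) atTop (𝓝 z') := hzlim.comp hψ.tendsto_atTop
  have hglim : Tendsto (fun j => g (z (φ (ψ j)))) atTop (𝓝 (g z')) :=
    (hg z' hz'K).tendsto.comp (tendsto_nhdsWithin_iff.2
      ⟨hzlim', Eventually.of_forall fun j => hzK _⟩)
  have hclim : Tendsto (fun j => rate μ (N (φ (ψ j)) + 1) - g (z (φ (ψ j)))) atTop
      (𝓝 (robin (essSpectrum μ) - g z')) :=
    (hrate.comp ((tendsto_add_atTop_nat 1).comp hν.tendsto_atTop)).sub hglim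
  have h1 := hν.potential_le hR hinf hzlim' hclim (Frequently.of_forall fun j => by
    have := hz (φ (ψ j))
    rw [← not_le, rootOP_le_exp_iff hB hinf, not_le] at this
    exact this.le)
  have h2 := hν.equilibrium_le hcompact hinf hE hcap hrate z'
  exact absurd ((greenFunction_lt_iff hE hcap).1 (hlt z' hz'K)) (not_lt.2 (h2.trans h1))

lemma LimsupLEUniformlyOnCompacts.limsup_le {f : ℕ → ℂ → ℝ≥0∞} {G : ℂ → EReal}
    (h : LimsupLEUniformlyOnCompacts f G) (z : ℂ) :
    limsup (fun n => f n z) atTop ≤ EReal.exp (G z) :=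
  limsup_le_exp fun y hy => (h {z} isCompact_singleton (fun _ => y) continuousOn_const
    (by simpa using hy)).mono fun n hn => hn z rfl

lemma IsRegularMeasure.greenUpperBound (hcompact : IsCompact μ.support)
    (hinf : μ.support.Infinite) (hE : IsCompact (essSpectrum μ))
    (hreg : IsRegularMeasure μ (essSpectrum μ)) : GreenUpperBound μ (essSpectrum μ) :=
  have h := hreg.limsupLEUniformlyOnCompacts hcompact hinf hE
  ⟨fun z => h.limsup_le z, h⟩

/-- If the roots `|x_n|^{1/n}` are eventually small almost everywhere for a measure of finite
energy, so are the rates compared with the potential of a limit of zero counting measures. -/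
lemma IsZeroLimit.ae_le_potential {N : ℕ → ℕ} {ν : ProbabilityMeasure ℂ} (hν : IsZeroLimit μ N ν)
    {R : ℝ} (hR : ∀ z ∈ μ.support, ‖z‖ ≤ R) (hinf : μ.support.Infinite) {σ : Measure ℂ}
    [IsFiniteMeasure σ] (hσ : BddBy R σ) (hσE : FiniteEnergy σ) {v y : ℝ}
    (hrate : ∀ᶠ j in atTop, v ≤ rate μ (N j + 1))
    (hlim : ∀ᵐ z ∂σ, limsup (fun n => rootOP μ n z) atTop < EReal.exp (y : EReal)) :
    ∀ᵐ z ∂σ, ((v - y : ℝ) : EReal) ≤ potential (ν : Measure ℂ) z := by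
  refine ae_le_potential_of_tendsto hν.tendsto_nhds (fun i => bddBy_zeroMeasure hR hinf _)
    (hν.bddBy hR) hσ hσE ?_
  filter_upwards [hlim] with z hz
  have h1 : ∀ᶠ j in atTop, rootOP μ (N j + 1) z < EReal.exp (y : EReal) :=
    ((tendsto_add_atTop_nat 1).comp hν.tendsto_atTop).eventually (eventually_lt_of_limsup_lt hz)
  filter_upwards [h1, hrate] with j hj hj2
  exact (EReal.coe_le_coe_iff.2 (by linarith)).trans
    ((rootOP_le_exp_iff (bddBy_of_support hR) hinf _ _ _).1 hj.le)

lemma essSpectrum_subset_support (μ : Measure ℂ) : essSpectrum μ ⊆ μ.support := fun _ hz => hz.1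

/-- Only the upper bound on the rates uses the hypothesis. It is tested against the equilibrium
measure, which lives on `∂Ω` and does not see sets of capacity zero. -/
lemma BoundaryUpperBound.isRegularMeasure (hcompact : IsCompact μ.support)
    (hinf : μ.support.Infinite) (hE : IsCompact (essSpectrum μ))
    (hbd : BoundaryUpperBound μ (essSpectrum μ)) : IsRegularMeasure μ (essSpectrum μ) := by
  obtain ⟨R, _, hR⟩ := exists_norm_le_of_isCompact hcompact
  have hB := bddBy_of_support hR
  rw [isRegularMeasure_iff hB hinf]
  refine tendsto_order.2 ⟨fun a ha => ?_, fun b hb => ?_⟩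
  · obtain ⟨v, h1, h2⟩ := EReal.lt_iff_exists_real_btwn.1 ha
    exact (eventually_le_rate hcompact hinf hE h2).mono fun n hn =>
      h1.trans_le (EReal.coe_le_coe_iff.2 hn)
  · have hcap : capacity (essSpectrum μ) ≠ 0 := fun h0 => by
      rw [(capacity_eq_zero_iff _).1 h0] at hb
      exact not_top_lt hb
    have hρ := isEquilibriumMeasure_equilibriumMeasure hE hcap
    have hρp := hρ.1
    rw [← coe_robin hE hcap] at hb
    obtain ⟨v, h1, h2⟩ := EReal.lt_iff_exists_real_btwn.1 hb
    rw [EReal.coe_lt_coe_iff] at h1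
    by_contra hcon
    obtain ⟨N, hN, hNP⟩ := exists_strictMono_succ (not_eventually.1 hcon)
    obtain ⟨ν, φ, hφ, hν⟩ := exists_isZeroLimit hcompact hinf hN.tendsto_atTop
    have hρB : BddBy R (equilibriumMeasure (essSpectrum μ)) :=
      bddBy_of_measure_compl (fun z hz => hR z (essSpectrum_subset_support μ hz)) hρ.measure_compl
    -- Half of the gap: the roots are eventually below `e^η`, which still leaves the potential of
    -- `ν` at least `v - η > robin (essSpectrum μ)`.
    set η := (v - robin (essSpectrum μ)) / 2 with hη
    have hη0 : 0 < η := by rw [hη]; linarith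
    have h3 := hν.ae_le_potential hR hinf hρB (hρ.finiteEnergy hE hcap) (v := v) (y := η)
      (Eventually.of_forall fun j => by
        have := hNP (φ j)
        exact EReal.coe_le_coe_iff.1 (h2.le.trans (not_lt.1 this)))
      (by
        filter_upwards [hbd.ae hρB (hρ.finiteEnergy hE hcap) (hρ.ae_mem_frontier hE hcap)] with z hz
        refine hz.trans_lt ?_
        rw [EReal.one_lt_exp_iff]
        exact_mod_cast hη0)
    have h4 := le_of_ae_le_potential (hν.bddBy hR) hρB (L := robin (essSpectrum μ)) (fun n => by
      rw [integral_tpot_comm (hν.bddBy hR) hρB]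
      exact integral_tpot_le_of_ae hρB (hν.bddBy hR)
        (Eventually.of_forall fun z => hρ.potential_le hE hcap z) n) h3
    linarith

end

/-! ### Consequences of regularity -/

section
variable {μ : Measure ℂ} [IsFiniteMeasure μ]

/-- Off the hull, which carries all zeros, the potentials are truncated potentials at one fixed
level and so converge under weak limits. Every limit measure gives the equilibrium potential there.
-/
lemma tendsto_rootOP_of_notMem (hcompact : IsCompact μ.support) (hinf : μ.support.Infinite)
    (hE : IsCompact (essSpectrum μ)) (hreg : IsRegularMeasure μ (essSpectrum μ)) {z : ℂ}
    (hz : z ∉ closedConvexHull ℝ μ.support) :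
    Tendsto (fun n => rootOP μ n z) atTop
      (𝓝 (EReal.exp (greenFunction (essSpectrum μ) z))) := by
  obtain ⟨R, _, hR⟩ := exists_norm_le_of_isCompact hcompact
  have hB := bddBy_of_support hR
  have hH := isCompact_closedConvexHull_support hcompact
  have hHne : (closedConvexHull ℝ μ.support).Nonempty :=
    hinf.nonempty.mono subset_closedConvexHull
  obtain ⟨k, hk⟩ : ∃ k : ℕ, ∀ w ∈ closedConvexHull ℝ μ.support, Real.exp (-k) ≤ ‖z - w‖ := by
    have hd := (hH.isClosed.notMem_iff_infDist_pos hHne).1 hz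
    obtain ⟨k, hk⟩ := exists_nat_gt (-Real.log (Metric.infDist z (closedConvexHull ℝ μ.support)))
    refine ⟨k, fun w hw => ?_⟩
    rw [← dist_eq_norm]
    refine le_trans ?_ (Metric.infDist_le_dist_of_mem hw)
    rw [← Real.le_log_iff_exp_le hd]
    linarith
  have hpot : ∀ κ : Measure ℂ, IsProbabilityMeasure κ →
      κ (closedConvexHull ℝ μ.support)ᶜ = 0 → potential κ z = tpot k κ z := fun κ _ hκ =>
    potential_eq_tpot (bddBy_of_closedConvexHull hR hκ) (by
      filter_upwards [show ∀ᵐ w ∂κ, w ∈ closedConvexHull ℝ μ.support from hκ] with w hw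
        using hk w hw)
  have hlog : ∀ n, ENNReal.log (rootOP μ (n + 1) z) =
      ((rate μ (n + 1) - tpot k (zeroMeasure μ n) z : ℝ) : EReal) := fun n => by
    rw [log_rootOP hB hinf, hpot _ inferInstance (zeroMeasure_compl hB hinf n), EReal.coe_sub]
  suffices h : Tendsto (fun n => ((rate μ (n + 1) - tpot k (zeroMeasure μ n) z : ℝ) : EReal)) atTop
      (𝓝 (greenFunction (essSpectrum μ) z)) by
    rw [← tendsto_add_atTop_iff_nat 1]
    have h1 := (ENNReal.continuous_exp.tendsto _).comp h
    refine h1.congr fun n => ?_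
    rw [Function.comp_apply, ← hlog, ENNReal.exp_log]
  by_cases hcap : capacity (essSpectrum μ) = 0
  -- The rates tend to `+∞` while the potentials at level `k` stay at most `k`.
  · rw [greenFunction_of_capacity_eq_zero hcap, EReal.tendsto_nhds_top_iff_real]
    intro x
    rw [isRegularMeasure_iff hB hinf, (capacity_eq_zero_iff _).1 hcap,
      EReal.tendsto_nhds_top_iff_real] at hreg
    filter_upwards [(tendsto_add_atTop_nat 1).eventually (hreg (x + k))] with n hn
    rw [EReal.coe_lt_coe_iff] at hn ⊢
    have := tpot_le (bddBy_zeroMeasure hR hinf n) k z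
    rw [probReal_univ, mul_one] at this
    linarith
  · have hρ := isEquilibriumMeasure_equilibriumMeasure hE hcap
    have hρp := hρ.1
    have hρH : equilibriumMeasure (essSpectrum μ) (closedConvexHull ℝ μ.support)ᶜ = 0 :=
      measure_mono_null (Set.compl_subset_compl.2
        ((essSpectrum_subset_support μ).trans subset_closedConvexHull)) hρ.measure_compl
    have hrate := hreg.tendsto_rate hB hinf hE hcap
    rw [greenFunction_eq hE hcap, hpot _ hρp hρH, ← EReal.coe_sub, EReal.tendsto_coe]
    refine (hrate.comp (tendsto_add_atTop_nat 1)).sub (tendsto_of_subseq_tendsto fun N hN => ?_)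
    obtain ⟨ν, φ, hφ, hν⟩ := exists_isZeroLimit hcompact hinf hN
    refine ⟨φ, ?_⟩
    have h1 := potential_eq_of_notMem_convex hH convex_closedConvexHull hHne hρH hν.measure_compl
      (hν.equilibrium_le hcompact hinf hE hcap hrate) hz
    rw [hpot _ hρp hρH, hpot _ inferInstance hν.measure_compl, EReal.coe_eq_coe_iff] at h1
    rw [h1]
    exact tendsto_tpot hν.tendsto_nhds (fun i => bddBy_zeroMeasure hR hinf _) (hν.bddBy hR) k
      tendsto_const_nhds

lemma measurable_rootOP (μ : Measure ℂ) (n : ℕ) : Measurable (rootOP μ n) := by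
  have : Continuous fun z => (orthonormalOP μ n).eval z := by fun_prop
  exact this.enorm.measurable.pow_const _

/-- If a measure of finite energy charged the set where the limsup is below `1`, the lower envelope
theorem would push the potential of a zero limit above the Robin constant on part of `∂Ω`. -/
lemma quasiEverywhereOn_limsup_eq_one (hcompact : IsCompact μ.support)
    (hinf : μ.support.Infinite) (hE : IsCompact (essSpectrum μ))
    (hreg : IsRegularMeasure μ (essSpectrum μ)) :
    QuasiEverywhereOn (frontier (unboundedComponent (essSpectrum μ)))
      fun z => limsup (fun n => rootOP μ n z) atTop = 1 := by
  by_cases hcap : capacity (essSpectrum μ) = 0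
  · refine ⟨_, hE.measurableSet, hcap, fun z hz => ?_⟩
    exact absurd (frontier_unboundedComponent_subset hE.isClosed hz.1) hz.2
  obtain ⟨R, _, hR⟩ := exists_norm_le_of_isCompact hcompact
  have hB := bddBy_of_support hR
  have hrate := hreg.tendsto_rate hB hinf hE hcap
  have hmeas : Measurable fun z => limsup (fun n => rootOP μ n z) atTop :=
    Measurable.limsup fun n => measurable_rootOP μ n
  have hBm : MeasurableSet (frontier (unboundedComponent (essSpectrum μ))) :=
    isClosed_frontier.measurableSet
  refine ⟨frontier (unboundedComponent (essSpectrum μ)) ∩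
    {z | limsup (fun n => rootOP μ n z) atTop ≠ 1},
    hBm.inter (hmeas (measurableSet_singleton 1)).compl, ?_, fun z hz => ?_⟩
  · refine capacity_eq_zero_of_forall fun σ R' hσp hσ hσE hσc hsupp => ?_
    have hσae : ∀ᵐ z ∂σ, z ∈ σ.support := Measure.support_mem_ae
    have hle : ∀ᵐ z ∂σ, limsup (fun n => rootOP μ n z) atTop ≤ 1 :=
      ((hreg.greenUpperBound hcompact hinf hE).boundaryUpperBound hE).ae hσ hσE
        (by filter_upwards [hσae] with z hz using (hsupp hz).1)
    have hnull : ∀ m : ℕ, σ {z | limsup (fun n => rootOP μ n z) atTop <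
        EReal.exp ((-(1 / ((m : ℝ) + 1)) : ℝ) : EReal)} = 0 := by
      intro m
      set A := {z | limsup (fun n => rootOP μ n z) atTop <
        EReal.exp ((-(1 / ((m : ℝ) + 1)) : ℝ) : EReal)} with hA
      have hAm : MeasurableSet A := measurableSet_lt hmeas measurable_const
      have hm0 : (0 : ℝ) < 1 / ((m : ℝ) + 1) := by positivity
      -- A single weak limit suffices: a strict upper bound for the full limsup holds eventually
      -- along every subsequence.
      obtain ⟨ν, φ, hφ, hν⟩ := exists_isZeroLimit hcompact hinf (N := id) tendsto_id
      have hlim := hrate.comp ((tendsto_add_atTop_nat 1).comp hν.tendsto_atTop)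
      have hRR : ∀ z ∈ μ.support, ‖z‖ ≤ max R R' := fun z hz => (hR z hz).trans (le_max_left _ _)
      have h1 := hν.ae_le_potential hRR hinf
        ((hσ.mono (le_max_right R R')).restrict A) (hσE.restrict hσ A)
        (v := robin (essSpectrum μ) - 1 / ((m : ℝ) + 1) / 2) (y := -(1 / ((m : ℝ) + 1)))
        (hlim.eventually (le_mem_nhds (by linarith))) (ae_restrict_mem hAm)
      have h2 : ∀ᵐ z ∂(σ.restrict A), False := by
        filter_upwards [h1, ae_restrict_of_ae hσae] with z hz hzs
        have h3 := hν.potential_le_of_tendsto_rate hcompact hinf hE hlim z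
          (frontier_subset_closure (hsupp hzs).1)
        have h4 := EReal.coe_le_coe_iff.1 (hz.trans h3)
        linarith
      simpa using h2
    have hcon : ∀ᵐ z ∂σ, False := by
      filter_upwards [hσae, hle, ae_all_iff.2 fun m => measure_eq_zero_iff_ae_notMem.1 (hnull m)]
        with z hzs hz1 hzm
      have hlt : limsup (fun n => rootOP μ n z) atTop < 1 := lt_of_le_of_ne hz1 (hsupp hzs).2
      have hneg : ENNReal.log (limsup (fun n => rootOP μ n z) atTop) < ((0 : ℝ) : EReal) := by
        rw [EReal.coe_zero]
        exact ENNReal.log_lt_zero_iff.2 hlt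
      obtain ⟨y, hy1, hy2⟩ := EReal.lt_iff_exists_real_btwn.1 hneg
      rw [EReal.coe_lt_coe_iff] at hy2
      obtain ⟨m, hm⟩ := exists_nat_one_div_lt (neg_pos.2 hy2)
      refine hzm m ?_
      rw [← ENNReal.exp_log (limsup (fun n => rootOP μ n z) atTop)]
      exact EReal.exp_lt_exp_iff.2 (hy1.trans (EReal.coe_lt_coe_iff.2 (by linarith)))
    exact (IsProbabilityMeasure.ne_zero σ) (by simpa using hcon)
  · by_contra hne
    exact hz.2 ⟨hz.1, hne⟩

lemma ofReal_rpow_le_exp_iff {t y : ℝ} {n : ℕ} (hn : 0 < n) :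
    ENNReal.ofReal t ^ ((1 : ℝ) / n) ≤ EReal.exp (y : EReal) ↔ t ≤ Real.exp (y * n) := by
  have hn' : (0 : ℝ) < n := by exact_mod_cast hn
  rw [one_div, ENNReal.rpow_inv_le_iff hn', EReal.exp_coe, ENNReal.ofReal_rpow_of_pos (Real.exp_pos _),
    ← Real.exp_mul, ENNReal.ofReal_le_ofReal_iff (Real.exp_pos _).le]

lemma eventually_add_le_exp (A : ℝ) {δ : ℝ} (hδ : 0 < δ) :
    ∀ᶠ n : ℕ in atTop, A + (n + 1) ≤ Real.exp (δ * n) := by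
  have h1 : ∀ᶠ n : ℕ in atTop, |A| + 2 ≤ δ ^ 2 / 4 * n :=
    (tendsto_natCast_atTop_atTop.const_mul_atTop (by positivity)).eventually_ge_atTop _
  filter_upwards [h1, eventually_ge_atTop 1] with n hn hn1
  have hn1' : (1 : ℝ) ≤ n := by exact_mod_cast hn1
  have h2 : Real.exp (δ * n) = Real.exp (δ * n / 2) ^ 2 := by
    rw [← Real.exp_nat_mul]
    congr 1
    push_cast
    ring
  have h3 := Real.add_one_le_exp (δ * n / 2)
  have h4 : (δ * n / 2) ^ 2 ≤ Real.exp (δ * n / 2) ^ 2 :=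
    pow_le_pow_left₀ (by positivity) (by linarith) 2
  have h5 : (|A| + 2) * n ≤ δ ^ 2 / 4 * n * n := by gcongr
  rw [h2]
  refine le_trans ?_ h4
  nlinarith [le_abs_self A, abs_nonneg A]

-- Each coefficient of `Q` in the orthonormal basis is at most the norm of `Q`. This crude form of
-- Bessel's inequality is enough under `n`-th roots.
open Polynomial in
lemma norm_eval_le_sum {R : ℝ} (h : BddBy R μ) (hinf : μ.support.Infinite) {n : ℕ} {Q : ℂ[X]}
    (hQ : Q.natDegree ≤ n) (z : ℂ) : ‖Q.eval z‖ ≤ Real.sqrt (normSqL2 μ Q) *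
      ∑ k ∈ Finset.range (n + 1), ‖(monicOP μ k).eval z‖ / opNorm μ k := by
  obtain ⟨c, hc⟩ := exists_eq_sum_monicOP μ (n + 1) Q
    (degree_lt_iff_coeff_zero _ _ |>.2 fun m hm => coeff_eq_zero_of_natDegree_lt (by omega))
  have hle : ∀ k ∈ Finset.range (n + 1), ‖c k‖ * opNorm μ k ≤ Real.sqrt (normSqL2 μ Q) := by
    intro k hk
    have := normSqL2_coeff_le h hinf (n + 1) c (Finset.mem_range.1 hk)
    rw [← hc] at this
    refine Real.le_sqrt_of_sq_le ?_
    rwa [mul_pow, opNorm, Real.sq_sqrt (normSqL2_nonneg _ _)]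
  conv_lhs => rw [hc]
  rw [eval_finsetSum, Finset.mul_sum]
  refine norm_sum_le_of_le _ fun k hk => ?_
  have hop := opNorm_pos h hinf k
  rw [eval_mul, eval_C, norm_mul, ← mul_div_assoc, le_div_iff₀ hop]
  calc ‖c k‖ * ‖(monicOP μ k).eval z‖ * opNorm μ k
      = ‖c k‖ * opNorm μ k * ‖(monicOP μ k).eval z‖ := by ring
    _ ≤ _ := mul_le_mul_of_nonneg_right (hle k hk) (norm_nonneg _)

/-- The quotient is at most a sum of `n + 1` values `|x_k(z)|`, which exceeds `e^{yn}` by a factor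
growing at most linearly. -/
lemma limsup_eval_div_norm_le (hcompact : IsCompact μ.support) (hinf : μ.support.Infinite)
    {E : Set ℂ} (hE : IsCompact E) (hreg : GreenUpperBound μ E) {Q : ℕ → Polynomial ℂ}
    (hQ : ∀ n, Q n ≠ 0 ∧ (Q n).natDegree ≤ n) (z : ℂ) :
    limsup (fun n : ℕ => (‖(Q n).eval z‖ₑ / L2norm μ (Q n)) ^ ((1 : ℝ) / n)) atTop ≤
      EReal.exp (greenFunction E z) := by
  obtain ⟨R, _, hR⟩ := exists_norm_le_of_isCompact hcompact
  have hB := bddBy_of_support hR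
  refine limsup_le_exp fun y' hy' => ?_
  obtain ⟨y, hy, hyy'⟩ := EReal.lt_iff_exists_real_btwn.1 hy'
  rw [EReal.coe_lt_coe_iff] at hyy'
  -- Positivity of `y`, a consequence of `G_E ≥ 0`, is what bounds the terms `e^{yk}` with `k ≤ n`
  -- by `e^{yn}`.
  have hy0 := nonneg_of_greenFunction_lt hE hy
  have hev : ∀ᶠ k in atTop, rootOP μ k z < EReal.exp (y : EReal) :=
    eventually_lt_of_limsup_lt ((hreg.1 z).trans_lt (EReal.exp_lt_exp_iff.2 hy))
  obtain ⟨k₀, hk₀⟩ := eventually_atTop.1 (hev.and (eventually_gt_atTop 0))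
  set a : ℕ → ℝ := fun k => ‖(monicOP μ k).eval z‖ / opNorm μ k with ha
  have ha0 : ∀ k, 0 ≤ a k := fun k => div_nonneg (norm_nonneg _) (opNorm_pos hB hinf k).le
  have hak : ∀ k ≥ k₀, a k ≤ Real.exp (y * k) := by
    intro k hk
    obtain ⟨h1, h2⟩ := hk₀ k hk
    rw [rootOP, ← ofReal_norm, norm_eval_orthonormalOP hB] at h1
    exact (ofReal_rpow_le_exp_iff h2).1 h1.le
  set A := ∑ k ∈ Finset.range k₀, a k with hA
  have hA0 : 0 ≤ A := Finset.sum_nonneg fun k _ => ha0 k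
  have hsum : ∀ n : ℕ, ∑ k ∈ Finset.range (n + 1), a k ≤ (A + (n + 1)) * Real.exp (y * n) := by
    intro n
    have hbound : ∀ k ∈ Finset.range (n + 1), a k ≤
        (if k < k₀ then a k else 0) + Real.exp (y * n) := by
      intro k hk
      have hkn : (k : ℝ) ≤ n := by exact_mod_cast Nat.lt_succ_iff.1 (Finset.mem_range.1 hk)
      split_ifs with hlt
      · linarith [Real.exp_pos (y * n)]
      · rw [zero_add]
        exact (hak k (not_lt.1 hlt)).trans (Real.exp_le_exp.2 (by gcongr))
    refine (Finset.sum_le_sum hbound).trans ?_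
    rw [Finset.sum_add_distrib, Finset.sum_const, Finset.card_range, nsmul_eq_mul]
    have h1 : ∑ k ∈ Finset.range (n + 1), (if k < k₀ then a k else 0) ≤ A := by
      rw [← Finset.sum_filter]
      exact Finset.sum_le_sum_of_subset_of_nonneg
        (fun k hk => Finset.mem_range.2 (Finset.mem_filter.1 hk).2) fun k _ _ => ha0 k
    have h2 : 1 ≤ Real.exp (y * n) := Real.one_le_exp (by positivity)
    push_cast
    nlinarith
  filter_upwards [eventually_add_le_exp A (sub_pos.2 hyy'), eventually_gt_atTop 0] with n hn hn0
  have hpos : 0 < Real.sqrt (normSqL2 μ (Q n)) :=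
    Real.sqrt_pos.2 (lt_of_le_of_ne (normSqL2_nonneg _ _) fun h0 =>
      (hQ n).1 (eq_zero_of_normSqL2 hB hinf h0.symm))
  rw [L2norm_eq hB, ← ofReal_norm, ← ENNReal.ofReal_div_of_pos hpos, ofReal_rpow_le_exp_iff hn0,
    div_le_iff₀ hpos]
  refine (norm_eval_le_sum hB hinf (hQ n).2 z).trans ?_
  rw [mul_comm]
  refine mul_le_mul_of_nonneg_right ((hsum n).trans ?_) hpos.le
  calc (A + (n + 1)) * Real.exp (y * n) ≤ Real.exp ((y' - y) * n) * Real.exp (y * n) := by gcongr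
    _ = Real.exp (y' * n) := by rw [← Real.exp_add]; ring_nf

end

end

end OPRegular

theorem theorem1p8 (μ : Measure ℂ) [IsFiniteMeasure μ] (E : Set ℂ) (hE : IsCompact E)
    (hcompact : IsCompact μ.support) (hinf : μ.support.Infinite) (hess : essSpectrum μ = E) :
    List.TFAE [IsRegularMeasure μ E, GreenUpperBound μ E, BoundaryUpperBound μ E] ∧
    (IsRegularMeasure μ E →
      (∀ z ∉ closedConvexHull ℝ μ.support,
        Tendsto (fun n => rootOP μ n z) atTop (𝓝 (EReal.exp (greenFunction E z)))) ∧
      QuasiEverywhereOn (frontier (unboundedComponent E))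
        (fun z => limsup (fun n => rootOP μ n z) atTop = 1) ∧
      (∀ Q : ℕ → Polynomial ℂ, (∀ n, Q n ≠ 0 ∧ (Q n).natDegree ≤ n) →
        ∀ z : ℂ, limsup (fun n : ℕ => (‖(Q n).eval z‖ₑ / L2norm μ (Q n)) ^ ((1 : ℝ) / n)) atTop
          ≤ EReal.exp (greenFunction E z))) := by
  subst hess
  refine ⟨?_, fun hreg => ⟨fun z hz => tendsto_rootOP_of_notMem hcompact hinf hE hreg hz,
    quasiEverywhereOn_limsup_eq_one hcompact hinf hE hreg, fun Q hQ z =>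
    limsup_eval_div_norm_le hcompact hinf hE (hreg.greenUpperBound hcompact hinf hE) hQ z⟩⟩
  tfae_have 1 → 2 := fun h => h.greenUpperBound hcompact hinf hE
  tfae_have 2 → 3 := fun h => h.boundaryUpperBound hE
  tfae_have 3 → 1 := fun h => h.isRegularMeasure hcompact hinf hE
  tfae_finish
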